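/- Let $0\le N\le M$, let $\eta,\xi_1,\dots,\xi_M\in\mathbb C$, and write $\operatorname{sh}=\sinh$. On the Fock space of fermionic modes with $\{c_i,c_j\}=\{c_i^\dagger,c_j^\dagger\}=0$, $\{c_i^\dagger,c_j\}=\delta_{ij}$, $n_i=c_i^\dagger c_i$, let $$R_{ij}(u)=1-n_i-n_j+\frac{\operatorname{sh}u}{\operatorname{sh}(u+\eta)}(n_i+n_j-2n_in_j)+\frac{\operatorname{sh}\eta}{\operatorname{sh}(u+\eta)}(c_i^\dagger c_j+c_j^\dagger c_i).$$ With one auxiliary mode $a$ and $M$ lattice modes $1,\dots,M$ let $$T(u)=R_{aM}(u-\xi_M)\cdots R_{a1}(u-\xi_1)=A(u)(1-n_a)+B(u)c_a+c_a^\dagger C(u)+D(u)n_a ,$$ where $A,B,C,D$ act on the lattice Fock space; equivalently $B(u)={}_a\langle0|T(u)c_a^\dagger|0\rangle_a$ and $C(u)={}_a\langle0|c_aT(u)|0\rangle_a$. Let $|\Omega\rangle$ be the vacuum of the lattice Fock space and $$\mathbb S_N(\{\mu\}|\{\lambda\})=\langle\Omega|\prod_{j=1}^NC(\mu_j)\prod_{j=1}^NB(\lambda_j)|\Omega\rangle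 .$$ Put $$d(u)=\prod_{m=1}^M\frac{\operatorname{sh}(u-\xi_m)}{\operatorname{sh}(u-\xi_m+\eta)},\qquad t(u,v)=\frac{\operatorname{sh}\eta}{\operatorname{sh}(u-v)\operatorname{sh}(u-v+\eta)}.$$ Let $\lambda_1,\dots,\lambda_N\in\mathbb C$ be Bethe roots, i.e. for all $j$ $$(-1)^{N+1}=d(\lambda_j)\prod_{k\ne j}\frac{\operatorname{sh}(\lambda_j-\lambda_k+\eta)}{\operatorname{sh}(\lambda_j-\lambda_k-\eta)}$$ with non-vanishing denominators, and let $\mu_1,\dots,\mu_N$ be arbitrary complex numbers, subject only to $\operatorname{sh}(\mu_j-\xi_m+\eta)\ne0$ for all $j,m$ (so that $B(\mu_j)$, $C(\mu_j)$ are defined). Then $$\mathbb S_N(\{\mu\}|\{\lambda\})=\mathbb S_N(\{\lambda\}|\{\mu\}),$$ and, whenever the denominators below do not vanish, that is, $\operatorname{sh}(\lambda_a-\lambda_b)\ne0$ and $\operatorname{sh}(\mu_a-\mu_b)\neq0$ for $a\ne b$, and $\operatorname{sh}(\lambda_a-\mu_b)\ne 0$, $\operatorname{sh}(\lambda_a-\mu_b+\eta)\ne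 0$, $\operatorname{sh}(\mu_b-\lambda_a+\eta)\ne0$ for all $a,b$, $$\mathbb S_N(\{\mu\}|\{\lambda\})=(-1)^{\frac{N(N-1)}2}\,\frac{\prod_{a,b=1}^N\operatorname{sh}(\lambda_a-\mu_b+\eta)}{\prod_{1\le a<b\le N}\operatorname{sh}(\lambda_a-\lambda_b)\operatorname{sh}(\mu_b-\mu_a)}\,\det\Psi,$$ where $\Psi$ is the $N\times N$ matrix $$\Psi_{jk}=t(\lambda_j,\mu_k)-(-1)^{N+1}d(\mu_k)\,t(\mu_k,\lambda_j)\prod_{a=1}^N\frac{\operatorname{sh}(\mu_k-\lambda_a+\eta)}{\operatorname{sh}(\mu_k-\lambda_a-\eta)} .$$ -/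

import Mathlib

namespace SpinlessFermion

open Complex

noncomputable section

/-- The fermionic Fock space over a family of modes `ι`: the exterior algebra of `ℂ^ι`.
Its unit `1` is the vacuum. -/
abbrev Fock (ι : Type) : Type := ExteriorAlgebra ℂ (ι → ℂ)

/-- Creation operator `c†_i`: exterior multiplication by the basis vector `e_i`. -/
def create {ι : Type} [DecidableEq ι] (i : ι) : Module.End ℂ (Fock ι) :=
  LinearMap.mulLeft ℂ (ExteriorAlgebra.ι ℂ (Pi.single i (1 : ℂ)))

/-- Annihilation operator `c_i`: interior product with the `i`-th coordinate functional. -/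
def annihilate {ι : Type} (i : ι) : Module.End ℂ (Fock ι) :=
  CliffordAlgebra.contractLeft (LinearMap.proj i : (ι → ℂ) →ₗ[ℂ] ℂ)

/-- Number operator `n_i = c†_i c_i`. -/
def number {ι : Type} [DecidableEq ι] (i : ι) : Module.End ℂ (Fock ι) :=
  create i * annihilate i

/-- The canonical anticommutation relation `{c†_i, c_j} = δ_ij`. -/
theorem create_annihilate {ι : Type} [DecidableEq ι] (i j : ι) :
    create i * annihilate j + annihilate j * create i =
      (if i = j then (1 : Module.End ℂ (Fock ι)) else 0) := by
  refine LinearMap.ext fun x => ?_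
  simp only [create, annihilate, LinearMap.add_apply, Module.End.mul_apply,
    LinearMap.mulLeft_apply, ExteriorAlgebra.ι, CliffordAlgebra.contractLeft_ι_mul,
    LinearMap.proj_apply, Pi.single_apply]
  by_cases h : i = j
  · subst h; simp
  · simp [h, Ne.symm h]

/-- The canonical anticommutation relation `{c†_i, c†_j} = 0`. -/
theorem create_create {ι : Type} [DecidableEq ι] (i j : ι) :
    create i * create j + create j * create i = (0 : Module.End ℂ (Fock ι)) := by
  refine LinearMap.ext fun x => ?_
  simp only [create, LinearMap.add_apply, Module.End.mul_apply, LinearMap.mulLeft_apply,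
    ← mul_assoc, ← add_mul, ExteriorAlgebra.ι_add_mul_swap, zero_mul, LinearMap.zero_apply]

/-- The canonical anticommutation relation `{c_i, c_j} = 0`. -/
theorem annihilate_annihilate {ι : Type} (i j : ι) :
    annihilate i * annihilate j + annihilate j * annihilate i =
      (0 : Module.End ℂ (Fock ι)) := by
  refine LinearMap.ext fun x => ?_
  simp only [annihilate, LinearMap.add_apply, Module.End.mul_apply, LinearMap.zero_apply]
  rw [CliffordAlgebra.contractLeft_comm, neg_add_cancel]

/-- The vacuum `|Ω⟩` is annihilated by every `c_i`. -/
theorem annihilate_vacuum {ι : Type} (i : ι) : annihilate i (1 : Fock ι) = 0 := by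
  simp only [annihilate]
  exact CliffordAlgebra.contractLeft_one 0 _

/-- The fermionic `R`-operator `R_{ij}(u)` with crossing parameter `η`. -/
def rOperator {ι : Type} [DecidableEq ι] (η : ℂ) (i j : ι) (u : ℂ) :
    Module.End ℂ (Fock ι) :=
  1 - number i - number j
    + (sinh u / sinh (u + η)) • (number i + number j - (2 : ℂ) • (number i * number j))
    + (sinh η / sinh (u + η)) • (create i * annihilate j + create j * annihilate i)

/-- The monodromy operator `T(u) = L_M(u) ⋯ L_2(u) L_1(u)`, `L_m(u) = R_{am}(u - ξ_m)`.
The auxiliary mode `a` is `none`, the `M` sites of the lattice are `some m`. -/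
def monodromy {M : ℕ} (η : ℂ) (ξ : Fin M → ℂ) (u : ℂ) :
    Module.End ℂ (Fock (Option (Fin M))) :=
  (List.ofFn fun m : Fin M => rOperator η none (some m) (u - ξ m)).reverse.prod

/-- `φ ↦ |0⟩_a φ`, from the Fock space of the lattice to that of the lattice together with
the auxiliary mode. -/
def auxKet (M : ℕ) : Fock (Fin M) →ₗ[ℂ] Fock (Option (Fin M)) :=
  (ExteriorAlgebra.map (Function.ExtendByZero.linearMap ℂ (some : Fin M → Option (Fin M)))
    ).toLinearMap

/-- The partial contraction with `_a⟨0|`: it kills the vectors `c†_a ψ` and is left inverse to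
`auxKet`. -/
def auxBra (M : ℕ) : Fock (Option (Fin M)) →ₗ[ℂ] Fock (Fin M) :=
  (ExteriorAlgebra.map (LinearMap.funLeft ℂ ℂ (some : Fin M → Option (Fin M)))).toLinearMap

/-- The entry `B(u) = _a⟨0| T(u) |1⟩_a`, `|1⟩_a = c†_a |0⟩_a`, of the decomposition
`T = A (1 - n_a) + B c_a + c†_a C + D n_a`. -/
def opB {M : ℕ} (η : ℂ) (ξ : Fin M → ℂ) (u : ℂ) : Module.End ℂ (Fock (Fin M)) :=
  auxBra M ∘ₗ (monodromy η ξ u * create none) ∘ₗ auxKet M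

/-- The entry `C(u) = _a⟨1| T(u) |0⟩_a`, `_a⟨1| = _a⟨0| c_a`, of the decomposition
`T = A (1 - n_a) + B c_a + c†_a C + D n_a`. -/
def opC {M : ℕ} (η : ℂ) (ξ : Fin M → ℂ) (u : ℂ) : Module.End ℂ (Fock (Fin M)) :=
  auxBra M ∘ₗ (annihilate none * monodromy η ξ u) ∘ₗ auxKet M

/-- The vacuum expectation value `⟨Ω| X |Ω⟩`: the component of `X|Ω⟩` of degree zero. -/
def vacuumExpectation {M : ℕ} (X : Module.End ℂ (Fock (Fin M))) : ℂ :=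
  ExteriorAlgebra.algebraMapInv (X 1)

/-- The scalar product `S_N({μ}|{l}) = ⟨Ω| C(μ_1) ⋯ C(μ_N) B(l_1) ⋯ B(l_N) |Ω⟩`. -/
def scalarProduct {M N : ℕ} (η : ℂ) (ξ : Fin M → ℂ) (μ l : Fin N → ℂ) : ℂ :=
  vacuumExpectation
    ((List.ofFn fun j => opC η ξ (μ j)).prod * (List.ofFn fun j => opB η ξ (l j)).prod)

/-- The vacuum eigenvalue `d(u)` (while `a(u) = 1`). -/
def dVac {M : ℕ} (η : ℂ) (ξ : Fin M → ℂ) (u : ℂ) : ℂ :=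
  ∏ m, sinh (u - ξ m) / sinh (u - ξ m + η)

/-- `l_1, …, l_N` are Bethe roots: they solve the Bethe ansatz equations, whose denominators
do not vanish. -/
structure IsBetheRoots {M N : ℕ} (η : ℂ) (ξ : Fin M → ℂ) (l : Fin N → ℂ) : Prop where
  regular_site : ∀ j m, sinh (l j - ξ m + η) ≠ 0
  regular_pair : ∀ j k, j ≠ k → sinh (l j - l k - η) ≠ 0
  equation : ∀ j, (-1 : ℂ) ^ (N + 1) =
    (∏ m, sinh (l j - ξ m) / sinh (l j - ξ m + η)) *
      ∏ k ∈ Finset.univ.erase j, sinh (l j - l k + η) / sinh (l j - l k - η)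

/-- `t(u, v) = sh η / (sh (u - v) sh (u - v + η))`. -/
def tFun (η u v : ℂ) : ℂ := sinh η / (sinh (u - v) * sinh (u - v + η))

/-- The matrix `Ψ({μ}|{l})`. -/
def psiMatrix {M N : ℕ} (η : ℂ) (ξ : Fin M → ℂ) (μ l : Fin N → ℂ) :
    Matrix (Fin N) (Fin N) ℂ :=
  Matrix.of fun j k =>
    tFun η (l j) (μ k) -
      (-1 : ℂ) ^ (N + 1) * dVac η ξ (μ k) * tFun η (μ k) (l j) *
        ∏ a, sinh (μ k - l a + η) / sinh (μ k - l a - η)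

end

end SpinlessFermion

/-! The entries `A`, `B`, `C`, `D` of the monodromy matrix obey the exchange relations of the
six-vertex R-matrix up to fermionic signs. The vacuum is an eigenvector of `A` (eigenvalue 1) and of
`D` (eigenvalue d), and is killed by `C`. These facts, collected in `YBRep`, already determine the
scalar products at generic points: the operators `C` preserve the span of Bethe vectors up to
enlarging the point set, and a functional killing the range of every `B` is fixed on that span by
its value on the vacuum. Applied to a direct sum of two representations this gives
`YBRep.pairing_congr`; comparison with the dual representation, where `B` and `C` trade places,
gives the symmetry `YBRep.pairing_comm`.

For the determinant, let t be the Bethe roots, s a set of N+1 further points, and X(s∖k) the scalar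
product of t with s∖k. By the Bethe equations the dual Bethe vector of t is an eigenvector of A − D.
Letting A − D at a point j of s act to the left or to the right gives a linear relation among the
numbers X(s∖k). Weighting these relations by values of a trigonometric polynomial and summing over
j, interpolation collapses the double sum to ∑_k X(s∖k) w_k Ψ_{ik} / ∏_{l≠k} sinh(v_k − v_l) = 0,
one relation for each Bethe root i (`YBRep.slavnov_relation`). Up to normalisation this is the
Laplace expansion of a determinant with a repeated row. Hence the minors of Ψ solve the system, and
the solution is unique up to one constant as soon as one minor is nonzero (`exchange_relation_det`).

The constant is read off at reference points λ_k + η + ε that are declared to be zeros of d. The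
given lattice need not have such zeros, but only the values of d matter, and `exists_dVac_eq`
supplies another lattice with prescribed values. At zeros of d the scalar product satisfies a
one-step recursion (`YBRep.pairing_insert`). As ε → 0 a single term of it survives, the rescaled Ψ
becomes diagonal, and ∏ d(λ_j) = 1 by the Bethe equations. Remaining non-generic configurations
follow by continuity, and the case sinh η = 0 is checked directly. -/

namespace SpinlessFermion

open Complex

/-! ### Splitting off the auxiliary mode. -/

section Auxiliary

/-- Both sides follow the same antiderivation rule under left multiplication by a vector, so left
induction applies. This is what carries annihilation operators through `auxKet`. -/
theorem contractLeft_map {V W : Type} [AddCommGroup V] [Module ℂ V] [AddCommGroup W] [Module ℂ W]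
    (f : V →ₗ[ℂ] W) (d : W →ₗ[ℂ] ℂ) (x : ExteriorAlgebra ℂ V) :
    CliffordAlgebra.contractLeft (Q := (0 : QuadraticForm ℂ W)) d (ExteriorAlgebra.map f x) =
      ExteriorAlgebra.map f
        (CliffordAlgebra.contractLeft (Q := (0 : QuadraticForm ℂ V)) (d ∘ₗ f) x) := by
  induction x using CliffordAlgebra.left_induction with
  | algebraMap r =>
    rw [CliffordAlgebra.contractLeft_algebraMap]
    have : ExteriorAlgebra.map f (algebraMap ℂ (ExteriorAlgebra ℂ V) r) =
        algebraMap ℂ (ExteriorAlgebra ℂ W) r := AlgHom.commutes _ _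
    erw [this, CliffordAlgebra.contractLeft_algebraMap, map_zero]
  | add x y hx hy => simp only [map_add, hx, hy]
  | ι_mul x v hx =>
    rw [CliffordAlgebra.contractLeft_ι_mul, map_mul]
    have h : ExteriorAlgebra.map f (CliffordAlgebra.ι (0 : QuadraticForm ℂ V) v) =
        CliffordAlgebra.ι (0 : QuadraticForm ℂ W) (f v) := ExteriorAlgebra.map_apply_ι f v
    rw [h, CliffordAlgebra.contractLeft_ι_mul, hx, map_sub, map_mul, h, map_smul]
    rfl

variable {M : ℕ}

theorem extend_some (f : Fin M → ℂ) (i : Fin M) :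
    Function.extend (some : Fin M → Option (Fin M)) f 0 (some i) = f i :=
  (Option.some_injective _).extend_apply f 0 i

theorem auxKet_create (m : Fin M) (x : Fock (Fin M)) :
    auxKet M (create m x) = create (some m) (auxKet M x) := by
  simp only [auxKet, create, LinearMap.mulLeft_apply, AlgHom.toLinearMap_apply, map_mul,
    ExteriorAlgebra.map_apply_ι]
  congr 2
  ext i
  cases i with
  | none => simp
  | some i => simp [extend_some, Pi.single_apply]

theorem annihilate_none_auxKet (x : Fock (Fin M)) : annihilate none (auxKet M x) = 0 := by
  simp only [auxKet, annihilate, AlgHom.toLinearMap_apply]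
  rw [contractLeft_map]
  have : (LinearMap.proj none : (Option (Fin M) → ℂ) →ₗ[ℂ] ℂ) ∘ₗ
      Function.ExtendByZero.linearMap ℂ (some : Fin M → Option (Fin M)) = 0 := by
    ext i
    simp
  rw [this]
  simp

theorem auxKet_annihilate (m : Fin M) (x : Fock (Fin M)) :
    auxKet M (annihilate m x) = annihilate (some m) (auxKet M x) := by
  simp only [auxKet, annihilate, AlgHom.toLinearMap_apply]
  rw [contractLeft_map]
  have : (LinearMap.proj (some m) : (Option (Fin M) → ℂ) →ₗ[ℂ] ℂ) ∘ₗ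
      Function.ExtendByZero.linearMap ℂ (some : Fin M → Option (Fin M)) = LinearMap.proj m := by
    ext i
    simp [extend_some, Pi.single_apply]
  rw [this]

theorem auxBra_auxKet (x : Fock (Fin M)) : auxBra M (auxKet M x) = x := by
  simp only [auxKet, auxBra, AlgHom.toLinearMap_apply]
  rw [← AlgHom.comp_apply, ExteriorAlgebra.map_comp_map]
  have : (LinearMap.funLeft ℂ ℂ (some : Fin M → Option (Fin M))) ∘ₗ
      Function.ExtendByZero.linearMap ℂ (some : Fin M → Option (Fin M)) = LinearMap.id := by
    ext i j
    simp [extend_some, LinearMap.funLeft_apply]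
  rw [this, ExteriorAlgebra.map_id]
  rfl

theorem auxBra_create_none (x : Fock (Option (Fin M))) : auxBra M (create none x) = 0 := by
  simp only [auxBra, create, LinearMap.mulLeft_apply, AlgHom.toLinearMap_apply, map_mul,
    ExteriorAlgebra.map_apply_ι]
  have : LinearMap.funLeft ℂ ℂ (some : Fin M → Option (Fin M)) (Pi.single none 1) = 0 := by
    ext i
    simp [LinearMap.funLeft_apply]
  rw [this, map_zero, zero_mul]

end Auxiliary

/-! ### The monodromy operator as a 2 × 2 matrix over the lattice Fock space. -/

section Lax

/-- The `2 × 2` matrix `R_{am}` in the auxiliary mode, with entries in the mode `m`. -/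
noncomputable def lax {ι : Type} [DecidableEq ι] (η : ℂ) (m : ι) (u : ℂ) :
    Matrix (Fin 2) (Fin 2) (Module.End ℂ (Fock ι)) :=
  !![1 - number m + (sinh u / sinh (u + η)) • number m, (sinh η / sinh (u + η)) • create m;
     (sinh η / sinh (u + η)) • annihilate m, (sinh u / sinh (u + η)) • (1 - number m) - number m]

/-- Monodromy matrix over the Fock space of the lattice, for a list of sites. -/
noncomputable def monodromyMatrix {M : ℕ} (η : ℂ) (ξ : Fin M → ℂ) (u : ℂ) (s : List (Fin M)) :
    Matrix (Fin 2) (Fin 2) (Module.End ℂ (Fock (Fin M))) :=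
  (s.map fun m => lax η m (u - ξ m)).prod

theorem create_sq {ι : Type} [DecidableEq ι] (i : ι) (x : Fock ι) :
    create i (create i x) = 0 := by
  have := LinearMap.congr_fun (create_create i i) x
  have h : (2 : ℂ) • create i (create i x) = 0 := by
    rw [two_smul]
    exact this
  exact (smul_eq_zero.mp h).resolve_left two_ne_zero

theorem annihilate_create_apply {ι : Type} [DecidableEq ι] (i j : ι) (x : Fock ι) :
    annihilate j (create i x) = (if i = j then x else 0) - create i (annihilate j x) := by
  have := LinearMap.congr_fun (create_annihilate i j) x
  rw [eq_sub_iff_add_eq, add_comm]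
  refine Eq.trans this ?_
  split_ifs <;> simp

theorem create_create_apply {ι : Type} [DecidableEq ι] (i j : ι) (x : Fock ι) :
    create i (create j x) = - create j (create i x) := by
  have := LinearMap.congr_fun (create_create i j) x
  exact eq_neg_of_add_eq_zero_left this

variable {M : ℕ}

theorem rOperator_auxKet (η u : ℂ) (m : Fin M) (x : Fock (Fin M)) :
    rOperator η none (some m) u (auxKet M x) =
      auxKet M (lax η m u 0 0 x) + create none (auxKet M (lax η m u 1 0 x)) := by
  have h : annihilate none (annihilate (some m) (auxKet M x)) = 0 := by
    rw [← auxKet_annihilate, annihilate_none_auxKet]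
  simp only [rOperator, lax, number, auxKet_create, auxKet_annihilate, annihilate_none_auxKet, h,
    annihilate_create_apply, LinearMap.add_apply,
    LinearMap.sub_apply, LinearMap.smul_apply, Module.End.mul_apply, Module.End.one_apply, map_add,
    map_sub, map_smul, map_zero, Matrix.of_apply, Matrix.cons_val', Matrix.cons_val_zero,
    Matrix.cons_val_one, Matrix.cons_val_fin_one, reduceCtorEq, if_false, sub_zero]
  module

theorem rOperator_create_auxKet (η u : ℂ) (m : Fin M) (x : Fock (Fin M)) :
    rOperator η none (some m) u (create none (auxKet M x)) =
      auxKet M (lax η m u 0 1 x) + create none (auxKet M (lax η m u 1 1 x)) := by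
  simp only [rOperator, lax, number, auxKet_create, auxKet_annihilate, annihilate_none_auxKet,
    annihilate_create_apply, create_create_apply none (some m), create_sq, LinearMap.add_apply,
    LinearMap.sub_apply, LinearMap.smul_apply, Module.End.mul_apply, Module.End.one_apply,
    map_sub, map_smul, map_zero, if_true, Matrix.of_apply, Matrix.cons_val', Matrix.cons_val_zero,
    Matrix.cons_val_one, Matrix.cons_val_fin_one, reduceCtorEq, if_false, sub_zero, neg_zero]
  module

/-- The vectors `auxKet M x` and `create none (auxKet M x)` act as the two auxiliary basis states.
Each R-operator acts on this pair by its `lax` matrix, so the operator product becomes a matrix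
product. -/
theorem prod_rOperator_auxKet (η : ℂ) (ξ : Fin M → ℂ) (u : ℂ) (s : List (Fin M))
    (x : Fock (Fin M)) :
    ((s.map fun m => rOperator η none (some m) (u - ξ m)).prod (auxKet M x) =
      auxKet M (monodromyMatrix η ξ u s 0 0 x) +
        create none (auxKet M (monodromyMatrix η ξ u s 1 0 x))) ∧
    ((s.map fun m => rOperator η none (some m) (u - ξ m)).prod (create none (auxKet M x)) =
      auxKet M (monodromyMatrix η ξ u s 0 1 x) +
        create none (auxKet M (monodromyMatrix η ξ u s 1 1 x))) := by
  induction s with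
  | nil => simp [monodromyMatrix]
  | cons m s ih =>
    have hm : monodromyMatrix η ξ u (m :: s) =
        lax η m (u - ξ m) * monodromyMatrix η ξ u s := by simp [monodromyMatrix]
    simp only [List.map_cons, List.prod_cons, Module.End.mul_apply, ih.1, ih.2, map_add,
      rOperator_auxKet, rOperator_create_auxKet, hm, Matrix.mul_apply, Fin.sum_univ_two,
      LinearMap.add_apply]
    constructor <;> abel

/-- Sites in the order in which they enter the monodromy operator. -/
def sites (M : ℕ) : List (Fin M) := (List.finRange M).reverse

theorem monodromy_eq (η : ℂ) (ξ : Fin M → ℂ) (u : ℂ) :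
    monodromy η ξ u = ((sites M).map fun m => rOperator η none (some m) (u - ξ m)).prod := by
  rw [monodromy, sites, List.ofFn_eq_map, List.map_reverse]

theorem opB_eq (η : ℂ) (ξ : Fin M → ℂ) (u : ℂ) :
    opB η ξ u = monodromyMatrix η ξ u (sites M) 0 1 := by
  refine LinearMap.ext fun x => ?_
  simp [opB, monodromy_eq, (prod_rOperator_auxKet η ξ u (sites M) x).2, auxBra_auxKet,
    auxBra_create_none]

theorem opC_eq (η : ℂ) (ξ : Fin M → ℂ) (u : ℂ) :
    opC η ξ u = monodromyMatrix η ξ u (sites M) 1 0 := by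
  refine LinearMap.ext fun x => ?_
  simp [opC, monodromy_eq, (prod_rOperator_auxKet η ξ u (sites M) x).1, auxBra_auxKet,
    annihilate_none_auxKet, annihilate_create_apply]

end Lax

/-! ### Graded tensor products of 2 × 2 matrices. -/

section Graded

variable {R : Type*} [Ring R] [Algebra ℂ R]

/-- The graded product `T(u) ⊗ U(v)` of two `2 × 2` matrices with entries in a ring. -/
def gradedKron (T U : Matrix (Fin 2) (Fin 2) R) : Matrix (Fin 2 × Fin 2) (Fin 2 × Fin 2) R :=
  Matrix.of fun p q => (-1 : ℂ) ^ (((p.1 : ℕ) + q.1) * p.2) • (T p.1 q.1 * U p.2 q.2)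

/-- The graded product with the factors in the opposite order. -/
def gradedKronSwap (T U : Matrix (Fin 2) (Fin 2) R) : Matrix (Fin 2 × Fin 2) (Fin 2 × Fin 2) R :=
  Matrix.of fun p q => (-1 : ℂ) ^ (((p.2 : ℕ) + q.2) * p.1) • (U p.2 q.2 * T p.1 q.1)

/-- The entries of `T` and `L` commute in the graded sense. -/
def GradedCommute (T L : Matrix (Fin 2) (Fin 2) R) : Prop :=
  ∀ a k j b : Fin 2, T a k * L j b = (-1 : ℂ) ^ (((a : ℕ) + k) * (j + b)) • (L j b * T a k)

/-- The entry (a, k) has parity a + k. Moving an entry of `T` past one of `L'` costs the product of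
their parities, and the sign in `gradedKron` is chosen to absorb exactly this. -/
theorem gradedKron_mul {L T L' U : Matrix (Fin 2) (Fin 2) R} (h : GradedCommute T L') :
    gradedKron (L * T) (L' * U) = gradedKron L L' * gradedKron T U := by
  ext ⟨i, j⟩ ⟨k, l⟩
  simp only [gradedKron, Matrix.of_apply, Matrix.mul_apply, Finset.sum_mul_sum,
    Fintype.sum_prod_type, Finset.smul_sum]
  refine Finset.sum_congr rfl fun a _ => Finset.sum_congr rfl fun b _ => ?_
  have : L i a * T a k * (L' j b * U b l) =
      (-1 : ℂ) ^ (((a : ℕ) + k) * (j + b)) • (L i a * L' j b * (T a k * U b l)) := by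
    rw [mul_assoc, ← mul_assoc (T a k), h]
    simp only [smul_mul_assoc, mul_smul_comm, mul_assoc]
  rw [this, smul_mul_smul_comm, smul_smul]
  congr 1
  fin_cases i <;> fin_cases j <;> fin_cases k <;> fin_cases a <;> fin_cases b <;> norm_num

theorem gradedKronSwap_mul {L T L' U : Matrix (Fin 2) (Fin 2) R} (h : GradedCommute U L) :
    gradedKronSwap (L * T) (L' * U) = gradedKronSwap L L' * gradedKronSwap T U := by
  ext ⟨i, j⟩ ⟨k, l⟩
  simp only [gradedKronSwap, Matrix.of_apply, Matrix.mul_apply, Finset.sum_mul_sum,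
    Fintype.sum_prod_type, Finset.smul_sum]
  rw [Finset.sum_comm]
  refine Finset.sum_congr rfl fun a _ => Finset.sum_congr rfl fun b _ => ?_
  have : L' j b * U b l * (L i a * T a k) =
      (-1 : ℂ) ^ (((b : ℕ) + l) * (i + a)) • (L' j b * L i a * (U b l * T a k)) := by
    rw [mul_assoc, ← mul_assoc (U b l), h]
    simp only [smul_mul_assoc, mul_smul_comm, mul_assoc]
  rw [this, smul_mul_smul_comm, smul_smul]
  congr 1
  fin_cases i <;> fin_cases j <;> fin_cases l <;> fin_cases a <;> fin_cases b <;> norm_num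

/-- The numerical `R`-matrix of the six-vertex model, with denominators cleared. -/
noncomputable def sixVertex (R : Type*) [Ring R] [Algebra ℂ R] (η x : ℂ) :
    Matrix (Fin 2 × Fin 2) (Fin 2 × Fin 2) R :=
  Matrix.of fun p q => algebraMap ℂ R
    (if p = q then (if p.1 = p.2 then sinh (x + η) else sinh x)
      else if p = q.swap then sinh η else 0)

end Graded

/-! ### The Yang–Baxter relation at one site. -/

section Lax

theorem annihilate_sq {ι : Type} (i : ι) (x : Fock ι) : annihilate i (annihilate i x) = 0 := by
  have h : (2 : ℂ) • annihilate i (annihilate i x) = 0 := by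
    rw [two_smul]
    exact LinearMap.congr_fun (annihilate_annihilate i i) x
  exact (smul_eq_zero.mp h).resolve_left two_ne_zero

theorem annihilate_mul_self {ι : Type} (i : ι) : (annihilate i * annihilate i : Module.End ℂ (Fock ι)) = 0 :=
  LinearMap.ext fun x => annihilate_sq i x

variable {ι : Type} [DecidableEq ι]

theorem create_mul_self (i : ι) : (create i * create i : Module.End ℂ (Fock ι)) = 0 :=
  LinearMap.ext fun x => create_sq i x

theorem annihilate_mul_create (i : ι) :
    (annihilate i * create i : Module.End ℂ (Fock ι)) = 1 - number i := by
  have := create_annihilate i i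
  rw [if_pos rfl] at this
  rw [← this, number]
  abel

theorem number_mul_create (i : ι) : number i * create i = create i := by
  rw [number, mul_assoc, annihilate_mul_create, number, mul_sub, ← mul_assoc, create_mul_self]
  simp

theorem create_mul_number (i : ι) : create i * number i = 0 := by
  rw [number, ← mul_assoc, create_mul_self, zero_mul]

theorem number_mul_annihilate (i : ι) : number i * annihilate i = 0 := by
  rw [number, mul_assoc, annihilate_mul_self, mul_zero]

theorem annihilate_mul_number (i : ι) : annihilate i * number i = annihilate i := by
  rw [number, ← mul_assoc, annihilate_mul_create, sub_mul, number_mul_annihilate]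
  simp

theorem number_mul_self (i : ι) : number i * number i = number i := by
  nth_rewrite 1 [number]
  rw [mul_assoc, annihilate_mul_number, number]

-- On one mode all products reduce to the monomials 1, n, c, c†. The entries that do not match
-- identically come down to the three hyperbolic identities `h₁`, `h₂`, `h₃`.
set_option maxHeartbeats 4000000 in
theorem sixVertex_mul_gradedKron_lax (η u v : ℂ) (m : ι) (hu : sinh (u + η) ≠ 0)
    (hv : sinh (v + η) ≠ 0) :
    sixVertex _ η (u - v) * gradedKron (lax η m u) (lax η m v) =
      gradedKronSwap (lax η m u) (lax η m v) * sixVertex _ η (u - v) := by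
  have cu := Complex.cosh_sq u
  have cv := Complex.cosh_sq v
  have ce := Complex.cosh_sq η
  have h₁ : sinh (u - v + η) * (sinh η / sinh (v + η)) * (sinh u / sinh (u + η)) =
      sinh (u - v) * (sinh η / sinh (v + η)) +
        sinh η * (sinh v / sinh (v + η)) * (sinh η / sinh (u + η)) := by
    field_simp
    simp only [Complex.sinh_add, Complex.sinh_sub, Complex.cosh_sub]
    linear_combination (sinh η ^ 2 * sinh v) * cu
  have h₂ : sinh (u - v + η) * (sinh η / sinh (u + η)) =
      sinh η * (sinh η / sinh (v + η)) +
        sinh (u - v) * (sinh v / sinh (v + η)) * (sinh η / sinh (u + η)) := by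
    field_simp
    simp only [Complex.sinh_add, Complex.sinh_sub, Complex.cosh_sub]
    linear_combination (sinh η * (sinh u * cosh v - cosh u * sinh v) * sinh v) * ce +
      sinh η * (sinh u * sinh η * cosh η + cosh u * sinh η ^ 2) * cv
  have h₃ : sinh η * (sinh u / sinh (u + η)) = sinh η * (sinh v / sinh (v + η)) +
      sinh (u - v) * (sinh η / sinh (v + η)) * (sinh η / sinh (u + η)) := by
    field_simp
    simp only [Complex.sinh_add, Complex.sinh_sub]
    ring
  ext1 ⟨i, j⟩ ⟨k, l⟩
  fin_cases i <;> fin_cases j <;> fin_cases k <;> fin_cases l <;>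
    simp [Matrix.mul_apply, Fintype.sum_prod_type, Fin.sum_univ_two, sixVertex, gradedKron,
      gradedKronSwap, lax, mul_add, add_mul, mul_sub, sub_mul, number_mul_self,
      create_mul_number, number_mul_create, annihilate_mul_number, number_mul_annihilate,
      annihilate_mul_create, create_mul_self, annihilate_mul_self, Algebra.algebraMap_eq_smul_one,
      ← number.eq_1, smul_smul, -smul_eq_zero, smul_sub, smul_add]
  · linear_combination (norm := module) h₁ • (create m)
  · linear_combination (norm := module) h₂ • (create m)
  · linear_combination (norm := module) (-h₁) • (annihilate m)
  · linear_combination (norm := module) h₃ • (1 : Module.End ℂ (Fock ι))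
  · linear_combination (norm := module) h₂ • (create m)
  · linear_combination (norm := module) (-h₂) • (annihilate m)
  · linear_combination (norm := module) (-h₃) • (1 : Module.End ℂ (Fock ι))
  · linear_combination (norm := module) h₁ • (create m)
  · linear_combination (norm := module) h₂ • (annihilate m)
  · linear_combination (norm := module) h₁ • (annihilate m)

end Lax

/-! ### From one site to the whole lattice. -/

section Graded

variable {R : Type*} [Ring R] [Algebra ℂ R]

theorem GradedCommute.one_left (L : Matrix (Fin 2) (Fin 2) R) : GradedCommute 1 L := by
  intro a k j b
  by_cases h : a = k
  · subst h
    simp [← two_mul, pow_mul]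
  · simp [Matrix.one_apply_ne h]

/-- Parities add along a matrix product: the intermediate index enters the exponent twice with the
same factor and drops out of the sign. -/
theorem GradedCommute.mul_left {T U L : Matrix (Fin 2) (Fin 2) R} (hT : GradedCommute T L)
    (hU : GradedCommute U L) : GradedCommute (T * U) L := by
  intro a k j b
  simp only [Matrix.mul_apply, Finset.sum_mul, Finset.mul_sum, Finset.smul_sum]
  refine Finset.sum_congr rfl fun x _ => ?_
  rw [mul_assoc, hU, mul_smul_comm, ← mul_assoc, hT, smul_mul_assoc, smul_smul, mul_assoc]
  congr 1
  rw [← pow_add, show ((x : ℕ) + k) * (j + b) + (a + x) * (j + b) =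
    2 * (x * (j + b)) + (a + k) * (j + b) by ring, pow_add, pow_mul]
  simp

end Graded

section Lax

theorem annihilate_mul_annihilate {ι : Type} (i j : ι) :
    (annihilate i * annihilate j : Module.End ℂ (Fock ι)) = -(annihilate j * annihilate i) :=
  eq_neg_of_add_eq_zero_left (annihilate_annihilate i j)

variable {ι : Type} [DecidableEq ι]

theorem annihilate_mul_create_of_ne {i j : ι} (h : i ≠ j) :
    (annihilate i * create j : Module.End ℂ (Fock ι)) = -(create j * annihilate i) := by
  have := create_annihilate j i
  rw [if_neg h.symm] at this
  rw [eq_neg_iff_add_eq_zero, add_comm, this]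

theorem create_mul_create (i j : ι) :
    (create i * create j : Module.End ℂ (Fock ι)) = -(create j * create i) :=
  eq_neg_of_add_eq_zero_left (create_create i j)

theorem number_mul_create_of_ne {i j : ι} (h : i ≠ j) :
    (number i * create j : Module.End ℂ (Fock ι)) = create j * number i := by
  rw [number, mul_assoc, annihilate_mul_create_of_ne h, mul_neg (create i), ← mul_assoc,
    create_mul_create i j, neg_mul (create j * create i), neg_neg, mul_assoc]

theorem number_mul_annihilate_of_ne {i j : ι} (h : i ≠ j) :
    (number i * annihilate j : Module.End ℂ (Fock ι)) = annihilate j * number i := by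
  rw [number, mul_assoc, annihilate_mul_annihilate i j, mul_neg (create i), ← mul_assoc,
    ← mul_assoc, annihilate_mul_create_of_ne h.symm, neg_mul (create i * annihilate j)]

theorem number_mul_number_of_ne {i j : ι} (h : i ≠ j) :
    (number i * number j : Module.End ℂ (Fock ι)) = number j * number i := by
  nth_rewrite 2 [number]
  rw [← mul_assoc, number_mul_create_of_ne h, mul_assoc, number_mul_annihilate_of_ne h,
    ← mul_assoc, ← number]

theorem gradedCommute_lax (η u v : ℂ) {i j : ι} (h : i ≠ j) :
    GradedCommute (lax η i u) (lax η j v) := by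
  intro a k x b
  fin_cases a <;> fin_cases k <;> fin_cases x <;> fin_cases b <;>
    simp [lax, mul_add, add_mul, mul_sub, sub_mul, number_mul_number_of_ne h,
      number_mul_create_of_ne h, number_mul_annihilate_of_ne h,
      ← number_mul_create_of_ne h.symm, ← number_mul_annihilate_of_ne h.symm,
      annihilate_mul_annihilate i j, create_mul_create i j, annihilate_mul_create_of_ne h,
      annihilate_mul_create_of_ne h.symm, -smul_eq_zero] <;> module

variable {M : ℕ}

theorem gradedCommute_monodromyMatrix (η : ℂ) (ξ : Fin M → ℂ) (u v : ℂ) (s : List (Fin M))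
    (m : Fin M) (hm : m ∉ s) : GradedCommute (monodromyMatrix η ξ u s) (lax η m v) := by
  induction s with
  | nil => exact GradedCommute.one_left _
  | cons a s ih =>
    rw [List.mem_cons, not_or] at hm
    rw [monodromyMatrix, List.map_cons, List.prod_cons]
    exact (gradedCommute_lax _ _ _ (Ne.symm hm.1)).mul_left (ih hm.2)

/-- The graded Yang–Baxter algebra of the monodromy matrix. -/
theorem sixVertex_mul_gradedKron (η : ℂ) (ξ : Fin M → ℂ) (u v : ℂ) (s : List (Fin M))
    (hs : s.Nodup) (hu : ∀ m, sinh (u - ξ m + η) ≠ 0) (hv : ∀ m, sinh (v - ξ m + η) ≠ 0) :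
    sixVertex _ η (u - v) * gradedKron (monodromyMatrix η ξ u s) (monodromyMatrix η ξ v s) =
      gradedKronSwap (monodromyMatrix η ξ u s) (monodromyMatrix η ξ v s) *
        sixVertex _ η (u - v) := by
  induction s with
  | nil =>
    have h1 : gradedKron (1 : Matrix (Fin 2) (Fin 2) (Module.End ℂ (Fock (Fin M)))) 1 = 1 := by
      ext1 ⟨i, j⟩ ⟨k, l⟩
      fin_cases i <;> fin_cases j <;> fin_cases k <;> fin_cases l <;>
        simp [gradedKron, Matrix.one_apply]
    have h2 : gradedKronSwap (1 : Matrix (Fin 2) (Fin 2) (Module.End ℂ (Fock (Fin M)))) 1 = 1 := by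
      ext1 ⟨i, j⟩ ⟨k, l⟩
      fin_cases i <;> fin_cases j <;> fin_cases k <;> fin_cases l <;>
        simp [gradedKronSwap, Matrix.one_apply]
    simp only [monodromyMatrix, List.map_nil, List.prod_nil, h1, h2, one_mul, mul_one]
  | cons m s ih =>
    rw [List.nodup_cons] at hs
    have hc : ∀ w, monodromyMatrix η ξ w (m :: s) =
        lax η m (w - ξ m) * monodromyMatrix η ξ w s := fun w => by simp [monodromyMatrix]
    have hl := sixVertex_mul_gradedKron_lax η (u - ξ m) (v - ξ m) m (hu m) (hv m)
    -- The inhomogeneity cancels in the difference of spectral parameters, so one and the same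
    -- R-matrix intertwines every site.
    rw [sub_sub_sub_cancel_right] at hl
    rw [hc, hc, gradedKron_mul (gradedCommute_monodromyMatrix η ξ u _ s m hs.1),
      gradedKronSwap_mul (gradedCommute_monodromyMatrix η ξ v _ s m hs.1), ← mul_assoc, hl,
      mul_assoc, ih hs.2, mul_assoc]

end Lax

/-! ### Exchange relations between the entries. -/

section Relations

variable {M : ℕ} (η : ℂ) (ξ : Fin M → ℂ)

/-- The entry `A(u)` of the monodromy matrix. -/
noncomputable def opA (u : ℂ) : Module.End ℂ (Fock (Fin M)) := monodromyMatrix η ξ u (sites M) 0 0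

/-- The entry `D(u)` of the monodromy matrix. -/
noncomputable def opD (u : ℂ) : Module.End ℂ (Fock (Fin M)) := monodromyMatrix η ξ u (sites M) 1 1

theorem nodup_sites : (sites M).Nodup := List.nodup_reverse.mpr (List.nodup_finRange M)

variable {η ξ} {u v : ℂ}

/-- These are the matrix entries needed for a highest weight representation. Denominators stay
cleared, so `u` and `v` need not be separated yet. -/
theorem yangBaxter_entries (hu : ∀ m, sinh (u - ξ m + η) ≠ 0)
    (hv : ∀ m, sinh (v - ξ m + η) ≠ 0) :
    sinh (u - v + η) • (opB η ξ u * opB η ξ v) = sinh (u - v + η) • (opB η ξ v * opB η ξ u) ∧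
    sinh (u - v + η) • (opC η ξ u * opC η ξ v) = sinh (u - v + η) • (opC η ξ v * opC η ξ u) ∧
    sinh (u - v + η) • (opB η ξ u * opA η ξ v) =
      sinh η • (opB η ξ v * opA η ξ u) + sinh (u - v) • (opA η ξ v * opB η ξ u) ∧
    -(sinh η • (opB η ξ u * opD η ξ v)) + sinh (u - v) • (opD η ξ u * opB η ξ v) =
      -(sinh (u - v + η) • (opB η ξ v * opD η ξ u)) ∧
    sinh η • (opA η ξ u * opC η ξ v) + sinh (u - v) • (opC η ξ u * opA η ξ v) =
      sinh (u - v + η) • (opA η ξ v * opC η ξ u) ∧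
    sinh (u - v + η) • (opD η ξ u * opC η ξ v) =
      sinh η • (opD η ξ v * opC η ξ u) + -(sinh (u - v) • (opC η ξ v * opD η ξ u)) ∧
    sinh η • (opA η ξ u * opD η ξ v) + sinh (u - v) • (opC η ξ u * opB η ξ v) =
      -(sinh (u - v) • (opB η ξ v * opC η ξ u)) + sinh η • (opA η ξ v * opD η ξ u) ∧
    -(sinh (u - v) • (opB η ξ u * opC η ξ v)) + sinh η • (opD η ξ u * opA η ξ v) =
      sinh η • (opD η ξ v * opA η ξ u) + sinh (u - v) • (opC η ξ v * opB η ξ u) := by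
  have h := fun p q =>
    congrFun (congrFun (sixVertex_mul_gradedKron η ξ u v _ nodup_sites hu hv) p) q
  simp only [Matrix.mul_apply, Fintype.sum_prod_type, Fin.sum_univ_two, sixVertex, gradedKron,
    gradedKronSwap, Matrix.of_apply] at h
  have h₁ := h (0, 0) (1, 1)
  have h₂ := h (1, 1) (0, 0)
  have h₃ := h (0, 0) (1, 0)
  have h₄ := h (1, 0) (1, 1)
  have h₅ := h (1, 0) (0, 0)
  have h₆ := h (1, 1) (1, 0)
  have h₇ := h (1, 0) (0, 1)
  have h₈ := h (0, 1) (1, 0)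
  clear h
  simp [Algebra.algebraMap_eq_smul_one, ← opB_eq, ← opC_eq, ← opA.eq_1, ← opD.eq_1,
    -smul_eq_zero] at *
  exact ⟨h₁, h₂, h₃, h₄, h₅, h₆, h₇, h₈⟩

end Relations

/-! ### Abstract highest weight representations, their duals and direct sums. -/

/-- The diagonal exchange coefficient `sh (x - η) / sh x`. -/
noncomputable def diagWeight (η x : ℂ) : ℂ := sinh (x - η) / sinh x

/-- The off-diagonal exchange coefficient `sh η / sh x`. -/
noncomputable def exchWeight (η x : ℂ) : ℂ := sinh η / sinh x

/-- In the induction of `YBRep.exchange_bvec` the same exchanged vector is reached along two paths;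
this identity adds their coefficients. -/
theorem exchWeight_identity (η : ℂ) {x y : ℂ} (hx : sinh x ≠ 0) (hy : sinh y ≠ 0)
    (hxy : sinh (x + y) ≠ 0) :
    diagWeight η x * exchWeight η (x + y) + exchWeight η x * exchWeight η y =
      exchWeight η (x + y) * diagWeight η (-y) := by
  simp only [diagWeight, exchWeight, Complex.sinh_neg]
  have : sinh (-y - η) = - sinh (y + η) := by rw [← Complex.sinh_neg]; ring_nf
  rw [this]
  field_simp
  simp only [Complex.sinh_add, Complex.sinh_sub]
  ring

/-- A highest weight representation of the graded Yang–Baxter algebra at a family `v` of points,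
with vacuum eigenvalues `1` of `A` and `d` of `D`, together with a dual vacuum. -/
structure YBRep {ι : Type} (η : ℂ) (v d : ι → ℂ) (V : Type) [AddCommGroup V] [Module ℂ V] where
  A : ι → Module.End ℂ V
  B : ι → Module.End ℂ V
  C : ι → Module.End ℂ V
  D : ι → Module.End ℂ V
  vac : V
  bra : V →ₗ[ℂ] ℂ
  BB : ∀ i j, B i * B j = B j * B i
  CC : ∀ i j, C i * C j = C j * C i
  AB : ∀ i j, i ≠ j → A i * B j =
    diagWeight η (v i - v j) • (B j * A i) + exchWeight η (v i - v j) • (B i * A j)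
  DB : ∀ i j, i ≠ j → D i * B j =
    -(diagWeight (-η) (v i - v j) • (B j * D i) + exchWeight (-η) (v i - v j) • (B i * D j))
  CA : ∀ i j, i ≠ j → C j * A i =
    diagWeight η (v i - v j) • (A i * C j) + exchWeight η (v i - v j) • (A j * C i)
  CD : ∀ i j, i ≠ j → C j * D i =
    -(diagWeight (-η) (v i - v j) • (D i * C j) + exchWeight (-η) (v i - v j) • (D j * C i))
  CB : ∀ i j, i ≠ j → C i * B j + B j * C i =
    exchWeight η (v i - v j) • (A j * D i - A i * D j)
  CB' : ∀ i j, i ≠ j → C i * B j + B j * C i =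
    exchWeight η (v i - v j) • (D i * A j - D j * A i)
  A_vac : ∀ i, A i vac = vac
  D_vac : ∀ i, D i vac = d i • vac
  C_vac : ∀ i, C i vac = 0
  bra_A : ∀ i, bra ∘ₗ A i = bra
  bra_D : ∀ i, bra ∘ₗ D i = d i • bra
  bra_B : ∀ i, bra ∘ₗ B i = 0
  bra_vac : bra vac = 1

namespace YBRep

variable {ι : Type} {η : ℂ} {v d : ι → ℂ} {V W : Type} [AddCommGroup V] [Module ℂ V]
  [AddCommGroup W] [Module ℂ W]

theorem exchWeight_sub_comm (η x y : ℂ) : exchWeight η (x - y) = - exchWeight η (y - x) := by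
  rw [exchWeight, exchWeight, ← neg_sub y x, Complex.sinh_neg, div_neg]

/-- The representation on the dual space, with the roles of `B` and `C` exchanged. -/
noncomputable def dual (R : YBRep η v d V) : YBRep η v d (Module.Dual ℂ V) where
  A i := (R.A i).dualMap
  B i := (R.C i).dualMap
  C i := (R.B i).dualMap
  D i := (R.D i).dualMap
  vac := R.bra
  bra := Module.Dual.eval ℂ V R.vac
  BB i j := by
    refine LinearMap.ext fun φ => LinearMap.ext fun w => ?_
    exact congrArg φ (LinearMap.congr_fun (R.CC j i) w)
  CC i j := by
    refine LinearMap.ext fun φ => LinearMap.ext fun w => ?_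
    exact congrArg φ (LinearMap.congr_fun (R.BB j i) w)
  AB i j h := by
    refine LinearMap.ext fun φ => LinearMap.ext fun w => ?_
    simpa using congrArg φ (LinearMap.congr_fun (R.CA i j h) w)
  DB i j h := by
    refine LinearMap.ext fun φ => LinearMap.ext fun w => ?_
    simpa using congrArg φ (LinearMap.congr_fun (R.CD i j h) w)
  CA i j h := by
    refine LinearMap.ext fun φ => LinearMap.ext fun w => ?_
    simpa using congrArg φ (LinearMap.congr_fun (R.AB i j h) w)
  CD i j h := by
    refine LinearMap.ext fun φ => LinearMap.ext fun w => ?_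
    simpa using congrArg φ (LinearMap.congr_fun (R.DB i j h) w)
  CB i j h := by
    refine LinearMap.ext fun φ => LinearMap.ext fun w => ?_
    -- Transposition reverses the products of `A` and `D`, so `CB` of the dual is `CB'` of `R` with
    -- the indices interchanged. Hence both forms are part of the structure.
    have := congrArg φ (LinearMap.congr_fun (R.CB' j i h.symm) w)
    rw [exchWeight_sub_comm] at this
    simp at this ⊢
    linear_combination this
  CB' i j h := by
    refine LinearMap.ext fun φ => LinearMap.ext fun w => ?_
    have := congrArg φ (LinearMap.congr_fun (R.CB j i h.symm) w)
    rw [exchWeight_sub_comm] at this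
    simp at this ⊢
    linear_combination this
  A_vac i := R.bra_A i
  D_vac i := R.bra_D i
  C_vac i := R.bra_B i
  bra_A i := LinearMap.ext fun φ => congrArg φ (R.A_vac i)
  bra_D i := LinearMap.ext fun φ => by simpa using congrArg φ (R.D_vac i)
  bra_B i := LinearMap.ext fun φ => by simpa using congrArg φ (R.C_vac i)
  bra_vac := R.bra_vac

/-- The direct sum of two representations, with the sum of the two vacua as vacuum. -/
noncomputable def prod (R : YBRep η v d V) (R' : YBRep η v d W) : YBRep η v d (V × W) where
  A i := (R.A i).prodMap (R'.A i)
  B i := (R.B i).prodMap (R'.B i)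
  C i := (R.C i).prodMap (R'.C i)
  D i := (R.D i).prodMap (R'.D i)
  vac := (R.vac, R'.vac)
  -- The bra of the second summand would do equally well; `pairing_congr` compares the two.
  bra := R.bra ∘ₗ LinearMap.fst ℂ V W
  BB i j := LinearMap.ext fun w =>
    Prod.ext (LinearMap.congr_fun (R.BB i j) w.1) (LinearMap.congr_fun (R'.BB i j) w.2)
  CC i j := LinearMap.ext fun w =>
    Prod.ext (LinearMap.congr_fun (R.CC i j) w.1) (LinearMap.congr_fun (R'.CC i j) w.2)
  AB i j h := LinearMap.ext fun w =>
    Prod.ext (LinearMap.congr_fun (R.AB i j h) w.1) (LinearMap.congr_fun (R'.AB i j h) w.2)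
  DB i j h := LinearMap.ext fun w =>
    Prod.ext (LinearMap.congr_fun (R.DB i j h) w.1) (LinearMap.congr_fun (R'.DB i j h) w.2)
  CA i j h := LinearMap.ext fun w =>
    Prod.ext (LinearMap.congr_fun (R.CA i j h) w.1) (LinearMap.congr_fun (R'.CA i j h) w.2)
  CD i j h := LinearMap.ext fun w =>
    Prod.ext (LinearMap.congr_fun (R.CD i j h) w.1) (LinearMap.congr_fun (R'.CD i j h) w.2)
  CB i j h := LinearMap.ext fun w =>
    Prod.ext (LinearMap.congr_fun (R.CB i j h) w.1) (LinearMap.congr_fun (R'.CB i j h) w.2)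
  CB' i j h := LinearMap.ext fun w =>
    Prod.ext (LinearMap.congr_fun (R.CB' i j h) w.1) (LinearMap.congr_fun (R'.CB' i j h) w.2)
  A_vac i := by simp [R.A_vac, R'.A_vac]
  D_vac i := by simp [R.D_vac, R'.D_vac]
  C_vac i := by simp [R.C_vac, R'.C_vac]
  bra_A i := LinearMap.ext fun w => LinearMap.congr_fun (R.bra_A i) w.1
  bra_D i := LinearMap.ext fun w => LinearMap.congr_fun (R.bra_D i) w.1
  bra_B i := LinearMap.ext fun w => LinearMap.congr_fun (R.bra_B i) w.1
  bra_vac := R.bra_vac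

variable (R : YBRep η v d V) (R' : YBRep η v d W)

/-- The product of the operators `B i`, `i ∈ s`. -/
noncomputable def bProd (s : Finset ι) : Module.End ℂ V :=
  s.noncommProd R.B fun i _ j _ _ => R.BB i j

/-- The product of the operators `C i`, `i ∈ s`. -/
noncomputable def cProd (s : Finset ι) : Module.End ℂ V :=
  s.noncommProd R.C fun i _ j _ _ => R.CC i j

/-- The Bethe vector `∏_{i ∈ s} B i |Ω⟩`. -/
noncomputable def bvec (s : Finset ι) : V := R.bProd s R.vac

/-- The scalar product `⟨Ω| ∏_{i ∈ t} C i ∏_{i ∈ s} B i |Ω⟩`. -/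
noncomputable def pairing (t s : Finset ι) : ℂ := R.bra (R.cProd t (R.bvec s))

theorem bProd_empty : R.bProd ∅ = 1 := Finset.noncommProd_empty _ _

theorem cProd_empty : R.cProd ∅ = 1 := Finset.noncommProd_empty _ _

theorem bvec_empty : R.bvec ∅ = R.vac := by simp [bvec, bProd_empty]

variable [DecidableEq ι]

theorem bProd_insert {i : ι} {s : Finset ι} (h : i ∉ s) :
    R.bProd (insert i s) = R.B i * R.bProd s := Finset.noncommProd_insert_of_notMem _ _ _ _ h

theorem cProd_insert {i : ι} {s : Finset ι} (h : i ∉ s) :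
    R.cProd (insert i s) = R.C i * R.cProd s := Finset.noncommProd_insert_of_notMem _ _ _ _ h

theorem cProd_insert' {i : ι} {s : Finset ι} (h : i ∉ s) :
    R.cProd (insert i s) = R.cProd s * R.C i := Finset.noncommProd_insert_of_notMem' _ _ _ _ h

theorem bvec_insert {i : ι} {s : Finset ι} (h : i ∉ s) :
    R.bvec (insert i s) = R.B i (R.bvec s) := by
  rw [bvec, bProd_insert R h, Module.End.mul_apply, bvec]

theorem dual_bProd (s : Finset ι) : R.dual.bProd s = (R.cProd s).dualMap := by
  induction s using Finset.induction_on with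
  | empty => rw [bProd_empty, cProd_empty]; rfl
  | insert i s h ih => rw [bProd_insert _ h, cProd_insert' _ h, ih]; rfl

theorem dual_cProd (s : Finset ι) : R.dual.cProd s = (R.bProd s).dualMap := by
  induction s using Finset.induction_on with
  | empty => rw [bProd_empty, cProd_empty]; rfl
  | insert i s h ih => rw [cProd_insert' _ h, bProd_insert _ h, ih]; rfl

theorem prod_bProd (s : Finset ι) :
    (R.prod R').bProd s = (R.bProd s).prodMap (R'.bProd s) := by
  induction s using Finset.induction_on with
  | empty => rw [bProd_empty, bProd_empty, bProd_empty]; rfl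
  | insert i s h ih =>
    rw [bProd_insert _ h, bProd_insert _ h, bProd_insert _ h, ih]
    rfl

theorem prod_cProd (s : Finset ι) :
    (R.prod R').cProd s = (R.cProd s).prodMap (R'.cProd s) := by
  induction s using Finset.induction_on with
  | empty => rw [cProd_empty, cProd_empty, cProd_empty]; rfl
  | insert i s h ih =>
    rw [cProd_insert _ h, cProd_insert _ h, cProd_insert _ h, ih]
    rfl

theorem dual_bvec_apply (t : Finset ι) (w : V) : R.dual.bvec t w = R.bra (R.cProd t w) := by
  rw [bvec, dual_bProd]
  rfl

end YBRep

/-! ### Action on Bethe vectors; uniqueness and symmetry of scalar products. -/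

namespace YBRep

variable {ι : Type} {η : ℂ} {v d : ι → ℂ} {V W : Type} [AddCommGroup V] [Module ℂ V]
  [AddCommGroup W] [Module ℂ W] (R : YBRep η v d V) (R' : YBRep η v d W)

/-- The span of the Bethe vectors on subsets of `S`. -/
noncomputable def betheSpan (S : Finset ι) : Submodule ℂ V :=
  Submodule.span ℂ (R.bvec '' {s | s ⊆ S})

theorem bvec_mem {s S : Finset ι} (h : s ⊆ S) : R.bvec s ∈ R.betheSpan S :=
  Submodule.subset_span ⟨s, h, rfl⟩

theorem map_mem_betheSpan {X : Module.End ℂ V} {S T : Finset ι}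
    (h : ∀ s ⊆ S, X (R.bvec s) ∈ R.betheSpan T) {w : V} (hw : w ∈ R.betheSpan S) :
    X w ∈ R.betheSpan T := by
  have : R.betheSpan S ≤ (R.betheSpan T).comap X := by
    rw [betheSpan, Submodule.span_le]
    rintro _ ⟨s, hs, rfl⟩
    exact h s hs
  exact this hw

variable [DecidableEq ι]

/-- The operator `A` is the case ε = 1, κ = η, and `D` the case ε = -1, κ = -η. When a point j is
added, `X u` passes `B j` either keeping its label or trading it for j. Contributions to the same
vector are merged by `exchWeight_identity`. -/
theorem exchange_bvec (hv : ∀ i j, i ≠ j → sinh (v i - v j) ≠ 0) (X : ι → Module.End ℂ V)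
    (ε κ : ℂ) (a : ι → ℂ)
    (hX : ∀ i j, i ≠ j → X i * R.B j =
      ε • (diagWeight κ (v i - v j) • (R.B j * X i) + exchWeight κ (v i - v j) • (R.B i * X j)))
    (hvac : ∀ i, X i R.vac = a i • R.vac) (s : Finset ι) :
    ∀ u ∉ s, X u (R.bvec s) = ε ^ s.card •
      ((a u * ∏ i ∈ s, diagWeight κ (v u - v i)) • R.bvec s +
        ∑ k ∈ s, (a k * exchWeight κ (v u - v k) * ∏ i ∈ s.erase k, diagWeight κ (v k - v i)) •
          R.bvec (insert u (s.erase k))) := by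
  induction s using Finset.induction_on with
  | empty => intro u _; simp [bvec_empty, hvac]
  | insert j s hj ih =>
    intro u hu
    rw [Finset.mem_insert, not_or] at hu
    obtain ⟨huj, hus⟩ := hu
    have h1 := LinearMap.congr_fun (hX u j huj) (R.bvec s)
    simp only [Module.End.mul_apply, LinearMap.smul_apply, LinearMap.add_apply] at h1
    rw [bvec_insert _ hj, h1, ih u hus, ih j hj, Finset.card_insert_of_notMem hj,
      Finset.prod_insert hj, Finset.sum_insert hj, Finset.erase_insert hj]
    simp only [map_smul, map_add, map_sum]
    have h2 : ∑ k ∈ s, (a k * exchWeight κ (v u - v k) *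
          ∏ i ∈ (insert j s).erase k, diagWeight κ (v k - v i)) •
            R.bvec (insert u ((insert j s).erase k)) =
        diagWeight κ (v u - v j) • ∑ k ∈ s, (a k * exchWeight κ (v u - v k) *
          ∏ i ∈ s.erase k, diagWeight κ (v k - v i)) • R.B j (R.bvec (insert u (s.erase k))) +
        exchWeight κ (v u - v j) • ∑ k ∈ s, (a k * exchWeight κ (v j - v k) *
          ∏ i ∈ s.erase k, diagWeight κ (v k - v i)) • R.B u (R.bvec (insert j (s.erase k))) := by
      rw [Finset.smul_sum, Finset.smul_sum, ← Finset.sum_add_distrib]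
      refine Finset.sum_congr rfl fun k hk => ?_
      have hkj : k ≠ j := fun h => hj (h ▸ hk)
      have hku : u ≠ k := fun h => hus (h ▸ hk)
      have hje : j ∉ s.erase k := fun h => hj (Finset.mem_of_mem_erase h)
      have h3 : R.B u (R.bvec (insert j (s.erase k))) =
          R.bvec (insert u (insert j (s.erase k))) :=
        (bvec_insert _ (by simp [huj, hus])).symm
      have h4 : R.B j (R.bvec (insert u (s.erase k))) =
          R.bvec (insert u (insert j (s.erase k))) := by
        rw [Finset.insert_comm]
        exact (bvec_insert _ (by simp [Ne.symm huj, hj])).symm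
      have h5 := exchWeight_identity κ (hv u j huj) (hv j k hkj.symm)
        (by rw [sub_add_sub_cancel]; exact hv u k hku)
      rw [sub_add_sub_cancel, neg_sub] at h5
      rw [h3, h4, Finset.erase_insert_of_ne hkj.symm, Finset.prod_insert hje, smul_smul, smul_smul,
        ← add_smul]
      congr 1
      linear_combination (-(a k * ∏ i ∈ s.erase k, diagWeight κ (v k - v i))) * h5
    rw [h2, ← bvec_insert _ hus, ← bvec_insert _ hj, pow_succ]
    module

theorem A_bvec (hv : ∀ i j, i ≠ j → sinh (v i - v j) ≠ 0) {s : Finset ι} {u : ι} (hu : u ∉ s) :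
    R.A u (R.bvec s) = (∏ i ∈ s, diagWeight η (v u - v i)) • R.bvec s +
      ∑ k ∈ s, (exchWeight η (v u - v k) * ∏ i ∈ s.erase k, diagWeight η (v k - v i)) •
        R.bvec (insert u (s.erase k)) := by
  have := R.exchange_bvec hv R.A 1 η (fun _ => 1) (fun i j h => by rw [one_smul, R.AB i j h])
    (fun i => by rw [one_smul, R.A_vac]) s u hu
  simpa using this

theorem D_bvec (hv : ∀ i j, i ≠ j → sinh (v i - v j) ≠ 0) {s : Finset ι} {u : ι} (hu : u ∉ s) :
    R.D u (R.bvec s) = (-1 : ℂ) ^ s.card •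
      ((d u * ∏ i ∈ s, diagWeight (-η) (v u - v i)) • R.bvec s +
      ∑ k ∈ s, (d k * exchWeight (-η) (v u - v k) *
        ∏ i ∈ s.erase k, diagWeight (-η) (v k - v i)) • R.bvec (insert u (s.erase k))) :=
  R.exchange_bvec hv R.D (-1) (-η) d (fun i j h => by rw [neg_one_smul, R.DB i j h])
    R.D_vac s u hu

theorem B_mem {S : Finset ι} {u : ι} (hu : u ∉ S) {w : V} (hw : w ∈ R.betheSpan S) :
    R.B u w ∈ R.betheSpan (insert u S) := by
  refine R.map_mem_betheSpan (fun s hs => ?_) hw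
  rw [← bvec_insert _ fun h => hu (hs h)]
  exact R.bvec_mem (Finset.insert_subset_insert _ hs)

theorem A_mem (hv : ∀ i j, i ≠ j → sinh (v i - v j) ≠ 0) {S : Finset ι} {u : ι} (hu : u ∉ S)
    {w : V} (hw : w ∈ R.betheSpan S) : R.A u w ∈ R.betheSpan (insert u S) := by
  refine R.map_mem_betheSpan (fun s hs => ?_) hw
  rw [R.A_bvec hv fun h => hu (hs h)]
  refine add_mem (Submodule.smul_mem _ _ (R.bvec_mem (hs.trans (Finset.subset_insert _ _))))
    (Submodule.sum_mem _ fun k _ => Submodule.smul_mem _ _ (R.bvec_mem ?_))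
  exact Finset.insert_subset_insert _ ((Finset.erase_subset _ _).trans hs)

theorem D_mem (hv : ∀ i j, i ≠ j → sinh (v i - v j) ≠ 0) {S : Finset ι} {u : ι} (hu : u ∉ S)
    {w : V} (hw : w ∈ R.betheSpan S) : R.D u w ∈ R.betheSpan (insert u S) := by
  refine R.map_mem_betheSpan (fun s hs => ?_) hw
  rw [R.D_bvec hv fun h => hu (hs h)]
  refine Submodule.smul_mem _ _
    (add_mem (Submodule.smul_mem _ _ (R.bvec_mem (hs.trans (Finset.subset_insert _ _))))
    (Submodule.sum_mem _ fun k _ => Submodule.smul_mem _ _ (R.bvec_mem ?_)))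
  exact Finset.insert_subset_insert _ ((Finset.erase_subset _ _).trans hs)

/-- Passing `C u` through one `B j` leaves products A D, whose action is known, and a shorter
instance of the claim. -/
theorem C_bvec_mem (hv : ∀ i j, i ≠ j → sinh (v i - v j) ≠ 0) (s : Finset ι) :
    ∀ u ∉ s, R.C u (R.bvec s) ∈ R.betheSpan (insert u s) := by
  induction s using Finset.induction_on with
  | empty => intro u _; rw [bvec_empty, R.C_vac]; exact zero_mem _
  | insert j s hj ih =>
    intro u hu
    rw [Finset.mem_insert, not_or] at hu
    obtain ⟨huj, hus⟩ := hu
    have h1 := LinearMap.congr_fun (R.CB u j huj) (R.bvec s)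
    simp only [Module.End.mul_apply, LinearMap.smul_apply, LinearMap.add_apply,
      LinearMap.sub_apply] at h1
    rw [bvec_insert _ hj, eq_sub_of_add_eq h1]
    have hju : j ∉ insert u s := by simp [Ne.symm huj, hj]
    have huj' : u ∉ insert j s := by simp [huj, hus]
    have m := R.bvec_mem (Finset.Subset.refl s)
    rw [Finset.insert_comm]
    refine sub_mem (Submodule.smul_mem _ _ (sub_mem (R.A_mem hv hju (R.D_mem hv hus m)) ?_))
      (R.B_mem hju (ih u hus))
    rw [Finset.insert_comm]
    exact R.A_mem hv huj' (R.D_mem hv hj m)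

theorem C_mem (hv : ∀ i j, i ≠ j → sinh (v i - v j) ≠ 0) {S : Finset ι} {u : ι} (hu : u ∉ S)
    {w : V} (hw : w ∈ R.betheSpan S) : R.C u w ∈ R.betheSpan (insert u S) := by
  refine R.map_mem_betheSpan (fun s hs => ?_) hw
  have := R.C_bvec_mem hv s u fun h => hu (hs h)
  exact Submodule.span_mono (Set.image_mono fun t ht =>
    ht.trans (Finset.insert_subset_insert _ hs)) this

theorem cProd_mem (hv : ∀ i j, i ≠ j → sinh (v i - v j) ≠ 0) (t : Finset ι) {S : Finset ι}
    (h : Disjoint t S) {w : V} (hw : w ∈ R.betheSpan S) :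
    R.cProd t w ∈ R.betheSpan (t ∪ S) := by
  induction t using Finset.induction_on with
  | empty => simpa [cProd_empty] using hw
  | insert i t hi ih =>
    rw [Finset.disjoint_insert_left] at h
    rw [cProd_insert _ hi, Module.End.mul_apply, Finset.insert_union]
    exact R.C_mem hv (by simp [hi, h.1]) (ih h.2)

/-- A functional which vanishes on the range of each `B i` is determined on Bethe vectors by its
value on the vacuum. -/
theorem eq_on_betheSpan {φ ψ : V →ₗ[ℂ] ℂ} (hφ : ∀ i, φ ∘ₗ R.B i = 0) (hψ : ∀ i, ψ ∘ₗ R.B i = 0)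
    (h : φ R.vac = ψ R.vac) {S : Finset ι} {w : V} (hw : w ∈ R.betheSpan S) : φ w = ψ w := by
  have : R.betheSpan S ≤ LinearMap.eqLocus φ ψ := by
    rw [betheSpan, Submodule.span_le]
    rintro _ ⟨s, -, rfl⟩
    change φ _ = ψ _
    rcases s.eq_empty_or_nonempty with rfl | ⟨i, hi⟩
    · rw [bvec_empty, h]
    · rw [← Finset.insert_erase hi, bvec_insert _ (Finset.notMem_erase _ _)]
      exact (LinearMap.congr_fun (hφ i) _).trans (LinearMap.congr_fun (hψ i) _).symm
  exact this hw

/-- Scalar products depend only on the points and the vacuum eigenvalues. -/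
theorem pairing_congr (hv : ∀ i j, i ≠ j → sinh (v i - v j) ≠ 0) {t s : Finset ι}
    (h : Disjoint t s) : R.pairing t s = R'.pairing t s := by
  -- Everything generated from the joint vacuum lies in one Bethe span of the direct sum. There the
  -- bras of the two summands agree: each kills the range of every `B` and equals 1 on the joint
  -- vacuum.
  have hm := (R.prod R').cProd_mem hv t h ((R.prod R').bvec_mem (Finset.Subset.refl s))
  have := (R.prod R').eq_on_betheSpan (φ := R.bra ∘ₗ LinearMap.fst ℂ V W)
    (ψ := R'.bra ∘ₗ LinearMap.snd ℂ V W)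
    (fun i => LinearMap.ext fun w => LinearMap.congr_fun (R.bra_B i) w.1)
    (fun i => LinearMap.ext fun w => LinearMap.congr_fun (R'.bra_B i) w.2)
    (R.bra_vac.trans R'.bra_vac.symm) hm
  rw [prod_cProd, bvec, prod_bProd] at this
  exact this

/-- The dual representation has the same points and the same eigenvalues, hence the same scalar
products; transposing back exchanges the roles of `t` and `s`. -/
theorem pairing_comm (hv : ∀ i j, i ≠ j → sinh (v i - v j) ≠ 0) {t s : Finset ι}
    (h : Disjoint t s) : R.pairing t s = R.pairing s t := by
  rw [R.pairing_congr R.dual hv h, pairing, dual_cProd, bvec, dual_bProd]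
  rfl

/-- On-shell Bethe vectors are eigenvectors of the supertrace `A - D`. -/
theorem eigenvector (hv : ∀ i j, i ≠ j → sinh (v i - v j) ≠ 0) {s : Finset ι} {u : ι}
    (hu : u ∉ s)
    (hs : ∀ k ∈ s, ∏ i ∈ s.erase k, diagWeight η (v k - v i) +
      (-1 : ℂ) ^ s.card * d k * ∏ i ∈ s.erase k, diagWeight (-η) (v k - v i) = 0) :
    R.A u (R.bvec s) - R.D u (R.bvec s) =
      (∏ i ∈ s, diagWeight η (v u - v i) -
        (-1 : ℂ) ^ s.card * d u * ∏ i ∈ s, diagWeight (-η) (v u - v i)) • R.bvec s := by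
  rw [R.A_bvec hv hu, R.D_bvec hv hu]
  -- The unwanted terms of `A` and `D` carry the same vectors, and the Bethe equation at k equates
  -- their coefficients.
  have : ∑ k ∈ s, (exchWeight η (v u - v k) * ∏ i ∈ s.erase k, diagWeight η (v k - v i)) •
        R.bvec (insert u (s.erase k)) =
      (-1 : ℂ) ^ s.card • ∑ k ∈ s, (d k * exchWeight (-η) (v u - v k) *
        ∏ i ∈ s.erase k, diagWeight (-η) (v k - v i)) • R.bvec (insert u (s.erase k)) := by
    rw [Finset.smul_sum]
    refine Finset.sum_congr rfl fun k hk => ?_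
    rw [smul_smul]
    congr 1
    have he : exchWeight (-η) (v u - v k) = - exchWeight η (v u - v k) := by
      rw [exchWeight, exchWeight, Complex.sinh_neg, neg_div]
    rw [he]
    linear_combination exchWeight η (v u - v k) * hs k hk
  rw [this]
  module

end YBRep

/-! ### Trigonometric interpolation. -/

theorem sinh_sub_eq (u v : ℂ) :
    sinh (u - v) = exp (-u) * exp (-v) * (exp (2 * u) - exp (2 * v)) / 2 := by
  rw [Complex.sinh, mul_sub, ← exp_add, ← exp_add, ← exp_add]
  ring_nf

theorem exp_two_mul_ne {u v : ℂ} (h : sinh (u - v) ≠ 0) : exp (2 * u) ≠ exp (2 * v) := by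
  intro h'
  rw [sinh_sub_eq, h'] at h
  simp at h

/-- Lagrange interpolation for trigonometric polynomials. -/
theorem trig_interpolation {ι : Type} [DecidableEq ι] (v : ι → ℂ) (s : Finset ι)
    (hv : ∀ i ∈ s, ∀ j ∈ s, i ≠ j → sinh (v i - v j) ≠ 0) {κ : Type} (t : Finset κ)
    (hst : s.card = t.card + 1) (α β : κ → ℂ) (w : ℂ) :
    ∏ a ∈ t, (α a * exp w + β a * exp (-w)) =
      ∑ j ∈ s, (∏ a ∈ t, (α a * exp (v j) + β a * exp (-v j))) *
        ∏ l ∈ s.erase j, (sinh (w - v l) / sinh (v j - v l)) := by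
  -- Each factor is exp(-z) times a linear polynomial in exp(2z). Up to the prefactor this is a
  -- polynomial of degree at most `t.card`, determined by `t.card + 1` nodes.
  set P : Polynomial ℂ := ∏ a ∈ t, (Polynomial.C (α a) * Polynomial.X + Polynomial.C (β a)) with hP
  have hPe : ∀ z, ∏ a ∈ t, (α a * exp z + β a * exp (-z)) =
      exp (-z) ^ t.card * P.eval (exp (2 * z)) := by
    intro z
    rw [hP, Polynomial.eval_prod, ← Finset.prod_const, ← Finset.prod_mul_distrib]
    refine Finset.prod_congr rfl fun a _ => ?_
    simp only [Polynomial.eval_add, Polynomial.eval_mul, Polynomial.eval_C, Polynomial.eval_X]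
    have : exp (-z) * exp (2 * z) = exp z := by rw [← exp_add]; ring_nf
    linear_combination (-α a) * this
  have hdeg : P.degree < s.card := by
    refine lt_of_le_of_lt (Polynomial.degree_prod_le _ _) ?_
    refine lt_of_le_of_lt (Finset.sum_le_card_nsmul _ _ 1 fun a _ => Polynomial.degree_linear_le) ?_
    rw [hst]
    simp only [nsmul_eq_mul, mul_one]
    exact_mod_cast Nat.lt_succ_self _
  clear_value P
  have hinj : Set.InjOn (fun i => exp (2 * v i)) s := fun i hi j hj hij => by
    by_contra h
    exact exp_two_mul_ne (hv i hi j hj h) hij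
  have hint := Lagrange.eq_interpolate_of_eval_eq (fun i => P.eval (exp (2 * v i))) hinj hdeg
    fun _ _ => rfl
  have he := congrArg (Polynomial.eval (exp (2 * w))) hint
  rw [hPe, he, Lagrange.interpolate_apply, Polynomial.eval_finsetSum, Finset.mul_sum]
  refine Finset.sum_congr rfl fun j hj => ?_
  rw [hPe, Polynomial.eval_mul, Polynomial.eval_C, Lagrange.basis, Polynomial.eval_prod]
  have hb : ∀ l ∈ s.erase j, sinh (w - v l) / sinh (v j - v l) = exp (-w) * exp (v j) *
      Polynomial.eval (exp (2 * w)) (Lagrange.basisDivisor (exp (2 * v j)) (exp (2 * v l))) := by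
    intro l hl
    have hne := exp_two_mul_ne (hv j hj l (Finset.mem_of_mem_erase hl) (Finset.ne_of_mem_erase hl).symm)
    simp only [Lagrange.basisDivisor, Polynomial.eval_mul, Polynomial.eval_sub, Polynomial.eval_C,
      Polynomial.eval_X]
    rw [sinh_sub_eq, sinh_sub_eq]
    have h1 := exp_ne_zero (-v l)
    have h2 := exp_ne_zero (-v j)
    have h3 : exp (v j) * exp (-v j) = 1 := by rw [← exp_add]; simp
    have h4 := sub_ne_zero.mpr hne
    generalize exp (2 * v j) = x at *
    generalize exp (2 * v l) = y at *
    generalize exp (2 * w) = z at *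
    field_simp
    linear_combination (-(z - y)) * h3
  rw [Finset.prod_congr rfl hb, Finset.prod_mul_distrib, Finset.prod_const,
    Finset.card_erase_of_mem hj, hst, Nat.add_sub_cancel]
  have h3 : exp (v j) * exp (-v j) = 1 := by rw [← exp_add]; simp
  have h5 : exp (-v j) ^ t.card * (exp (-w) * exp (v j)) ^ t.card = exp (-w) ^ t.card := by
    rw [← mul_pow]
    congr 1
    linear_combination exp (-w) * h3
  rw [← h5]
  ring

/-- The contour form of trigonometric interpolation. -/
theorem trig_interpolation_div {ι : Type} [DecidableEq ι] (v : ι → ℂ) (s : Finset ι)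
    (hv : ∀ i ∈ s, ∀ j ∈ s, i ≠ j → sinh (v i - v j) ≠ 0) {κ : Type} (t : Finset κ)
    (hst : s.card = t.card + 1) (α β : κ → ℂ) (w : ℂ) (hw : ∀ j ∈ s, sinh (w - v j) ≠ 0) :
    ∑ j ∈ s, (∏ a ∈ t, (α a * exp (v j) + β a * exp (-v j))) /
        (∏ l ∈ s.erase j, sinh (v j - v l)) / sinh (v j - w) =
      -(∏ a ∈ t, (α a * exp w + β a * exp (-w))) / ∏ l ∈ s, sinh (w - v l) := by
  have hs : ∏ l ∈ s, sinh (w - v l) ≠ 0 := Finset.prod_ne_zero_iff.mpr hw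
  rw [eq_div_iff hs, trig_interpolation v s hv t hst α β w, ← Finset.sum_neg_distrib,
    Finset.sum_mul]
  refine Finset.sum_congr rfl fun j hj => ?_
  rw [← Finset.mul_prod_erase _ _ hj, Finset.prod_div_distrib]
  have h1 : sinh (v j - w) = - sinh (w - v j) := by rw [← Complex.sinh_neg]; ring_nf
  have h2 : ∏ l ∈ s.erase j, sinh (v j - v l) ≠ 0 := Finset.prod_ne_zero_iff.mpr fun l hl =>
    hv j hj l (Finset.mem_of_mem_erase hl) (Finset.ne_of_mem_erase hl).symm
  have h3 := hw j hj
  rw [h1]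
  generalize ∏ a ∈ t, (α a * exp (v j) + β a * exp (-v j)) = p
  field_simp

/-! ### Linear relations between scalar products with an on-shell vector. -/

namespace YBRep

variable {ι : Type} {η : ℂ} {v d : ι → ℂ} {V W : Type} [AddCommGroup V] [Module ℂ V]
  [DecidableEq ι] (R : YBRep η v d V)

/-- The Bethe equations for the points indexed by `t`, for the vacuum eigenvalues `d`. -/
def OnShell (η : ℂ) (v d : ι → ℂ) (t : Finset ι) : Prop :=
  ∀ k ∈ t, ∏ i ∈ t.erase k, diagWeight η (v k - v i) +
    (-1 : ℂ) ^ t.card * d k * ∏ i ∈ t.erase k, diagWeight (-η) (v k - v i) = 0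

theorem pairing_eq_dual_bvec (t s : Finset ι) : R.pairing t s = R.dual.bvec t (R.bvec s) := by
  rw [dual_bvec_apply, pairing]

/-- The operator A − D at j is placed between the dual vector of `t` and the vector of `s.erase j`:
it acts to the left by its eigenvalue and to the right by `A_bvec` and `D_bvec`. The diagonal part
of the right action fits the general summand at k = j, where the quotients of sinh are 1 and -1. -/
theorem exchange_pairing (hv : ∀ i j, i ≠ j → sinh (v i - v j) ≠ 0)
    (hη : ∀ i j, sinh (v i - v j + η) ≠ 0) {t s : Finset ι} (hst : s.card = t.card + 1)
    (hd : Disjoint t s) (ht : OnShell η v d t) {j : ι} (hj : j ∈ s) :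
    (∏ a ∈ t, diagWeight η (v j - v a) -
        (-1 : ℂ) ^ t.card * d j * ∏ a ∈ t, diagWeight (-η) (v j - v a)) * R.pairing t (s.erase j) =
      ∑ k ∈ s, ((∏ i ∈ s.erase k, diagWeight η (v k - v i)) *
          (sinh η / sinh (v j - (v k - η))) +
        (-1 : ℂ) ^ t.card * d k * (∏ i ∈ s.erase k, diagWeight (-η) (v k - v i)) *
          (sinh η / sinh (v j - (v k + η)))) * R.pairing t (s.erase k) := by
  have hjt : j ∉ t := fun h => Finset.disjoint_left.mp hd h hj
  have hη0 : sinh η ≠ 0 := by simpa using hη j j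
  have he := LinearMap.congr_fun (R.dual.eigenvector hv hjt ht) (R.bvec (s.erase j))
  have hA : R.dual.A j (R.dual.bvec t) (R.bvec (s.erase j)) =
    R.dual.bvec t (R.A j (R.bvec (s.erase j))) := rfl
  have hD : R.dual.D j (R.dual.bvec t) (R.bvec (s.erase j)) =
    R.dual.bvec t (R.D j (R.bvec (s.erase j))) := rfl
  rw [LinearMap.sub_apply, hA, hD, R.A_bvec hv (Finset.notMem_erase j s),
    R.D_bvec hv (Finset.notMem_erase j s), LinearMap.smul_apply, smul_eq_mul] at he
  simp only [pairing_eq_dual_bvec]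
  rw [← he, ← Finset.add_sum_erase s _ hj, Finset.card_erase_of_mem hj, hst, Nat.add_sub_cancel]
  simp only [map_add, map_smul, map_sum, smul_eq_mul]
  have hneg : sinh η / sinh (-η) = -1 := by rw [Complex.sinh_neg, div_neg, div_self hη0]
  rw [show v j - (v j - η) = η by ring, show v j - (v j + η) = -η by ring, div_self hη0, hneg,
    mul_add, Finset.mul_sum]
  have hsum : ∀ k ∈ s.erase j,
      ((∏ i ∈ s.erase k, diagWeight η (v k - v i)) * (sinh η / sinh (v j - (v k - η))) +
        (-1 : ℂ) ^ t.card * d k * (∏ i ∈ s.erase k, diagWeight (-η) (v k - v i)) *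
          (sinh η / sinh (v j - (v k + η)))) * R.dual.bvec t (R.bvec (s.erase k)) =
      (exchWeight η (v j - v k) * ∏ i ∈ (s.erase j).erase k, diagWeight η (v k - v i)) *
          R.dual.bvec t (R.bvec (insert j ((s.erase j).erase k))) -
        (-1 : ℂ) ^ t.card * ((d k * exchWeight (-η) (v j - v k) *
          ∏ i ∈ (s.erase j).erase k, diagWeight (-η) (v k - v i)) *
          R.dual.bvec t (R.bvec (insert j ((s.erase j).erase k)))) := by
    intro k hk
    have hkj : k ≠ j := Finset.ne_of_mem_erase hk
    have hjk : j ∈ s.erase k := Finset.mem_erase.mpr ⟨hkj.symm, hj⟩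
    rw [Finset.erase_right_comm, Finset.insert_erase hjk, ← Finset.mul_prod_erase _ _ hjk,
      ← Finset.mul_prod_erase _ _ hjk]
    have h0 := hv j k hkj.symm
    have h1 : diagWeight η (v k - v j) * (sinh η / sinh (v j - (v k - η))) =
        exchWeight η (v j - v k) := by
      have e1 : v k - v j - η = -(v j - v k + η) := by ring
      have e2 : v k - v j = -(v j - v k) := by ring
      have e3 : v j - (v k - η) = v j - v k + η := by ring
      have h2 := hη j k
      rw [diagWeight, exchWeight, e1, e2, e3, Complex.sinh_neg, Complex.sinh_neg]
      field_simp
    have h2 : diagWeight (-η) (v k - v j) * (sinh η / sinh (v j - (v k + η))) =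
        -exchWeight (-η) (v j - v k) := by
      have e2 : v j - v k = -(v k - v j) := by ring
      have e3 : v j - (v k + η) = -(v k - v j + η) := by ring
      have h2 := hη k j
      have h3 := hv k j hkj
      rw [diagWeight, exchWeight, e2, e3, Complex.sinh_neg, Complex.sinh_neg, Complex.sinh_neg,
        sub_neg_eq_add]
      field_simp
    linear_combination ((∏ i ∈ (s.erase k).erase j, diagWeight η (v k - v i)) *
      R.dual.bvec t (R.bvec (s.erase k))) * h1 + ((-1 : ℂ) ^ t.card * d k *
      (∏ i ∈ (s.erase k).erase j, diagWeight (-η) (v k - v i)) *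
      R.dual.bvec t (R.bvec (s.erase k))) * h2
  rw [Finset.sum_congr rfl hsum, Finset.sum_sub_distrib]
  ring

/-- The entry `Ψ` of the Slavnov determinant, for Bethe roots indexed by `t`. -/
noncomputable def slavnovEntry (η : ℂ) (v d : ι → ℂ) (t : Finset ι) (i k : ι) : ℂ :=
  tFun η (v i) (v k) + (-1 : ℂ) ^ t.card * d k * tFun η (v k) (v i) *
    ∏ a ∈ t, sinh (v k - v a + η) / sinh (v k - v a - η)

/-- Multiply `exchange_pairing` by Φ(v_j)/Δ_j and sum over j. The inner sum against 1 / sinh(v_j −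
(v_k ∓ η)) is evaluated by `trig_interpolation_div`, which leaves a single sum over k. -/
theorem slavnov_relation (hv : ∀ i j, i ≠ j → sinh (v i - v j) ≠ 0)
    (hη : ∀ i j, sinh (v i - v j + η) ≠ 0) {t s : Finset ι} (hst : s.card = t.card + 1)
    (hd : Disjoint t s) (ht : OnShell η v d t) {i : ι} (hi : i ∈ t) :
    ∑ k ∈ s, R.pairing t (s.erase k) * ((∏ a ∈ t, sinh (v k - v a - η)) *
      slavnovEntry η v d t i k) / ∏ l ∈ s.erase k, sinh (v k - v l) = 0 := by
  have hvs : ∀ i ∈ s, ∀ j ∈ s, i ≠ j → sinh (v i - v j) ≠ 0 := fun i _ j _ => hv i j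
  have hη0 : sinh η ≠ 0 := by simpa using hη i i
  -- There are `t.card` factors, one fewer than the nodes in `s`, as interpolation requires. The
  -- factor at the root i is cosh instead of sinh: divided by sinh it is a coth, and differences of
  -- coth over a step η produce `tFun`.
  set Φ : ℂ → ℂ := fun z => cosh (z - v i) * ∏ a ∈ t.erase i, sinh (z - v a) with hΦ
  set α : ι → ℂ := fun a => exp (-v a) / 2 with hα
  set β : ι → ℂ := fun a => if a = i then exp (v a) / 2 else -exp (v a) / 2 with hβ
  have hΦe : ∀ z, ∏ a ∈ t, (α a * exp z + β a * exp (-z)) = Φ z := by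
    intro z
    rw [← Finset.mul_prod_erase t _ hi, hΦ]
    congr 1
    · simp only [hα, hβ, if_true]
      rw [Complex.cosh, neg_sub, sub_eq_add_neg, sub_eq_add_neg, exp_add, exp_add]
      ring
    · refine Finset.prod_congr rfl fun a ha => ?_
      simp only [hα, hβ, if_neg (Finset.ne_of_mem_erase ha)]
      rw [Complex.sinh, neg_sub, sub_eq_add_neg z, sub_eq_add_neg (v a), exp_add, exp_add]
      ring
  have hint : ∀ w, (∀ j ∈ s, sinh (w - v j) ≠ 0) →
      ∑ j ∈ s, Φ (v j) / (∏ l ∈ s.erase j, sinh (v j - v l)) / sinh (v j - w) =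
        -Φ w / ∏ l ∈ s, sinh (w - v l) := by
    intro w hw
    have := trig_interpolation_div v s hvs t hst α β w hw
    simpa only [hΦe] using this
  set Λ : ι → ℂ := fun j => ∏ a ∈ t, diagWeight η (v j - v a) -
        (-1 : ℂ) ^ t.card * d j * ∏ a ∈ t, diagWeight (-η) (v j - v a) with hΛ
  set Δ : ι → ℂ := fun k => ∏ l ∈ s.erase k, sinh (v k - v l) with hΔ
  have hΔ0 : ∀ k, Δ k ≠ 0 := fun k => Finset.prod_ne_zero_iff.mpr fun l hl =>
    hv k l (Finset.ne_of_mem_erase hl).symm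
  have hleft : ∀ k ∈ s, (∏ l ∈ s.erase k, diagWeight η (v k - v l)) * sinh η *
      (-Φ (v k - η) / ∏ l ∈ s, sinh (v k - η - v l)) = Φ (v k - η) / Δ k := by
    intro k hk
    have h1 : ∏ l ∈ s.erase k, sinh (v k - η - v l) ≠ 0 := Finset.prod_ne_zero_iff.mpr fun l _ => by
      rw [show v k - η - v l = -(v l - v k + η) by ring, Complex.sinh_neg]
      exact neg_ne_zero.mpr (hη l k)
    have h2 : ∏ l ∈ s.erase k, diagWeight η (v k - v l) =
        (∏ l ∈ s.erase k, sinh (v k - η - v l)) / Δ k := by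
      rw [hΔ, ← Finset.prod_div_distrib]
      exact Finset.prod_congr rfl fun l _ => by rw [diagWeight, sub_right_comm]
    rw [← Finset.mul_prod_erase s _ hk, h2, show v k - η - v k = -η by ring, Complex.sinh_neg]
    have := hΔ0 k
    field_simp
  have hright : ∀ k ∈ s, (∏ l ∈ s.erase k, diagWeight (-η) (v k - v l)) * sinh η *
      (-Φ (v k + η) / ∏ l ∈ s, sinh (v k + η - v l)) = -Φ (v k + η) / Δ k := by
    intro k hk
    have h1 : ∏ l ∈ s.erase k, sinh (v k + η - v l) ≠ 0 := Finset.prod_ne_zero_iff.mpr fun l _ => by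
      rw [show v k + η - v l = v k - v l + η by ring]
      exact hη k l
    have h2 : ∏ l ∈ s.erase k, diagWeight (-η) (v k - v l) =
        (∏ l ∈ s.erase k, sinh (v k + η - v l)) / Δ k := by
      rw [hΔ, ← Finset.prod_div_distrib]
      exact Finset.prod_congr rfl fun l _ => by
        rw [diagWeight, show v k - v l - -η = v k + η - v l by ring]
    rw [← Finset.mul_prod_erase s _ hk, h2, show v k + η - v k = η by ring]
    have := hΔ0 k
    field_simp
  have hmain : ∑ j ∈ s, Φ (v j) / Δ j * (Λ j * R.pairing t (s.erase j)) =
      ∑ k ∈ s, (Φ (v k - η) / Δ k + (-1 : ℂ) ^ t.card * d k * (-Φ (v k + η) / Δ k)) *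
        R.pairing t (s.erase k) := by
    rw [Finset.sum_congr rfl fun j hj => by
      rw [hΛ, R.exchange_pairing hv hη hst hd ht hj, Finset.mul_sum], Finset.sum_comm]
    refine Finset.sum_congr rfl fun k hk => ?_
    rw [← hleft k hk, ← hright k hk, ← hint (v k - η) fun j _ => ?_, ← hint (v k + η) fun j _ => ?_]
    · simp only [Finset.mul_sum, Finset.sum_mul, ← Finset.sum_add_distrib, add_mul]
      refine Finset.sum_congr rfl fun j _ => ?_
      ring
    · rw [show v k + η - v j = v k - v j + η by ring]
      exact hη k j
    · rw [show v k - η - v j = -(v j - v k + η) by ring, Complex.sinh_neg]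
      exact neg_ne_zero.mpr (hη j k)
  have hzero : ∑ k ∈ s, (Φ (v k) * Λ k - Φ (v k - η) + (-1 : ℂ) ^ t.card * d k * Φ (v k + η)) *
      R.pairing t (s.erase k) / Δ k = 0 := by
    rw [← sub_eq_zero, ← Finset.sum_sub_distrib] at hmain
    rw [← hmain]
    refine Finset.sum_congr rfl fun k _ => ?_
    ring
  rw [← neg_eq_zero, ← hzero, ← Finset.sum_neg_distrib]
  refine Finset.sum_congr rfl fun k hk => ?_
  have hki : k ≠ i := fun h => Finset.disjoint_left.mp hd hi (h ▸ hk)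
  have key : Φ (v k) * Λ k - Φ (v k - η) + (-1 : ℂ) ^ t.card * d k * Φ (v k + η) =
      -((∏ a ∈ t, sinh (v k - v a - η)) * slavnovEntry η v d t i k) := by
    have e1 : ∀ a, v k - η - v a = v k - v a - η := fun a => by ring
    have e2 : ∀ a, v k + η - v a = v k - v a + η := fun a => by ring
    have e3 : v i - v k = -(v k - v i) := by ring
    have e4 : v i - v k + η = -(v k - v i - η) := by ring
    simp only [hΦ, hΛ, slavnovEntry, diagWeight, tFun, Finset.prod_div_distrib, e1, e2, sub_neg_eq_add]
    rw [← Finset.mul_prod_erase t (fun a => sinh (v k - v a)) hi,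
      ← Finset.mul_prod_erase t (fun a => sinh (v k - v a - η)) hi,
      ← Finset.mul_prod_erase t (fun a => sinh (v k - v a + η)) hi, e4, e3]
    have n1 : ∏ a ∈ t.erase i, sinh (v k - v a) ≠ 0 := Finset.prod_ne_zero_iff.mpr fun a ha =>
      hv k a fun h => Finset.disjoint_left.mp hd (Finset.mem_of_mem_erase ha) (h ▸ hk)
    have n2 : ∀ a, sinh (v k - v a - η) ≠ 0 := fun a => by
      rw [show v k - v a - η = -(v a - v k + η) by ring, Complex.sinh_neg]
      exact neg_ne_zero.mpr (hη a k)
    have n3 : ∏ a ∈ t.erase i, sinh (v k - v a - η) ≠ 0 :=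
      Finset.prod_ne_zero_iff.mpr fun a _ => n2 a
    have n4 := hv k i hki
    have n5 := hη k i
    have n6 := n2 i
    generalize ∏ a ∈ t.erase i, sinh (v k - v a) = q at *
    generalize ∏ a ∈ t.erase i, sinh (v k - v a - η) = q' at *
    generalize ∏ a ∈ t.erase i, sinh (v k - v a + η) = q'' at *
    generalize v k - v i = x at *
    have a1 : cosh x * sinh (x - η) - cosh (x - η) * sinh x = -sinh η := by
      rw [Complex.sinh_sub, Complex.cosh_sub]
      linear_combination (-sinh η) * Complex.cosh_sq x
    have a2 : cosh x * sinh (x + η) - cosh (x + η) * sinh x = sinh η := by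
      rw [Complex.sinh_add, Complex.cosh_add]
      linear_combination (sinh η) * Complex.cosh_sq x
    rw [Complex.sinh_neg, Complex.sinh_neg]
    field_simp
    linear_combination q' * a1 - (-1 : ℂ) ^ t.card * d k * q'' * a2
  rw [key]
  ring

end YBRep

/-! ### Solving the relations by determinants. -/

/-- A function on `n`-subsets satisfying the exchange relations of `ψ` vanishes as soon as it
vanishes on one subset `p` on which the vectors `ψ · k` are linearly independent. -/
theorem eq_zero_of_exchange_relation {ι κ : Type} [DecidableEq ι] [Fintype κ] (ψ : κ → ι → ℂ)
    (X : Finset ι → ℂ) (ω : Finset ι → ι → ℂ) (U : Set ι) (n : ℕ) (hω : ∀ s k, ω s k ≠ 0)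
    (hX : ∀ s : Finset ι, ↑s ⊆ U → s.card = n + 1 → ∀ i,
      ∑ k ∈ s, X (s.erase k) * ω s k * ψ i k = 0)
    {p : Finset ι} (hpU : ↑p ⊆ U) (hpn : p.card = n)
    (hp : ∀ k ∈ p, ∃ c : κ → ℂ, ∀ l ∈ p, ∑ i, c i * ψ i l = if l = k then 1 else 0)
    (hXp : X p = 0) (m : ℕ) : ∀ q : Finset ι, ↑q ⊆ U → q.card = n → (q \ p).card = m → X q = 0 := by
  induction m with
  | zero =>
    intro q _ hqn hm
    have : q ⊆ p := Finset.sdiff_eq_empty_iff_subset.mp (Finset.card_eq_zero.mp hm)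
    rwa [Finset.eq_of_subset_of_card_le this (by rw [hpn, hqn])]
  | succ m ih =>
    intro q hqU hqn hm
    have hpq : (p \ q).Nonempty := by
      rw [← Finset.card_pos, Finset.card_sdiff_comm (by rw [hpn, hqn] : p.card = q.card), hm]
      exact Nat.succ_pos m
    obtain ⟨k, hk⟩ := hpq
    rw [Finset.mem_sdiff] at hk
    obtain ⟨c, hc⟩ := hp k hk.1
    have hU : ↑(insert k q) ⊆ U := by
      rw [Finset.coe_insert]
      exact Set.insert_subset (hpU hk.1) hqU
    -- The element k of p ∖ q is added to q, and the rows are combined by the vector c dual to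
    -- column k on p. Terms with l in p ∩ q vanish by the choice of c. For l outside p the set
    -- obtained by removing l is closer to p, so the induction hypothesis applies. Only X q is left.
    have hrel : ∑ l ∈ insert k q, X ((insert k q).erase l) * ω (insert k q) l *
        ∑ i, c i * ψ i l = 0 := by
      have := fun i => hX (insert k q) hU (by rw [Finset.card_insert_of_notMem hk.2, hqn]) i
      calc _ = ∑ i, c i * ∑ l ∈ insert k q,
            X ((insert k q).erase l) * ω (insert k q) l * ψ i l := by
            simp only [Finset.mul_sum]
            rw [Finset.sum_comm]
            refine Finset.sum_congr rfl fun i _ => Finset.sum_congr rfl fun l _ => ?_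
            ring
        _ = 0 := by simp [this]
    rw [Finset.sum_insert hk.2, Finset.erase_insert hk.2, hc k hk.1, if_pos rfl, mul_one,
      Finset.sum_eq_zero, add_zero] at hrel
    · exact (mul_eq_zero.mp hrel).resolve_right (hω _ _)
    intro l hl
    have hlk : l ≠ k := fun h => hk.2 (h ▸ hl)
    by_cases hlp : l ∈ p
    · rw [hc l hlp, if_neg hlk, mul_zero]
    · rw [ih ((insert k q).erase l)]
      · simp
      · exact (Finset.coe_subset.mpr (Finset.erase_subset _ _)).trans hU
      · rw [Finset.card_erase_of_mem (Finset.mem_insert_of_mem hl),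
          Finset.card_insert_of_notMem hk.2, hqn, Nat.add_sub_cancel]
      · have : (insert k q).erase l \ p = (q \ p).erase l := by
          ext x
          simp only [Finset.mem_sdiff, Finset.mem_erase, Finset.mem_insert]
          constructor
          · rintro ⟨⟨h1, rfl | h2⟩, h3⟩
            · exact absurd hk.1 h3
            · exact ⟨h1, h2, h3⟩
          · rintro ⟨h1, h2, h3⟩
            exact ⟨⟨h1, Or.inr h2⟩, h3⟩
        rw [this, Finset.card_erase_of_mem (Finset.mem_sdiff.mpr ⟨hl, hlp⟩), hm,
          Nat.add_sub_cancel]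

/-- Laplace expansion along the first row of a square matrix in which row i of ψ occurs twice. -/
theorem sum_det_succAbove_eq_zero {n : ℕ} (ψ : Fin n → Fin (n + 1) → ℂ) (i : Fin n) :
    ∑ k : Fin (n + 1), (-1 : ℂ) ^ (k : ℕ) * ψ i k *
      (Matrix.of fun r c => ψ r (k.succAbove c)).det = 0 := by
  set N : Matrix (Fin (n + 1)) (Fin (n + 1)) ℂ :=
    Matrix.of fun r c => Fin.cases (ψ i c) (fun r' => ψ r' c) r with hN
  have h0 : N.det = 0 := Matrix.det_zero_of_row_eq (Fin.succ_ne_zero i).symm (by ext c; simp [hN])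
  rw [Matrix.det_succ_row_zero] at h0
  rw [← h0]
  refine Finset.sum_congr rfl fun k _ => ?_
  congr 1

section Order

variable {ι : Type} [LinearOrder ι]

/-- The product of `sh (v b - v a)` over pairs `a < b` in `s`. -/
noncomputable def sinhVandermonde (v : ι → ℂ) (s : Finset ι) : ℂ :=
  ∏ a ∈ s, ∏ b ∈ s with a < b, sinh (v b - v a)

/-- Orienting all factors at k as sinh(v_k − v_l) costs one sign for each larger element of `s`.
These are the alternating signs of a Laplace expansion. -/
theorem sinhVandermonde_erase (v : ι → ℂ) {s : Finset ι} {k : ι} (hk : k ∈ s) :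
    sinhVandermonde v s = sinhVandermonde v (s.erase k) *
      ((-1 : ℂ) ^ (s.filter (k < ·)).card * ∏ l ∈ s.erase k, sinh (v k - v l)) := by
  have h1 : ∀ a ∈ s.erase k, ∏ b ∈ s with a < b, sinh (v b - v a) =
      (∏ b ∈ s.erase k with a < b, sinh (v b - v a)) *
        (if a < k then sinh (v k - v a) else 1) := by
    intro a _
    rw [← Finset.insert_erase hk, Finset.filter_insert, Finset.erase_insert (Finset.notMem_erase k s)]
    split_ifs with h
    · rw [Finset.prod_insert (by simp), mul_comm]
    · rw [mul_one]
  rw [sinhVandermonde, ← Finset.mul_prod_erase _ _ hk, Finset.prod_congr rfl h1,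
    Finset.prod_mul_distrib, sinhVandermonde]
  have h2 : ∏ b ∈ s with k < b, sinh (v b - v k) =
      (-1 : ℂ) ^ (s.filter (k < ·)).card * ∏ b ∈ s.erase k, if b < k then 1 else sinh (v k - v b) := by
    have : s.filter (k < ·) = (s.erase k).filter (fun b => ¬ b < k) := by
      ext b
      simp only [Finset.mem_filter, Finset.mem_erase, not_lt]
      constructor
      · rintro ⟨h1, h2⟩
        exact ⟨⟨h2.ne', h1⟩, h2.le⟩
      · rintro ⟨⟨h1, h2⟩, h3⟩
        exact ⟨h2, lt_of_le_of_ne h3 h1.symm⟩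
    rw [Finset.prod_ite, Finset.prod_const_one, one_mul, ← this, ← Finset.prod_const,
      ← Finset.prod_mul_distrib]
    refine Finset.prod_congr rfl fun b _ => ?_
    rw [← neg_sub, Complex.sinh_neg]
    ring
  have h3 : ∏ l ∈ s.erase k, sinh (v k - v l) = (∏ b ∈ s.erase k, if b < k then 1 else sinh (v k - v b)) *
      ∏ a ∈ s.erase k, if a < k then sinh (v k - v a) else 1 := by
    rw [← Finset.prod_mul_distrib]
    refine Finset.prod_congr rfl fun b _ => ?_
    split_ifs <;> simp
  rw [h2, h3]
  ring

theorem sinhVandermonde_ne_zero {v : ι → ℂ} (hv : ∀ i j, i ≠ j → sinh (v i - v j) ≠ 0)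
    (s : Finset ι) : sinhVandermonde v s ≠ 0 :=
  Finset.prod_ne_zero_iff.mpr fun _ _ => Finset.prod_ne_zero_iff.mpr fun _ hb =>
    hv _ _ (Finset.mem_filter.mp hb).2.ne'

theorem card_filter_lt_orderEmbOfFin {s : Finset ι} {n : ℕ} (hs : s.card = n + 1) (k : Fin (n + 1)) :
    (s.filter (s.orderEmbOfFin hs k < ·)).card = n - k := by
  have : s.filter (s.orderEmbOfFin hs k < ·) =
      (Finset.Ioi k).map (s.orderEmbOfFin hs).toEmbedding := by
    ext b
    simp only [Finset.mem_filter, Finset.mem_map, Finset.mem_Ioi, RelEmbedding.coe_toEmbedding]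
    constructor
    · rintro ⟨hb, hlt⟩
      obtain ⟨j, rfl⟩ : b ∈ Set.range (s.orderEmbOfFin hs) := by
        rw [Finset.range_orderEmbOfFin]
        exact hb
      exact ⟨j, (s.orderEmbOfFin hs).lt_iff_lt.mp hlt, rfl⟩
    · rintro ⟨j, hj, rfl⟩
      exact ⟨Finset.orderEmbOfFin_mem _ _ _, (s.orderEmbOfFin hs).lt_iff_lt.mpr hj⟩
  rw [this, Finset.card_map, Fin.card_Ioi]
  omega

theorem orderEmbOfFin_erase {s : Finset ι} {n : ℕ} (hs : s.card = n + 1) (k : Fin (n + 1))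
    (h : (s.erase (s.orderEmbOfFin hs k)).card = n) (c : Fin n) :
    (s.erase (s.orderEmbOfFin hs k)).orderEmbOfFin h c = s.orderEmbOfFin hs (k.succAbove c) := by
  have := Finset.orderEmbOfFin_unique h (f := fun c => s.orderEmbOfFin hs (k.succAbove c))
    (fun c => Finset.mem_erase.mpr ⟨fun e => Fin.succAbove_ne k c
      ((s.orderEmbOfFin hs).injective e), Finset.orderEmbOfFin_mem _ _ _⟩)
    ((s.orderEmbOfFin hs).strictMono.comp (Fin.strictMono_succAbove k))
  exact (congrFun this c).symm

/-- The determinant of `ψ` on the `n`-subset `s`. -/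
noncomputable def subsetDet {n : ℕ} (ψ : Fin n → ι → ℂ) (s : Finset ι) : ℂ :=
  if h : s.card = n then (Matrix.of fun r c => ψ r (s.orderEmbOfFin h c)).det else 0

/-- Solution of the exchange relations by determinants. -/
theorem exchange_relation_det {n : ℕ} (ψ : Fin n → ι → ℂ) {v : ι → ℂ}
    (hv : ∀ i j, i ≠ j → sinh (v i - v j) ≠ 0) (w : ι → ℂ) (hw : ∀ k, w k ≠ 0)
    (X : Finset ι → ℂ) (U : Set ι)
    (hX : ∀ s : Finset ι, ↑s ⊆ U → s.card = n + 1 → ∀ i,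
      ∑ k ∈ s, X (s.erase k) * (w k / ∏ l ∈ s.erase k, sinh (v k - v l)) * ψ i k = 0)
    {p q : Finset ι} (hpU : ↑p ⊆ U) (hpn : p.card = n) (hqU : ↑q ⊆ U) (hqn : q.card = n)
    (hp : subsetDet ψ p ≠ 0) :
    X q * (sinhVandermonde v q / ∏ a ∈ q, w a) * subsetDet ψ p =
      X p * (sinhVandermonde v p / ∏ a ∈ p, w a) * subsetDet ψ q := by
  -- Passing from G(s∖k) to G(s) costs exactly the weight of the k-th term, up to the sign counting
  -- elements above k. The relations for G · det therefore reduce to `sum_det_succAbove_eq_zero`.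
  set G : Finset ι → ℂ := fun s => (∏ a ∈ s, w a) / sinhVandermonde v s with hG
  have hV := sinhVandermonde_ne_zero hv
  have hP : ∀ s : Finset ι, ∏ a ∈ s, w a ≠ 0 := fun s => Finset.prod_ne_zero_iff.mpr fun a _ => hw a
  have hG0 : ∀ s, G s ≠ 0 := fun s => div_ne_zero (hP s) (hV s)
  have hdet : ∀ s : Finset ι, s.card = n + 1 → ∀ i, ∑ k ∈ s, (G (s.erase k) *
      subsetDet ψ (s.erase k)) * (w k / ∏ l ∈ s.erase k, sinh (v k - v l)) * ψ i k = 0 := by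
    intro s hs i
    have hterm : ∀ k ∈ s, (G (s.erase k) * subsetDet ψ (s.erase k)) *
        (w k / ∏ l ∈ s.erase k, sinh (v k - v l)) * ψ i k =
        G s * ((-1 : ℂ) ^ (s.filter (k < ·)).card * ψ i k * subsetDet ψ (s.erase k)) := by
      intro k hk
      have h1 := hV (s.erase k)
      have h2 : ∏ l ∈ s.erase k, sinh (v k - v l) ≠ 0 := Finset.prod_ne_zero_iff.mpr fun l hl =>
        hv k l (Finset.ne_of_mem_erase hl).symm
      have h3 : ((-1 : ℂ) ^ (s.filter (k < ·)).card) * (-1 : ℂ) ^ (s.filter (k < ·)).card = 1 := by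
        rw [← mul_pow]
        simp
      have h4 : ((-1 : ℂ) ^ (s.filter (k < ·)).card) ≠ 0 := pow_ne_zero _ (by simp)
      simp only [hG]
      rw [sinhVandermonde_erase v hk, ← Finset.mul_prod_erase s w hk]
      field_simp
    rw [Finset.sum_congr rfl hterm, ← Finset.mul_sum]
    refine mul_eq_zero_of_right _ ?_
    have hsum := sum_det_succAbove_eq_zero (fun r k => ψ r (s.orderEmbOfFin hs k)) i
    have hmap : s = Finset.univ.map (s.orderEmbOfFin hs).toEmbedding := by
      rw [Finset.map_orderEmbOfFin_univ]
    rw [Finset.sum_congr hmap fun _ _ => rfl, Finset.sum_map]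
    have hterm' : ∀ k : Fin (n + 1), (-1 : ℂ) ^ (s.filter (s.orderEmbOfFin hs k < ·)).card *
        ψ i (s.orderEmbOfFin hs k) * subsetDet ψ (s.erase (s.orderEmbOfFin hs k)) =
        (-1 : ℂ) ^ n * ((-1 : ℂ) ^ (k : ℕ) * ψ i (s.orderEmbOfFin hs k) *
          (Matrix.of fun r c => ψ r (s.orderEmbOfFin hs (k.succAbove c))).det) := by
      intro k
      have hc : (s.erase (s.orderEmbOfFin hs k)).card = n := by
        rw [Finset.card_erase_of_mem (Finset.orderEmbOfFin_mem _ _ _), hs, Nat.add_sub_cancel]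
      rw [card_filter_lt_orderEmbOfFin, subsetDet, dif_pos hc]
      simp only [orderEmbOfFin_erase hs k hc]
      have : (-1 : ℂ) ^ (n - (k : ℕ)) = (-1 : ℂ) ^ n * (-1 : ℂ) ^ (k : ℕ) := by
        have hk : (-1 : ℂ) ^ n = (-1 : ℂ) ^ (n - (k : ℕ)) * (-1 : ℂ) ^ (k : ℕ) := by
          rw [← pow_add, Nat.sub_add_cancel (Nat.lt_succ_iff.mp k.isLt)]
        rw [hk, mul_assoc, ← mul_pow]
        simp
      rw [this]
      ring
    simp only [RelEmbedding.coe_toEmbedding, hterm', ← Finset.mul_sum, hsum, mul_zero]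
  -- With this constant X − c · G · det vanishes at `p`, so uniqueness forces it to vanish at `q`.
  set c := X p / (G p * subsetDet ψ p) with hc
  have hz := eq_zero_of_exchange_relation ψ (fun s => X s - c * (G s * subsetDet ψ s))
    (fun s k => if k ∈ s then w k / ∏ l ∈ s.erase k, sinh (v k - v l) else 1) U n ?_ ?_ hpU hpn ?_ ?_
    (q \ p).card q hqU hqn rfl
  · have h1 : X q = c * (G q * subsetDet ψ q) := sub_eq_zero.mp hz
    rw [h1, hc]
    simp only [hG]
    have h2 := hV p
    have h3 := hV q
    have h4 := hP p
    have h5 := hP q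
    field_simp
  · intro s k
    split_ifs with h
    · exact div_ne_zero (hw k) (Finset.prod_ne_zero_iff.mpr fun l hl =>
        hv k l (Finset.ne_of_mem_erase hl).symm)
    · exact one_ne_zero
  · intro s hsU hs i
    rw [← sub_eq_zero.mpr ((hX s hsU hs i).trans (by rw [hdet s hs i, mul_zero] :
      0 = c * ∑ k ∈ s, (G (s.erase k) * subsetDet ψ (s.erase k)) *
        (w k / ∏ l ∈ s.erase k, sinh (v k - v l)) * ψ i k)), Finset.mul_sum, ← Finset.sum_sub_distrib]
    refine Finset.sum_congr rfl fun k hk => ?_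
    rw [if_pos hk]
    ring
  · intro k hk
    rw [subsetDet, dif_pos hpn] at hp
    obtain ⟨k', rfl⟩ : k ∈ Set.range (p.orderEmbOfFin hpn) := by
      rw [Finset.range_orderEmbOfFin]
      exact hk
    set P : Matrix (Fin n) (Fin n) ℂ := Matrix.of fun r c => ψ r (p.orderEmbOfFin hpn c) with hPdef
    refine ⟨P⁻¹ k', fun l hl => ?_⟩
    obtain ⟨l', rfl⟩ : l ∈ Set.range (p.orderEmbOfFin hpn) := by
      rw [Finset.range_orderEmbOfFin]
      exact hl
    have := congrFun (congrFun (Matrix.nonsing_inv_mul P (isUnit_iff_ne_zero.mpr hp)) k') l'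
    rw [Matrix.mul_apply] at this
    simp only [EmbeddingLike.apply_eq_iff_eq]
    rw [Matrix.one_apply] at this
    simp only [hPdef, Matrix.of_apply] at this ⊢
    rw [this]
    simp only [eq_comm]
  · have := hG0 p
    simp only [hc]
    field_simp
    simp

end Order

/-! ### Scalar products at zeros of d. -/

theorem exchWeight_neg (η x : ℂ) : exchWeight (-η) x = -exchWeight η x := by
  rw [exchWeight, exchWeight, Complex.sinh_neg, neg_div]

/-- Counterpart of `exchWeight_identity` for `YBRep.C_bvec_sub_mem_nullSpan`, where coefficients of
`A` and of `D` get multiplied. -/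
theorem exchWeight_mul_diagWeight_identity (η : ℂ) {x y : ℂ} (hx : sinh x ≠ 0) (hy : sinh y ≠ 0)
    (hxy : sinh (x + y) ≠ 0) :
    exchWeight η (x + y) - exchWeight η x * diagWeight η (x + y) * exchWeight η y =
      exchWeight η (x + y) * diagWeight (-η) (-y) * diagWeight η x := by
  simp only [diagWeight, exchWeight, Complex.sinh_neg]
  have : sinh (-y - -η) = - sinh (y - η) := by rw [← Complex.sinh_neg]; ring_nf
  rw [this]
  field_simp
  simp only [Complex.sinh_add, Complex.sinh_sub, Complex.cosh_add]
  linear_combination (-(sinh η * sinh x * sinh y)) * Complex.cosh_sq η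

namespace YBRep

variable {ι : Type} {η : ℂ} {v d : ι → ℂ} {V W : Type} [AddCommGroup V] [Module ℂ V]
  (R : YBRep η v d V)

/-- The span of the Bethe vectors on subsets of `S` which contain a zero of `d`. -/
noncomputable def nullSpan (S : Finset ι) : Submodule ℂ V :=
  Submodule.span ℂ (R.bvec '' {s | s ⊆ S ∧ ∃ i ∈ s, d i = 0})

theorem bvec_mem_nullSpan {s S : Finset ι} (h : s ⊆ S) {i : ι} (hi : i ∈ s) (hd : d i = 0) :
    R.bvec s ∈ R.nullSpan S :=
  Submodule.subset_span ⟨s, ⟨h, i, hi, hd⟩, rfl⟩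

theorem nullSpan_mono {S T : Finset ι} (h : S ⊆ T) : R.nullSpan S ≤ R.nullSpan T :=
  Submodule.span_mono (Set.image_mono fun _ ht => ⟨ht.1.trans h, ht.2⟩)

theorem map_mem_nullSpan {X : Module.End ℂ V} {S T : Finset ι}
    (h : ∀ s ⊆ S, ∀ i ∈ s, d i = 0 → X (R.bvec s) ∈ R.nullSpan T) {w : V}
    (hw : w ∈ R.nullSpan S) : X w ∈ R.nullSpan T := by
  have : R.nullSpan S ≤ (R.nullSpan T).comap X := by
    rw [nullSpan, Submodule.span_le]
    rintro _ ⟨s, ⟨hs, i, hi, hd⟩, rfl⟩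
    exact h s hs i hi hd
  exact this hw

theorem map_betheSpan_mem_nullSpan {X : Module.End ℂ V} {S T : Finset ι}
    (h : ∀ s ⊆ S, X (R.bvec s) ∈ R.nullSpan T) {w : V} (hw : w ∈ R.betheSpan S) :
    X w ∈ R.nullSpan T := by
  have : R.betheSpan S ≤ (R.nullSpan T).comap X := by
    rw [betheSpan, Submodule.span_le]
    rintro _ ⟨s, hs, rfl⟩
    exact h s hs
  exact this hw

variable [DecidableEq ι]

theorem B_mem_nullSpan {S : Finset ι} {u : ι} (hu : u ∉ S) {w : V} (hw : w ∈ R.nullSpan S) :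
    R.B u w ∈ R.nullSpan (insert u S) := by
  refine R.map_mem_nullSpan (fun s hs i hi hd => ?_) hw
  rw [← bvec_insert _ fun h => hu (hs h)]
  exact R.bvec_mem_nullSpan (Finset.insert_subset_insert _ hs) (Finset.mem_insert_of_mem hi) hd

theorem B_mem_nullSpan_of_eq_zero {S : Finset ι} {u : ι} (hu : u ∉ S) (hd : d u = 0) {w : V}
    (hw : w ∈ R.betheSpan S) : R.B u w ∈ R.nullSpan (insert u S) := by
  refine R.map_betheSpan_mem_nullSpan (fun s hs => ?_) hw
  rw [← bvec_insert _ fun h => hu (hs h)]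
  exact R.bvec_mem_nullSpan (Finset.insert_subset_insert _ hs) (Finset.mem_insert_self _ _) hd

/-- Either the old zero survives, or a point is exchanged for `u`, which is itself a zero. -/
theorem A_mem_nullSpan (hv : ∀ i j, i ≠ j → sinh (v i - v j) ≠ 0) {S : Finset ι} {u : ι}
    (hu : u ∉ S) (hd : d u = 0) {w : V} (hw : w ∈ R.nullSpan S) :
    R.A u w ∈ R.nullSpan (insert u S) := by
  refine R.map_mem_nullSpan (fun s hs i hi hdi => ?_) hw
  rw [R.A_bvec hv fun h => hu (hs h)]
  refine add_mem (Submodule.smul_mem _ _ (R.bvec_mem_nullSpan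
    (hs.trans (Finset.subset_insert _ _)) hi hdi)) (Submodule.sum_mem _ fun k _ =>
      Submodule.smul_mem _ _ (R.bvec_mem_nullSpan ?_ (Finset.mem_insert_self _ _) hd))
  exact Finset.insert_subset_insert _ ((Finset.erase_subset _ _).trans hs)

/-- Here `u` is arbitrary: exchanging away the zero i carries the coefficient d i = 0. -/
theorem D_mem_nullSpan (hv : ∀ i j, i ≠ j → sinh (v i - v j) ≠ 0) {S : Finset ι} {u : ι}
    (hu : u ∉ S) {w : V} (hw : w ∈ R.nullSpan S) :
    R.D u w ∈ R.nullSpan (insert u S) := by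
  refine R.map_mem_nullSpan (fun s hs i hi hdi => ?_) hw
  rw [R.D_bvec hv fun h => hu (hs h)]
  refine Submodule.smul_mem _ _ (add_mem (Submodule.smul_mem _ _ (R.bvec_mem_nullSpan
    (hs.trans (Finset.subset_insert _ _)) hi hdi)) (Submodule.sum_mem _ fun k _ => ?_))
  by_cases hik : i = k
  · rw [← hik, hdi, zero_mul, zero_mul, zero_smul]
    exact zero_mem _
  · exact Submodule.smul_mem _ _ (R.bvec_mem_nullSpan
      (Finset.insert_subset_insert _ ((Finset.erase_subset _ _).trans hs))
      (Finset.mem_insert_of_mem (Finset.mem_erase.mpr ⟨hik, hi⟩)) hdi)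

theorem D_mem_nullSpan_of_eq_zero (hv : ∀ i j, i ≠ j → sinh (v i - v j) ≠ 0) {S : Finset ι}
    {u : ι} (hu : u ∉ S) (hd : d u = 0) {w : V} (hw : w ∈ R.betheSpan S) :
    R.D u w ∈ R.nullSpan (insert u S) := by
  refine R.map_betheSpan_mem_nullSpan (fun s hs => ?_) hw
  rw [R.D_bvec hv fun h => hu (hs h), hd, zero_mul, zero_smul, zero_add]
  exact Submodule.smul_mem _ _ (Submodule.sum_mem _ fun k _ => Submodule.smul_mem _ _
    (R.bvec_mem_nullSpan (Finset.insert_subset_insert _ ((Finset.erase_subset _ _).trans hs))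
      (Finset.mem_insert_self _ _) hd))

/-- Peel off `B i` at a zero i and apply `CB`. In both products A D the operator `D` acts at a zero,
which yields a null vector, and `A` at a zero keeps it null. The remaining term has `B i` in front.
-/
theorem C_mem_nullSpan (hv : ∀ i j, i ≠ j → sinh (v i - v j) ≠ 0) {S : Finset ι} {u : ι}
    (hu : u ∉ S) (hd : d u = 0) {w : V} (hw : w ∈ R.nullSpan S) :
    R.C u w ∈ R.nullSpan (insert u S) := by
  refine R.map_mem_nullSpan (fun s hs i hi hdi => ?_) hw
  have hui : u ≠ i := fun h => hu (hs (h ▸ hi))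
  have hr : insert i (s.erase i) = s := Finset.insert_erase hi
  have hir : i ∉ s.erase i := Finset.notMem_erase _ _
  have hur : u ∉ s.erase i := fun h => hu (hs (Finset.mem_of_mem_erase h))
  have h1 := LinearMap.congr_fun (R.CB u i hui) (R.bvec (s.erase i))
  simp only [Module.End.mul_apply, LinearMap.smul_apply, LinearMap.add_apply,
    LinearMap.sub_apply] at h1
  refine R.nullSpan_mono (Finset.insert_subset_insert u hs) ?_
  have m := R.bvec_mem (Finset.Subset.refl (s.erase i))
  have hi' : i ∉ insert u (s.erase i) := by simp [Ne.symm hui]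
  have hu' : u ∉ insert i (s.erase i) := by rw [hr]; exact fun h => hu (hs h)
  have e : insert u s = insert i (insert u (s.erase i)) := by rw [Finset.insert_comm, hr]
  have m1 := R.A_mem_nullSpan hv hi' hdi (R.D_mem_nullSpan_of_eq_zero hv hur hd m)
  have m2 := R.A_mem_nullSpan hv hu' hd (R.D_mem_nullSpan_of_eq_zero hv hir hdi m)
  have m3 := R.B_mem_nullSpan_of_eq_zero hi' hdi (R.C_mem hv hur m)
  rw [hr] at m2
  rw [← e] at m1 m3
  have h2 : R.bvec s = R.B i (R.bvec (s.erase i)) := by rw [← bvec_insert _ hir, hr]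
  rw [h2, eq_sub_of_add_eq h1]
  exact sub_mem (Submodule.smul_mem _ _ (sub_mem m1 m2)) m3

theorem bra_nullSpan {S : Finset ι} {w : V} (hw : w ∈ R.nullSpan S) : R.bra w = 0 := by
  have : R.nullSpan S ≤ LinearMap.ker R.bra := by
    rw [nullSpan, Submodule.span_le]
    rintro _ ⟨s, ⟨-, i, hi, -⟩, rfl⟩
    rw [← Finset.insert_erase hi, bvec_insert _ (Finset.notMem_erase _ _)]
    exact LinearMap.congr_fun (R.bra_B i) _
  exact this hw

/-- Null vectors stay null under `C` at zeros of d, and the bra kills them because their Bethe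
vectors are nonempty products of `B`. They can thus be discarded in the recursion. -/
theorem bra_cProd_nullSpan (hv : ∀ i j, i ≠ j → sinh (v i - v j) ≠ 0) (t : Finset ι) :
    ∀ {S : Finset ι}, Disjoint t S → (∀ i ∈ t, d i = 0) → ∀ {w : V}, w ∈ R.nullSpan S →
      R.bra (R.cProd t w) = 0 := by
  induction t using Finset.induction_on with
  | empty => intro S _ _ w hw; rw [cProd_empty]; exact R.bra_nullSpan hw
  | insert i t hi ih =>
    intro S h hd w hw
    rw [Finset.disjoint_insert_left] at h
    rw [cProd_insert' _ hi, Module.End.mul_apply]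
    exact ih (Finset.disjoint_insert_right.mpr ⟨hi, h.2⟩)
      (fun j hj => hd j (Finset.mem_insert_of_mem hj))
      (R.C_mem_nullSpan hv h.1 (hd i (Finset.mem_insert_self _ _)) hw)

/-- The coefficient in the action of `C u` on a Bethe vector, for a zero `u` of `d`. -/
noncomputable def loweringWeight (η : ℂ) (v d : ι → ℂ) (u : ι) (s : Finset ι) (n : ι) : ℂ :=
  (-1 : ℂ) ^ s.card * exchWeight η (v u - v n) * d n *
    ∏ i ∈ s.erase n, diagWeight (-η) (v n - v i) * diagWeight η (v u - v i)

/-- In `CB'` the product `D u * A j` gives a null vector because d u = 0. In `D j * A u` only the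
diagonal part of `A u` counts, since its exchanged vectors contain the zero `u`. What survives is `D
j` on a Bethe vector and the induction hypothesis. -/
theorem C_bvec_sub_mem_nullSpan (hv : ∀ i j, i ≠ j → sinh (v i - v j) ≠ 0) {u : ι}
    (hd : d u = 0) (s : Finset ι) : u ∉ s →
    R.C u (R.bvec s) - ∑ n ∈ s, loweringWeight η v d u s n • R.bvec (s.erase n) ∈
      R.nullSpan (insert u s) := by
  induction s using Finset.induction_on with
  | empty => intro _; rw [bvec_empty, R.C_vac]; simp
  | insert j s hj ih =>
    intro hu
    rw [Finset.mem_insert, not_or] at hu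
    obtain ⟨huj, hus⟩ := hu
    have h1 := LinearMap.congr_fun (R.CB' u j huj) (R.bvec s)
    simp only [Module.End.mul_apply, LinearMap.smul_apply, LinearMap.add_apply,
      LinearMap.sub_apply] at h1
    have hju : j ∉ insert u s := by simp [Ne.symm huj, hj]
    have huj' : u ∉ insert j s := by simp [huj, hus]
    have m := R.bvec_mem (Finset.Subset.refl s)
    have m1 := R.D_mem_nullSpan_of_eq_zero hv huj' hd (R.A_mem hv hj m)
    have m2 := R.B_mem_nullSpan hju (ih hus)
    have m3 : R.D j (∑ k ∈ s, (exchWeight η (v u - v k) *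
        ∏ i ∈ s.erase k, diagWeight η (v k - v i)) • R.bvec (insert u (s.erase k))) ∈
        R.nullSpan (insert j (insert u s)) := by
      refine R.D_mem_nullSpan hv hju (Submodule.sum_mem _ fun k _ => Submodule.smul_mem _ _ ?_)
      exact R.bvec_mem_nullSpan (Finset.insert_subset_insert _ (Finset.erase_subset _ _))
        (Finset.mem_insert_self _ _) hd
    rw [Finset.insert_comm] at m2 m3
    convert sub_mem (sub_mem (Submodule.smul_mem _ (exchWeight η (v u - v j)) m1) m2)
      (Submodule.smul_mem _ (exchWeight η (v u - v j)) m3) using 1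
    have h2 : R.D j (R.A u (R.bvec s)) = (∏ i ∈ s, diagWeight η (v u - v i)) • R.D j (R.bvec s) +
        R.D j (∑ k ∈ s, (exchWeight η (v u - v k) *
        ∏ i ∈ s.erase k, diagWeight η (v k - v i)) • R.bvec (insert u (s.erase k))) := by
      rw [R.A_bvec hv hus, map_add, map_smul]
    rw [bvec_insert _ hj, eq_sub_of_add_eq h1, h2, map_sub, map_sum (R.B j), Finset.sum_insert hj,
      Finset.erase_insert hj]
    have h3 : ∑ k ∈ s, loweringWeight η v d u (insert j s) k • R.bvec ((insert j s).erase k) =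
        -∑ k ∈ s, R.B j (loweringWeight η v d u s k • R.bvec (s.erase k)) -
        (exchWeight η (v u - v j) * (∏ i ∈ s, diagWeight η (v u - v i)) * (-1 : ℂ) ^ s.card) •
          ∑ k ∈ s, (d k * exchWeight (-η) (v j - v k) *
            ∏ i ∈ s.erase k, diagWeight (-η) (v k - v i)) • R.bvec (insert j (s.erase k)) := by
      rw [Finset.smul_sum, ← Finset.sum_neg_distrib, ← Finset.sum_sub_distrib]
      refine Finset.sum_congr rfl fun k hk => ?_
      have hkj : k ≠ j := fun h => hj (h ▸ hk)
      have huk : u ≠ k := fun h => hus (h ▸ hk)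
      have hje : j ∉ s.erase k := fun h => hj (Finset.mem_of_mem_erase h)
      rw [map_smul, ← bvec_insert _ hje, Finset.erase_insert_of_ne hkj.symm, smul_smul,
        ← neg_smul, ← sub_smul]
      congr 1
      have h5 := exchWeight_mul_diagWeight_identity η (hv u j huj) (hv j k hkj.symm)
        (by rw [sub_add_sub_cancel]; exact hv u k huk)
      rw [sub_add_sub_cancel, neg_sub] at h5
      rw [loweringWeight, loweringWeight, Finset.erase_insert_of_ne hkj.symm,
        Finset.prod_insert hje, Finset.card_insert_of_notMem hj, pow_succ, exchWeight_neg,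
        ← Finset.mul_prod_erase s _ hk, Finset.prod_mul_distrib]
      linear_combination ((-1 : ℂ) ^ s.card * d k *
        (∏ i ∈ s.erase k, diagWeight (-η) (v k - v i)) *
        ∏ i ∈ s.erase k, diagWeight η (v u - v i)) * h5
    rw [h3, R.D_bvec hv hj, loweringWeight, Finset.erase_insert hj,
      Finset.card_insert_of_notMem hj, pow_succ, Finset.prod_mul_distrib]
    module

/-- Recursion for scalar products at zeros of `d`. -/
theorem pairing_insert (hv : ∀ i j, i ≠ j → sinh (v i - v j) ≠ 0) {t s : Finset ι} {u : ι}
    (hu : u ∉ t) (hd : ∀ i ∈ insert u t, d i = 0) (h : Disjoint (insert u t) s) :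
    R.pairing (insert u t) s = ∑ n ∈ s, loweringWeight η v d u s n * R.pairing t (s.erase n) := by
  have h' := Finset.disjoint_insert_left.mp h
  have hm := R.C_bvec_sub_mem_nullSpan hv (hd u (Finset.mem_insert_self _ _)) s h'.1
  have hz := R.bra_cProd_nullSpan hv t (Finset.disjoint_insert_right.mpr ⟨hu, h'.2⟩)
    (fun i hi => hd i (Finset.mem_insert_of_mem hi)) hm
  rw [map_sub, map_sub, sub_eq_zero, ← Module.End.mul_apply, ← cProd_insert' _ hu] at hz
  rw [pairing, hz]
  simp only [map_sum, map_smul, smul_eq_mul, pairing]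

end YBRep

/-! ### The lattice Fock space as a representation. -/

section Vacuum

variable {M : ℕ}

/-- The degree zero component of a vector of the Fock space. -/
noncomputable def vacuumBra (M : ℕ) : Fock (Fin M) →ₗ[ℂ] ℂ :=
  (ExteriorAlgebra.algebraMapInv : Fock (Fin M) →ₐ[ℂ] ℂ).toLinearMap

theorem vacuumBra_create (m : Fin M) (x : Fock (Fin M)) : vacuumBra M (create m x) = 0 := by
  simp [vacuumBra, create, ExteriorAlgebra.algebraMapInv]

theorem monodromyMatrix_cons (η : ℂ) (ξ : Fin M → ℂ) (u : ℂ) (m : Fin M) (s : List (Fin M)) :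
    monodromyMatrix η ξ u (m :: s) = lax η m (u - ξ m) * monodromyMatrix η ξ u s := by
  simp [monodromyMatrix]

/-- Both entries are odd, hence anticommute. On the ket side the annihilator then reaches the
vacuum; on the bra side `B` comes to stand next to the bra. -/
theorem annihilate_B_swap (η : ℂ) (ξ : Fin M → ℂ) (u v : ℂ) {m : Fin M} {s : List (Fin M)}
    (hm : m ∉ s) (x : Fock (Fin M)) :
    lax η m v 1 0 (monodromyMatrix η ξ u s 0 1 x) =
      -monodromyMatrix η ξ u s 0 1 (lax η m v 1 0 x) := by
  have := LinearMap.congr_fun (gradedCommute_monodromyMatrix η ξ u v s m hm 0 1 1 0) x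
  rw [← Module.End.mul_apply (monodromyMatrix η ξ u s 0 1), this]
  simp

theorem number_vacuum (m : Fin M) : number m (1 : Fock (Fin M)) = 0 := by
  rw [number, Module.End.mul_apply, annihilate_vacuum, map_zero]

theorem vacuumBra_number (m : Fin M) (x : Fock (Fin M)) : vacuumBra M (number m x) = 0 := by
  rw [number, Module.End.mul_apply, vacuumBra_create]

theorem monodromyMatrix_vacuum (η : ℂ) (ξ : Fin M → ℂ) (u : ℂ) (s : List (Fin M))
    (hs : s.Nodup) :
    monodromyMatrix η ξ u s 0 0 1 = 1 ∧ monodromyMatrix η ξ u s 1 0 1 = 0 ∧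
      monodromyMatrix η ξ u s 1 1 1 =
        (s.map fun m => sinh (u - ξ m) / sinh (u - ξ m + η)).prod • (1 : Fock (Fin M)) := by
  induction s with
  | nil => simp [monodromyMatrix]
  | cons m s ih =>
    rw [List.nodup_cons] at hs
    obtain ⟨h1, h2, h3⟩ := ih hs.2
    have h4 := annihilate_B_swap η ξ u (u - ξ m) hs.1 1
    simp only [monodromyMatrix_cons, Matrix.mul_apply, Fin.sum_univ_two, LinearMap.add_apply,
      Module.End.mul_apply, h1, h2, h3, h4]
    refine ⟨?_, ?_, ?_⟩
    · simp [lax, number_vacuum]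
    · simp [lax, annihilate_vacuum]
    · simp [lax, number_vacuum, annihilate_vacuum, smul_smul, mul_comm]

theorem vacuumBra_monodromyMatrix (η : ℂ) (ξ : Fin M → ℂ) (u : ℂ) (s : List (Fin M))
    (hs : s.Nodup) (x : Fock (Fin M)) :
    vacuumBra M (monodromyMatrix η ξ u s 0 0 x) = vacuumBra M x ∧
      vacuumBra M (monodromyMatrix η ξ u s 0 1 x) = 0 ∧
      vacuumBra M (monodromyMatrix η ξ u s 1 1 x) =
        (s.map fun m => sinh (u - ξ m) / sinh (u - ξ m + η)).prod * vacuumBra M x := by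
  induction s generalizing x with
  | nil => simp [monodromyMatrix]
  | cons m s ih =>
    rw [List.nodup_cons] at hs
    have ih := ih hs.2
    simp only [monodromyMatrix_cons, Matrix.mul_apply, Fin.sum_univ_two, LinearMap.add_apply,
      Module.End.mul_apply, map_add, annihilate_B_swap η ξ u (u - ξ m) hs.1, map_neg, (ih _).2.1]
    refine ⟨?_, ?_, ?_⟩
    · simp [lax, vacuumBra_number, vacuumBra_create, (ih x).1]
    · simp [lax, vacuumBra_number, vacuumBra_create, (ih x).2.1]
    · simp [lax, vacuumBra_number, (ih x).2.2, mul_assoc]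

theorem prod_map_sites (f : Fin M → ℂ) : ((sites M).map f).prod = ∏ m, f m := by
  rw [sites, List.map_reverse, List.prod_reverse, Fin.prod_univ_def]

end Vacuum

section LatticeRep

variable {M : ℕ} {ι : Type} {η : ℂ} {ξ : Fin M → ℂ} {v : ι → ℂ}

/-- Clearing denominators in the exchange coefficients. -/
theorem sinh_mul_weights (η : ℂ) {x : ℂ} (hx : sinh x ≠ 0) :
    sinh x * diagWeight (-η) x = sinh (x + η) ∧ sinh x * diagWeight η (-x) = sinh (x + η) ∧
      sinh x * exchWeight η x = sinh η ∧ sinh x * exchWeight η (-x) = -sinh η ∧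
      sinh x * exchWeight (-η) x = -sinh η := by
  refine ⟨?_, ?_, ?_, ?_, ?_⟩
  · rw [diagWeight, sub_neg_eq_add, mul_div_cancel₀ _ hx]
  · rw [diagWeight, show -x - η = -(x + η) by ring, Complex.sinh_neg, Complex.sinh_neg,
      neg_div_neg_eq, mul_div_cancel₀ _ hx]
  · rw [exchWeight, mul_div_cancel₀ _ hx]
  · rw [exchWeight, Complex.sinh_neg, div_neg, mul_neg, mul_div_cancel₀ _ hx]
  · rw [exchWeight_neg, exchWeight, mul_neg, mul_div_cancel₀ _ hx]

/-- The representation carried by the lattice Fock space. -/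
noncomputable def latticeRep (hξ : ∀ i m, sinh (v i - ξ m + η) ≠ 0)
    (hv : ∀ i j, i ≠ j → sinh (v i - v j) ≠ 0) (hη : ∀ i j, i ≠ j → sinh (v i - v j + η) ≠ 0) :
    YBRep η v (fun i => dVac η ξ (v i)) (Fock (Fin M)) where
  A i := opA η ξ (v i)
  B i := opB η ξ (v i)
  C i := opC η ξ (v i)
  D i := opD η ξ (v i)
  vac := 1
  bra := vacuumBra M
  BB i j := by
    by_cases h : i = j
    · rw [h]
    · exact smul_right_injective _ (hη i j h) (yangBaxter_entries (hξ i) (hξ j)).1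
  CC i j := by
    by_cases h : i = j
    · rw [h]
    · exact smul_right_injective _ (hη i j h) (yangBaxter_entries (hξ i) (hξ j)).2.1
  AB i j h := by
    have := (yangBaxter_entries (hξ j) (hξ i)).2.2.1
    refine smul_right_injective _ (hv j i h.symm) ?_
    obtain ⟨-, w2, -, w4, -⟩ := sinh_mul_weights η (hv j i h.symm)
    rw [← neg_sub (v j) (v i)]
    simp only [smul_add, smul_smul, w2, w4]
    linear_combination (norm := module) -this
  DB i j h := by
    have := (yangBaxter_entries (hξ i) (hξ j)).2.2.2.1
    refine smul_right_injective _ (hv i j h) ?_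
    obtain ⟨w1, -, -, -, w5⟩ := sinh_mul_weights η (hv i j h)
    simp only [smul_add, smul_neg, smul_smul, w1, w5]
    linear_combination (norm := module) this
  CA i j h := by
    have := (yangBaxter_entries (hξ j) (hξ i)).2.2.2.2.1
    refine smul_right_injective _ (hv j i h.symm) ?_
    obtain ⟨-, w2, -, w4, -⟩ := sinh_mul_weights η (hv j i h.symm)
    rw [← neg_sub (v j) (v i)]
    simp only [smul_add, smul_smul, w2, w4]
    linear_combination (norm := module) this
  CD i j h := by
    have := (yangBaxter_entries (hξ i) (hξ j)).2.2.2.2.2.1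
    refine smul_right_injective _ (hv i j h) ?_
    obtain ⟨w1, -, -, -, w5⟩ := sinh_mul_weights η (hv i j h)
    simp only [smul_add, smul_neg, smul_smul, w1, w5]
    linear_combination (norm := module) this
  CB i j h := by
    have := (yangBaxter_entries (hξ i) (hξ j)).2.2.2.2.2.2.1
    refine smul_right_injective _ (hv i j h) ?_
    obtain ⟨-, -, w3, -, -⟩ := sinh_mul_weights η (hv i j h)
    simp only [smul_add, smul_smul, w3]
    linear_combination (norm := module) this
  CB' i j h := by
    have := (yangBaxter_entries (hξ j) (hξ i)).2.2.2.2.2.2.2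
    refine smul_right_injective _ (hv j i h.symm) ?_
    obtain ⟨-, -, -, w4, -⟩ := sinh_mul_weights η (hv j i h.symm)
    rw [← neg_sub (v j) (v i)]
    simp only [smul_add, smul_smul, w4]
    linear_combination (norm := module) -this
  A_vac i := (monodromyMatrix_vacuum η ξ (v i) _ nodup_sites).1
  D_vac i := by
    rw [dVac, ← prod_map_sites]
    exact (monodromyMatrix_vacuum η ξ (v i) _ nodup_sites).2.2
  C_vac i := by
    rw [opC_eq]
    exact (monodromyMatrix_vacuum η ξ (v i) _ nodup_sites).2.1
  bra_A i := LinearMap.ext fun x => (vacuumBra_monodromyMatrix η ξ (v i) _ nodup_sites x).1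
  bra_D i := LinearMap.ext fun x => by
    rw [dVac, ← prod_map_sites]
    exact (vacuumBra_monodromyMatrix η ξ (v i) _ nodup_sites x).2.2
  bra_B i := LinearMap.ext fun x => by
    rw [opB_eq]
    exact (vacuumBra_monodromyMatrix η ξ (v i) _ nodup_sites x).2.1
  bra_vac := map_one (ExteriorAlgebra.algebraMapInv : Fock (Fin M) →ₐ[ℂ] ℂ)

theorem _root_.Finset.noncommProd_map_ofFn {R : Type*} [Monoid R] [DecidableEq ι] (f : ι → R)
    (hf : ∀ i j, f i * f j = f j * f i) {n : ℕ} (e : Fin n ↪ ι) :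
    (Finset.univ.map e).noncommProd f (fun i _ j _ _ => hf i j) =
      (List.ofFn fun j => f (e j)).prod := by
  have h1 : Finset.univ.map e = (List.ofFn e).toFinset := by
    ext x
    simp [List.mem_ofFn]
  have h2 := Finset.noncommProd_toFinset (List.ofFn e) f (fun i _ j _ _ => hf i j)
    (List.nodup_ofFn.mpr e.injective)
  rw [List.map_ofFn] at h2
  rw [← Function.comp_def f e, ← h2]
  congr 1

theorem pairing_latticeRep [DecidableEq ι] (hξ : ∀ i m, sinh (v i - ξ m + η) ≠ 0)
    (hv : ∀ i j, i ≠ j → sinh (v i - v j) ≠ 0) (hη : ∀ i j, i ≠ j → sinh (v i - v j + η) ≠ 0)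
    {N : ℕ} (a b : Fin N ↪ ι) :
    (latticeRep hξ hv hη).pairing (Finset.univ.map a) (Finset.univ.map b) =
      scalarProduct η ξ (v ∘ a) (v ∘ b) := by
  rw [YBRep.pairing, YBRep.bvec, YBRep.cProd, YBRep.bProd, Finset.noncommProd_map_ofFn _ (YBRep.CC _),
    Finset.noncommProd_map_ofFn _ (YBRep.BB _)]
  rfl

end LatticeRep

/-! ### Lattices with prescribed vacuum eigenvalues. -/

section Realization

/-- Any values at finitely many generic points are the vacuum eigenvalues of some model. -/
theorem exists_dVac_eq {ι : Type} [Fintype ι] [DecidableEq ι] {η : ℂ} {v : ι → ℂ}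
    (hv : ∀ i j, i ≠ j → sinh (v i - v j) ≠ 0) (hη : ∀ i j, sinh (v i - v j + η) ≠ 0)
    (d : ι → ℂ) : ∃ (M : ℕ) (ξ : Fin M → ℂ), (∀ i m, sinh (v i - ξ m + η) ≠ 0) ∧
      ∀ i, dVac η ξ (v i) = d i := by
  -- For K sites, d(v) = exp(ηK) Q(exp(2v)) / Q(exp(2(v + η))), where Q is monic with roots
  -- exp(2ξ_m). So Q should take the values d i at the numerator points and exp(ηK) at the
  -- denominator points. The value 1 at 0 keeps the roots nonzero, so that they have logarithms.
  set node : Option (ι ⊕ ι) → ℂ := fun o => o.elim 0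
    (Sum.elim (fun i => exp (2 * v i)) (fun i => exp (2 * (v i + η)))) with hnode
  set K := Fintype.card (Option (ι ⊕ ι)) with hK
  set r : Option (ι ⊕ ι) → ℂ := fun o => o.elim 1
    (Sum.elim (fun i => d i) (fun _ => exp η ^ K)) with hr
  have h2 : ∀ i j, exp (2 * v i) ≠ exp (2 * (v j + η)) := fun i j =>
    exp_two_mul_ne (by
      rw [show v i - (v j + η) = -(v j - v i + η) by ring, Complex.sinh_neg]
      exact neg_ne_zero.mpr (hη j i))
  have hinj : Set.InjOn node (Finset.univ : Finset (Option (ι ⊕ ι))) := by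
    rintro (_ | i | i) - (_ | j | j) - h
    · rfl
    · exact absurd h.symm (exp_ne_zero _)
    · exact absurd h.symm (exp_ne_zero _)
    · exact absurd h (exp_ne_zero _)
    · by_contra hij
      exact exp_two_mul_ne (hv i j fun e => hij (by rw [e])) h
    · exact absurd h (h2 i j)
    · exact absurd h (exp_ne_zero _)
    · exact absurd h.symm (h2 j i)
    · by_contra hij
      exact exp_two_mul_ne (u := v i + η) (v := v j + η)
        (by rw [add_sub_add_right_eq_sub]; exact hv i j fun e => hij (by rw [e])) h
  -- Adding the nodal polynomial does not change the prescribed values, but makes Q monic of degree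
  -- exactly K, the exponent already used in `r`.
  set Q : Polynomial ℂ := Lagrange.nodal Finset.univ node + Lagrange.interpolate Finset.univ node r
    with hQ
  have hQe : ∀ o, Q.eval (node o) = r o := fun o => by
    rw [hQ, Polynomial.eval_add, Lagrange.eval_nodal_at_node (Finset.mem_univ o),
      Lagrange.eval_interpolate_at_node _ hinj (Finset.mem_univ o), zero_add]
  have hdeg : (Lagrange.interpolate Finset.univ node r).degree <
      (Lagrange.nodal Finset.univ node).degree := by
    rw [Lagrange.degree_nodal]
    exact Lagrange.degree_interpolate_lt _ hinj
  have hmonic : Q.Monic := Lagrange.nodal_monic.add_of_left hdeg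
  have hnat : Q.natDegree = K := by
    rw [hQ, Polynomial.natDegree_add_eq_left_of_degree_lt hdeg, Lagrange.natDegree_nodal,
      Finset.card_univ]
  have hsplit := IsAlgClosed.splits Q
  set L := Q.roots.toList with hL
  have hlen : L.length = K := by
    rw [hL, Multiset.length_toList, ← hnat]
    exact (Polynomial.splits_iff_card_roots.mp hsplit)
  have hQprod : ∀ z, Q.eval z = ∏ m : Fin L.length, (z - L.get m) := by
    intro z
    have h1 : Q = (Q.roots.map fun a => Polynomial.X - Polynomial.C a).prod :=
      hsplit.eq_prod_roots_of_monic hmonic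
    conv_lhs => rw [h1]
    rw [Polynomial.eval_multiset_prod, Multiset.map_map, ← Multiset.coe_toList Q.roots,
      Multiset.map_coe, Multiset.prod_coe, ← hL]
    simp only [Function.comp_def, Polynomial.eval_sub, Polynomial.eval_X, Polynomial.eval_C]
    rw [← Fin.prod_univ_fun_getElem]
    rfl
  have hL0 : ∀ m : Fin L.length, L.get m ≠ 0 := by
    intro m hm
    have h0 : Q.eval 0 = 1 := hQe none
    rw [hQprod, Finset.prod_eq_zero (Finset.mem_univ m) (by rw [hm, sub_zero])] at h0
    exact zero_ne_one h0
  set ξ : Fin L.length → ℂ := fun m => log (L.get m) / 2 with hξ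
  have hexp : ∀ m, exp (2 * ξ m) = L.get m := fun m => by
    rw [hξ, mul_div_cancel₀ _ two_ne_zero, exp_log (hL0 m)]
  have hQl : ∀ i, ∏ m, (exp (2 * v i) - exp (2 * ξ m)) = d i := fun i => by
    simp only [hexp]
    rw [← hQprod]
    exact hQe (some (Sum.inl i))
  have hQr : ∀ i, ∏ m, (exp (2 * (v i + η)) - exp (2 * ξ m)) = exp η ^ K := fun i => by
    simp only [hexp]
    rw [← hQprod]
    exact hQe (some (Sum.inr i))
  have hne : ∀ i m, exp (2 * (v i + η)) - exp (2 * ξ m) ≠ 0 := fun i m h => by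
    have := hQr i
    rw [Finset.prod_eq_zero (Finset.mem_univ m) h] at this
    exact pow_ne_zero K (exp_ne_zero η) this.symm
  refine ⟨L.length, ξ, fun i m => ?_, fun i => ?_⟩
  · rw [sub_add_eq_add_sub, sinh_sub_eq]
    exact div_ne_zero (mul_ne_zero (mul_ne_zero (exp_ne_zero _) (exp_ne_zero _)) (hne i m))
      two_ne_zero
  · have hfac : ∀ m, sinh (v i - ξ m) / sinh (v i - ξ m + η) =
        exp η * ((exp (2 * v i) - exp (2 * ξ m)) / (exp (2 * (v i + η)) - exp (2 * ξ m))) := by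
      intro m
      rw [sub_add_eq_add_sub, sinh_sub_eq, sinh_sub_eq, neg_add, exp_add (-v i)]
      have h1 := exp_ne_zero (-v i)
      have h2 := exp_ne_zero (-ξ m)
      have h3 : exp η * exp (-η) = 1 := by rw [← exp_add]; simp
      have h4 := exp_ne_zero (-η)
      have h5 := hne i m
      generalize exp (2 * (v i + η)) - exp (2 * ξ m) = x at *
      generalize exp (2 * v i) - exp (2 * ξ m) = y at *
      field_simp
      linear_combination (-y) * h3
    rw [dVac, Finset.prod_congr rfl fun m _ => hfac m, Finset.prod_mul_distrib,
      Finset.prod_div_distrib, hQl, hQr, Finset.prod_const, Finset.card_univ, Fintype.card_fin, hlen]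
    have := pow_ne_zero K (exp_ne_zero η)
    field_simp

end Realization

/-! ### Continuity of scalar products in the parameters. -/

open scoped Topology

/-- A one-parameter family which is a finite combination of constants with coefficients that are
continuous at `0`. -/
def IsContinuousFamily {V : Type} [AddCommGroup V] [Module ℂ V] (F : ℂ → V) : Prop :=
  ∃ (κ : Type) (_ : Fintype κ) (φ : κ → ℂ → ℂ) (X : κ → V),
    (∀ i, ContinuousAt (φ i) 0) ∧ ∀ ε, F ε = ∑ i, φ i ε • X i

namespace IsContinuousFamily

variable {V : Type} [AddCommGroup V] [Module ℂ V] {A : Type} [Ring A] [Algebra ℂ A]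

theorem smul_const {φ : ℂ → ℂ} (hφ : ContinuousAt φ 0) (X : V) :
    IsContinuousFamily fun ε => φ ε • X :=
  ⟨Unit, inferInstance, fun _ => φ, fun _ => X, fun _ => hφ, fun ε => by simp⟩

theorem const (X : V) : IsContinuousFamily fun _ => X := by
  simpa using smul_const (φ := fun _ => 1) continuousAt_const X

theorem add {F G : ℂ → V} (hF : IsContinuousFamily F) (hG : IsContinuousFamily G) :
    IsContinuousFamily fun ε => F ε + G ε := by
  obtain ⟨κ, _, φ, X, hφ, hF⟩ := hF
  obtain ⟨κ', _, φ', X', hφ', hG⟩ := hG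
  refine ⟨κ ⊕ κ', inferInstance, Sum.elim φ φ', Sum.elim X X', ?_, fun ε => ?_⟩
  · rintro (i | i)
    exacts [hφ i, hφ' i]
  · simp [hF, hG, Fintype.sum_sum_type]

theorem mul {F G : ℂ → A} (hF : IsContinuousFamily F) (hG : IsContinuousFamily G) :
    IsContinuousFamily fun ε => F ε * G ε := by
  obtain ⟨κ, _, φ, X, hφ, hF⟩ := hF
  obtain ⟨κ', _, φ', X', hφ', hG⟩ := hG
  refine ⟨κ × κ', inferInstance, fun i ε => φ i.1 ε * φ' i.2 ε, fun i => X i.1 * X' i.2,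
    fun i => (hφ i.1).mul (hφ' i.2), fun ε => ?_⟩
  simp only [hF, hG, Finset.sum_mul_sum, Fintype.sum_prod_type, smul_mul_smul_comm]

theorem list_prod (L : List (ℂ → A)) (hL : ∀ F ∈ L, IsContinuousFamily F) :
    IsContinuousFamily fun ε => (L.map fun F => F ε).prod := by
  induction L with
  | nil => simpa using const 1
  | cons F L ih =>
    simp only [List.map_cons, List.prod_cons]
    exact (hL F (by simp)).mul (ih fun G hG => hL G (by simp [hG]))

/-- A linear functional turns the family into a finite sum of continuous scalars, so no topology on
the Fock space or on its operators is involved. -/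
theorem continuousAt {F : ℂ → V} (hF : IsContinuousFamily F) (f : V →ₗ[ℂ] ℂ) :
    ContinuousAt (fun ε => f (F ε)) 0 := by
  obtain ⟨κ, _, φ, X, hφ, hF⟩ := hF
  simp only [hF, map_sum, map_smul, smul_eq_mul]
  exact tendsto_finsetSum _ fun i _ => ((hφ i).mul continuousAt_const)

end IsContinuousFamily

theorem isContinuousFamily_monodromyMatrix {M : ℕ} (η : ℂ) (ξ : Fin M → ℂ) {u : ℂ → ℂ}
    (hu : ContinuousAt u 0) (hξ : ∀ m, sinh (u 0 - ξ m + η) ≠ 0) (s : List (Fin M))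
    (a b : Fin 2) : IsContinuousFamily fun ε => monodromyMatrix η ξ (u ε) s a b := by
  induction s generalizing a b with
  | nil => exact IsContinuousFamily.const _
  | cons m s ih =>
    simp only [monodromyMatrix_cons, Matrix.mul_apply, Fin.sum_univ_two]
    have hs : ContinuousAt (fun ε => sinh (u ε - ξ m)) 0 :=
      Complex.continuous_sinh.continuousAt.comp (hu.sub continuousAt_const)
    have hd : ContinuousAt (fun ε => sinh (u ε - ξ m + η)) 0 :=
      Complex.continuous_sinh.continuousAt.comp ((hu.sub continuousAt_const).add continuousAt_const)
    have h1 : ContinuousAt (fun ε => sinh (u ε - ξ m) / sinh (u ε - ξ m + η)) 0 :=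
      hs.div hd (hξ m)
    have h2 : ContinuousAt (fun ε => sinh η / sinh (u ε - ξ m + η)) 0 :=
      continuousAt_const.div hd (hξ m)
    have key : ∀ a b, IsContinuousFamily fun ε => lax η m (u ε - ξ m) a b := by
      intro a b
      fin_cases a <;> fin_cases b
      · exact (IsContinuousFamily.const (1 - number m)).add (.smul_const h1 (number m))
      · exact .smul_const h2 (create m)
      · exact .smul_const h2 (annihilate m)
      · simpa [lax, sub_eq_add_neg] using
          (IsContinuousFamily.smul_const h1 (1 - number m)).add (.const (-number m))
    exact ((key a 0).mul (ih 0 b)).add ((key a 1).mul (ih 1 b))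

theorem continuousAt_scalarProduct {M N : ℕ} (η : ℂ) (ξ : Fin M → ℂ) {x y : ℂ → Fin N → ℂ}
    (hx : ∀ j, ContinuousAt (fun ε => x ε j) 0) (hy : ∀ j, ContinuousAt (fun ε => y ε j) 0)
    (hxξ : ∀ j m, sinh (x 0 j - ξ m + η) ≠ 0) (hyξ : ∀ j m, sinh (y 0 j - ξ m + η) ≠ 0) :
    ContinuousAt (fun ε => scalarProduct η ξ (x ε) (y ε)) 0 := by
  have hC := IsContinuousFamily.list_prod (List.ofFn fun j ε => opC η ξ (x ε j)) (by
    simp only [List.mem_ofFn, forall_exists_index]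
    rintro _ j rfl
    simp only [opC_eq]
    exact isContinuousFamily_monodromyMatrix η ξ (hx j) (hxξ j) _ _ _)
  have hB := IsContinuousFamily.list_prod (List.ofFn fun j ε => opB η ξ (y ε j)) (by
    simp only [List.mem_ofFn, forall_exists_index]
    rintro _ j rfl
    simp only [opB_eq]
    exact isContinuousFamily_monodromyMatrix η ξ (hy j) (hyξ j) _ _ _)
  have := (hC.mul hB).continuousAt (vacuumBra M ∘ₗ LinearMap.applyₗ 1)
  simp only [List.map_ofFn] at this
  exact this

/-- `sh (a + k ε)` does not vanish for small `ε ≠ 0`, unless it vanishes identically. -/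
theorem eventually_sinh_ne {a k : ℂ} (h : sinh a ≠ 0 ∨ k ≠ 0) :
    ∀ᶠ ε in 𝓝[≠] (0 : ℂ), sinh (a + k * ε) ≠ 0 := by
  have hd : HasDerivAt (fun ε : ℂ => sinh (a + k * ε)) (cosh (a + k * 0) * (k * 1)) 0 :=
    (((hasDerivAt_id (0 : ℂ)).const_mul k).const_add a).csinh
  by_cases ha : sinh a = 0
  · refine hd.eventually_ne (mul_ne_zero ?_ (by simpa using h.resolve_left (not_not.mpr ha)))
    intro hc
    rw [mul_zero, add_zero] at hc
    simpa [ha, hc] using Complex.cosh_sq a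
  · refine (hd.continuousAt.eventually_ne ?_).filter_mono nhdsWithin_le_nhds
    simpa using ha

/-! ### The limit that fixes the normalisation. -/

open scoped Topology

theorem continuous_sinh_add (a : ℂ) : Continuous fun ε : ℂ => sinh (a + ε) :=
  Complex.continuous_sinh.comp (continuous_const.add continuous_id)

/-- Scalar products at zeros `x k + η + ε` of `d` with the points `x k` have a limit for `ε → 0`. -/
theorem exists_continuousAt_pairing {ι κ : Type} [DecidableEq ι] [DecidableEq κ] {η : ℂ}
    (hη0 : sinh η ≠ 0) (x : κ → ℂ)
    (hx : ∀ i j, i ≠ j → sinh (x i - x j) ≠ 0) (hη : ∀ i j, sinh (x i - x j + η) ≠ 0)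
    (l p : κ ↪ ι) (hlp : ∀ i j, p i ≠ l j) (v : ℂ → ι → ℂ) (hl : ∀ ε k, v ε (l k) = x k)
    (hp : ∀ ε k, v ε (p k) = x k + η + ε) (d : ι → ℂ) (hd : ∀ k, d (p k) = 0) (t : Finset κ) :
    ∀ s : Finset κ, ∃ h : ℂ → ℂ, ContinuousAt h 0 ∧
      (∀ ε, (∀ i j, i ≠ j → sinh (v ε i - v ε j) ≠ 0) → ∀ (V : Type) (_ : AddCommGroup V)
        (_ : Module ℂ V) (R : YBRep η (v ε) d V), R.pairing (t.map p) (s.map l) = h ε) ∧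
      (t = s → h 0 = (-1) ^ (t.card * (t.card + 1) / 2) * ∏ k ∈ t, d (l k)) := by
  induction t using Finset.induction_on with
  | empty =>
    intro s
    rcases s.eq_empty_or_nonempty with rfl | ⟨k, hk⟩
    · refine ⟨fun _ => 1, continuousAt_const, fun ε _ V _ _ R => ?_, by simp⟩
      rw [Finset.map_empty, Finset.map_empty, YBRep.pairing, YBRep.cProd_empty, YBRep.bvec_empty]
      exact R.bra_vac
    · refine ⟨fun _ => 0, continuousAt_const, fun ε _ V _ _ R => ?_, fun h => ?_⟩
      · rw [Finset.map_empty, YBRep.pairing, YBRep.cProd_empty, ← Finset.insert_erase hk,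
          Finset.map_insert, YBRep.bvec_insert _ (by simp)]
        exact LinearMap.congr_fun (R.bra_B _) _
      · exact absurd hk (by simp [← h])
  | insert u t hu ih =>
    intro s
    choose h hc hR h0 using ih
    -- This is `loweringWeight` in terms of x and ε alone; its ε-dependent denominators tend to
    -- sinh(x u − x n + η) ≠ 0.
    set c : κ → ℂ → ℂ := fun n ε => (-1 : ℂ) ^ s.card * exchWeight η (x u - x n + η + ε) * d (l n) *
      ∏ i ∈ s.erase n, diagWeight (-η) (x n - x i) * diagWeight η (x u - x i + η + ε) with hcdef
    refine ⟨fun ε => ∑ n ∈ s, c n ε * h (s.erase n) ε, ?_, ?_, ?_⟩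
    · have hw : ∀ n, ContinuousAt (fun ε => exchWeight η (x u - x n + η + ε)) 0 := fun n =>
        continuousAt_const.div (continuous_sinh_add _).continuousAt (by simpa using hη u n)
      have hw' : ∀ n, ContinuousAt (fun ε => diagWeight η (x u - x n + η + ε)) 0 := fun n =>
        ContinuousAt.div (Complex.continuous_sinh.continuousAt.comp
          ((continuous_const.add continuous_id).sub continuous_const).continuousAt)
          (continuous_sinh_add _).continuousAt (by simpa using hη u n)
      refine tendsto_finsetSum _ fun n _ => ContinuousAt.mul ?_ (hc _)
      refine ((continuousAt_const.mul (hw n)).mul continuousAt_const).mul ?_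
      exact tendsto_finsetProd _ fun i _ => (continuousAt_const.mul (hw' i))
    · intro ε hv V _ _ R
      rw [Finset.map_insert, R.pairing_insert hv (by simpa using hu), Finset.sum_map]
      · refine Finset.sum_congr rfl fun n _ => ?_
        rw [← Finset.map_erase, hR _ ε hv V _ _ R, YBRep.loweringWeight, Finset.card_map,
          ← Finset.map_erase, Finset.prod_map]
        simp only [hl, hp, hcdef, add_sub_right_comm]
      · rw [← Finset.map_insert]
        simp [hd]
      · rw [← Finset.map_insert, Finset.disjoint_left]
        simp only [Finset.mem_map, not_exists, not_and]
        rintro _ ⟨a, _, rfl⟩ b _ hb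
        exact hlp a b hb.symm
    · rintro rfl
      -- At ε = 0 the diagonal weight of x u + η against x u is zero, and every n ≠ u still contains
      -- this factor.
      have hz : ∀ n ∈ t, c n 0 = 0 := by
        intro n hn
        have hun : u ≠ n := fun h => hu (h ▸ hn)
        rw [hcdef]
        refine mul_eq_zero_of_right _ (Finset.prod_eq_zero
          (Finset.mem_erase.mpr ⟨hun, Finset.mem_insert_self _ _⟩) ?_)
        simp [diagWeight]
      have hcu : c u 0 = (-1) ^ (t.card + 1) * d (l u) := by
        simp only [hcdef, Finset.erase_insert hu, Finset.card_insert_of_notMem hu]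
        rw [Finset.prod_eq_one, exchWeight, sub_self, zero_add, add_zero, div_self hη0]
        · ring
        · intro i hi
          have hui : u ≠ i := fun h => hu (h ▸ hi)
          have h1 := hx u i hui
          have h2 := hη u i
          rw [diagWeight, diagWeight, sub_neg_eq_add, add_zero, add_sub_cancel_right]
          field_simp
      simp only
      rw [Finset.sum_insert hu, Finset.sum_eq_zero fun n hn => by rw [hz n hn, zero_mul], add_zero,
        hcu, Finset.erase_insert hu, h0 t rfl, Finset.prod_insert hu,
        Finset.card_insert_of_notMem hu]
      have : (t.card + 1) * (t.card + 1 + 1) / 2 = t.card + 1 + t.card * (t.card + 1) / 2 := by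
        rw [show (t.card + 1) * (t.card + 1 + 1) = t.card * (t.card + 1) + (t.card + 1) * 2 by ring,
          Nat.add_mul_div_right _ _ two_pos, add_comm]
      rw [this, pow_add]
      ring

theorem prod_erase_eq_mul {N : ℕ} (f : Fin N → Fin N → ℂ) :
    ∏ i, ∏ j ∈ Finset.univ.erase i, f i j = ∏ i, ∏ j ∈ Finset.Ioi i, f i j * f j i := by
  have h1 : ∀ i, ∏ j ∈ Finset.univ.erase i, f i j =
      (∏ j ∈ Finset.Ioi i, f i j) * ∏ j ∈ Finset.Iio i, f i j := by
    intro i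
    rw [← Finset.prod_union]
    · congr 1
      ext j
      simp [lt_or_lt_iff_ne, ne_comm]
    · rw [Finset.disjoint_left]
      intro j hj hj'
      exact lt_asymm (Finset.mem_Ioi.mp hj) (Finset.mem_Iio.mp hj')
  simp only [h1, Finset.prod_mul_distrib]
  congr 1
  exact Finset.prod_comm' (by simp)

theorem subsetDet_map {ι : Type} [LinearOrder ι] {n : ℕ} (ψ : Fin n → ι → ℂ) (e : Fin n ↪o ι) :
    subsetDet ψ (Finset.univ.map e.toEmbedding) = (Matrix.of fun r c => ψ r (e c)).det := by
  have h : (Finset.univ.map e.toEmbedding).card = n := by simp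
  rw [subsetDet, dif_pos h, ← Finset.orderEmbOfFin_unique' h (f := e) (by simp)]

theorem sinhVandermonde_map {ι : Type} [LinearOrder ι] {n : ℕ} (v : ι → ℂ) (e : Fin n ↪o ι) :
    sinhVandermonde v (Finset.univ.map e.toEmbedding) =
      ∏ a, ∏ b ∈ Finset.Ioi a, sinh (v (e b) - v (e a)) := by
  rw [sinhVandermonde, Finset.prod_map]
  refine Finset.prod_congr rfl fun a _ => ?_
  rw [Finset.filter_map, Finset.prod_map]
  refine Finset.prod_congr ?_ fun _ _ => rfl
  ext b
  simp

/-- On shell, the vacuum eigenvalues multiply to one. -/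
theorem IsBetheRoots.prod_dVac {M N : ℕ} {η : ℂ} {ξ : Fin M → ℂ} {l : Fin N → ℂ}
    (hl : IsBetheRoots η ξ l) : ∏ j, dVac η ξ (l j) = 1 := by
  have h1 : ∏ _j : Fin N, (-1 : ℂ) ^ (N + 1) = (∏ j, dVac η ξ (l j)) *
      ∏ j, ∏ k ∈ Finset.univ.erase j, sinh (l j - l k + η) / sinh (l j - l k - η) := by
    rw [← Finset.prod_mul_distrib]
    exact Finset.prod_congr rfl fun j _ => hl.equation j
  -- The factors of (i, j) and (j, i) are inverse to each other since sinh is odd.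
  have h2 : ∏ j, ∏ k ∈ Finset.univ.erase j, sinh (l j - l k + η) / sinh (l j - l k - η) = 1 := by
    rw [prod_erase_eq_mul]
    refine Finset.prod_eq_one fun i _ => Finset.prod_eq_one fun j hj => ?_
    have hij : i ≠ j := (Finset.mem_Ioi.mp hj).ne
    have h3 := hl.regular_pair i j hij
    have h4 := hl.regular_pair j i hij.symm
    have h5 : sinh (l j - l i + η) = -sinh (l i - l j - η) := by
      rw [← Complex.sinh_neg]; ring_nf
    have h6 : sinh (l i - l j + η) = -sinh (l j - l i - η) := by
      rw [← Complex.sinh_neg]; ring_nf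
    rw [h5, h6]
    field_simp
  rw [h2, mul_one, Finset.prod_const, Finset.card_univ, Fintype.card_fin, ← pow_mul] at h1
  rw [← h1, mul_comm, Even.neg_one_pow (Nat.even_mul_succ_self N)]

/-- Scalar products at generic points depend on the model only through `d`. -/
theorem scalarProduct_congr {M M' N : ℕ} {η : ℂ} {ξ : Fin M → ℂ} {ξ' : Fin M' → ℂ}
    {ι : Type} [DecidableEq ι] {v : ι → ℂ}
    (hv : ∀ i j, i ≠ j → sinh (v i - v j) ≠ 0) (hη : ∀ i j, i ≠ j → sinh (v i - v j + η) ≠ 0)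
    (hξ : ∀ i m, sinh (v i - ξ m + η) ≠ 0) (hξ' : ∀ i m, sinh (v i - ξ' m + η) ≠ 0)
    (hd : ∀ i, dVac η ξ (v i) = dVac η ξ' (v i)) (a b : Fin N ↪ ι) (hab : ∀ i j, a i ≠ b j) :
    scalarProduct η ξ (v ∘ a) (v ∘ b) = scalarProduct η ξ' (v ∘ a) (v ∘ b) := by
  rw [← pairing_latticeRep hξ hv hη, ← pairing_latticeRep hξ' hv hη]
  have hdis : Disjoint (Finset.univ.map a) (Finset.univ.map b) := by
    rw [Finset.disjoint_left]
    simp only [Finset.mem_map, not_exists, not_and]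
    rintro _ ⟨i, _, rfl⟩ j _ hj
    exact hab i j hj.symm
  have hd' : (fun i => dVac η ξ (v i)) = fun i => dVac η ξ' (v i) := funext hd
  generalize latticeRep hξ' hv hη = R'
  generalize latticeRep hξ hv hη = R
  revert R
  rw [hd']
  exact fun R => R.pairing_congr R' hv hdis

/-! ### The determinant formula at generic points. -/

open scoped Topology

theorem IsBetheRoots.onShell {M N : ℕ} {η : ℂ} {ξ : Fin M → ℂ} {l : Fin N → ℂ}
    (hl : IsBetheRoots η ξ l) {ι : Type} [DecidableEq ι] (e : Fin N ↪ ι) {v d : ι → ℂ}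
    (hv : ∀ j, v (e j) = l j) (hd : ∀ j, d (e j) = dVac η ξ (l j)) :
    YBRep.OnShell η v d (Finset.univ.map e) := by
  intro k hk
  obtain ⟨j, -, rfl⟩ := Finset.mem_map.mp hk
  have h1 : (-1 : ℂ) ^ (N + 1) = dVac η ξ (l j) *
      ∏ k ∈ Finset.univ.erase j, sinh (l j - l k + η) / sinh (l j - l k - η) := hl.equation j
  have h2 : ∏ k ∈ Finset.univ.erase j, sinh (l j - l k - η) ≠ 0 :=
    Finset.prod_ne_zero_iff.mpr fun k hk => hl.regular_pair j k (Finset.ne_of_mem_erase hk).symm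
  have h3 : (-1 : ℂ) ^ N * (-1 : ℂ) ^ N = 1 := by rw [← mul_pow]; simp
  rw [Finset.prod_div_distrib, pow_succ] at h1
  rw [← Finset.map_erase, Finset.prod_map, Finset.prod_map, Finset.card_map, Finset.card_univ,
    Fintype.card_fin, hd]
  simp only [diagWeight, hv, sub_neg_eq_add, Finset.prod_div_distrib]
  generalize ∏ k ∈ Finset.univ.erase j, sinh (l j - l k - η) = x at *
  generalize ∏ k ∈ Finset.univ.erase j, sinh (l j - l k + η) = y at *
  have h4 : dVac η ξ (l j) * y = -(-1) ^ N * x := by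
    field_simp at h1
    linear_combination -h1
  rw [mul_div_assoc', ← add_div, mul_assoc, h4]
  rw [show x + (-1) ^ N * (-(-1) ^ N * x) = x * (1 - (-1) ^ N * (-1) ^ N) by ring, h3]
  simp

section Limit

variable {M N : ℕ} {η : ℂ} {ξ : Fin M → ℂ} {l μ : Fin N → ℂ} {ι : Type} [LinearOrder ι]
  [Fintype ι]

/-- The determinant formula for one realization of the points `l k + η + ε`. -/
theorem scalarProduct_mul_det (hl : IsBetheRoots η ξ l) (hμ : ∀ j m, sinh (μ j - ξ m + η) ≠ 0)
    {el em ep : Fin N ↪o ι} (hlm : ∀ i j, el i ≠ em j) (hlp : ∀ i j, ep i ≠ el j)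
    {v d : ι → ℂ} {ε : ℂ} (hv : ∀ i j, i ≠ j → sinh (v i - v j) ≠ 0)
    (hη : ∀ i j, sinh (v i - v j + η) ≠ 0) (hvl : ∀ k, v (el k) = l k)
    (hvm : ∀ k, v (em k) = μ k) (hvp : ∀ k, v (ep k) = l k + η + ε)
    (hdl : ∀ k, d (el k) = dVac η ξ (l k)) (hdm : ∀ k, d (em k) = dVac η ξ (μ k))
    (hdp : ∀ k, d (ep k) = 0) {z : ℂ} (hz : ∀ (V : Type) (_ : AddCommGroup V)
        (_ : Module ℂ V) (R : YBRep η v d V), R.pairing (Finset.univ.map ep.toEmbedding)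
          (Finset.univ.map el.toEmbedding) = z)
    {F : Matrix (Fin N) (Fin N) ℂ} (hF : F.det ≠ 0)
    (hFe : ∀ i k, F i k = sinh η / sinh (l k - l i + η + ε) *
      ∏ a ∈ Finset.univ.erase i, sinh (l k - l a + ε)) :
    scalarProduct η ξ l μ * ((∏ a, ∏ b ∈ Finset.Ioi a, sinh (μ b - μ a)) /
      ∏ k, ∏ a, sinh (μ k - l a - η)) * F.det =
        z * (∏ a, ∏ b ∈ Finset.Ioi a, sinh (l b - l a)) * (psiMatrix η ξ μ l).det := by
  -- A second lattice realises the eigenvalues d, including the zeros at the points `ep`. By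
  -- `scalarProduct_congr` it shares the scalar product of `l` and `μ` with the given lattice.
  obtain ⟨M', ξ', hξ', hd'⟩ := exists_dVac_eq hv hη d
  obtain ⟨R, hR⟩ : ∃ R : YBRep η v d (Fock (Fin M')), ∀ a b : Fin N ↪ ι,
      R.pairing (Finset.univ.map a) (Finset.univ.map b) = scalarProduct η ξ' (v ∘ a) (v ∘ b) := by
    have : (fun i => dVac η ξ' (v i)) = d := funext hd'
    rw [← this]
    exact ⟨latticeRep hξ' hv fun i j _ => hη i j, pairing_latticeRep _ _ _⟩
  have hvl' : v ∘ el = l := funext hvl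
  have hvm' : v ∘ em = μ := funext hvm
  have hS : R.pairing (Finset.univ.map el.toEmbedding) (Finset.univ.map em.toEmbedding) =
      scalarProduct η ξ l μ := by
    have hinj : Function.Injective (Sum.elim el em) :=
      el.injective.sumElim em.injective hlm
    have he : Sum.elim l μ = v ∘ Sum.elim el em := by
      rw [← hvl', ← hvm', Sum.comp_elim]
    have h1 := scalarProduct_congr (v := Sum.elim l μ) (η := η) (ξ := ξ) (ξ' := ξ')
      (fun i j hij => by rw [he]; exact hv _ _ (hinj.ne hij))
      (fun i j _ => by rw [he]; exact hη _ _)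
      (by rintro (i | i) m; exacts [hl.regular_site i m, hμ i m])
      (fun i => by rw [he]; exact hξ' _)
      (by
        rintro (i | i)
        · simp only [Sum.elim_inl]
          rw [← hdl, ← hd', hvl]
        · simp only [Sum.elim_inr]
          rw [← hdm, ← hd', hvm])
      Function.Embedding.inl Function.Embedding.inr (by simp)
    rw [hR]
    exact (congrArg₂ (scalarProduct η ξ') hvl' hvm').trans h1.symm
  set t := Finset.univ.map el.toEmbedding with ht
  have hcard : ∀ e : Fin N ↪o ι, (Finset.univ.map e.toEmbedding).card = N := fun e => by simp
  have hdis : ∀ {e : Fin N ↪o ι}, (∀ i j, e i ≠ el j) →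
      ↑(Finset.univ.map e.toEmbedding) ⊆ {i | i ∉ t} := by
    intro e he i hi
    simp only [ht, Finset.coe_map, Set.mem_image, Finset.mem_map, Set.mem_ofPred_eq] at hi ⊢
    rintro ⟨j, -, rfl⟩
    obtain ⟨k, -, hk⟩ := hi
    exact he k j hk
  have hw : ∀ k, ∏ a ∈ t, sinh (v k - v a - η) ≠ 0 := fun k =>
    Finset.prod_ne_zero_iff.mpr fun a _ => by
      rw [show v k - v a - η = -(v a - v k + η) by ring, Complex.sinh_neg]
      exact neg_ne_zero.mpr (hη _ _)
  -- At a zero of d the second term of Ψ drops out. Multiplying column k by its weight cancels the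
  -- denominators sinh(λ_i − v_k + η), the diagonal one of which tends to 0 with ε.
  have hcol : F.det = (∏ k, ∏ a ∈ t, sinh (v (ep k) - v a - η)) *
      (Matrix.of fun i k => YBRep.slavnovEntry η v d t (el i) (ep k)).det := by
    rw [← Matrix.det_mul_row]
    congr 1
    ext i k
    rw [hFe, Matrix.of_apply, Matrix.of_apply, YBRep.slavnovEntry, hdp, ht, Finset.prod_map]
    simp only [mul_zero, zero_mul, add_zero, RelEmbedding.coe_toEmbedding, hvl, hvp, tFun]
    rw [← Finset.mul_prod_erase _ _ (Finset.mem_univ i)]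
    have h1 := hv (el i) (ep k) (hlp k i).symm
    have h2 := hη (el i) (ep k)
    rw [hvl, hvp] at h1 h2
    have h3 : sinh (l i - (l k + η + ε)) = -sinh (l k - l i + η + ε) := by
      rw [← Complex.sinh_neg]; ring_nf
    have h4 : sinh (l k + η + ε - l i - η) = -sinh (l i - (l k + η + ε) + η) := by
      rw [← Complex.sinh_neg]; ring_nf
    rw [h3, neg_ne_zero] at h1
    have h5 : ∀ a, l k + η + ε - l a - η = l k - l a + ε := fun a => by ring
    rw [h3, h4]
    simp only [h5]
    field_simp
  have hdet : subsetDet (fun i k => YBRep.slavnovEntry η v d t (el i) k)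
      (Finset.univ.map ep.toEmbedding) ≠ 0 := by
    rw [subsetDet_map]
    rw [hcol] at hF
    exact right_ne_zero_of_mul hF
  have key := exchange_relation_det (fun i k => YBRep.slavnovEntry η v d t (el i) k) hv
    (fun k => ∏ a ∈ t, sinh (v k - v a - η)) hw (fun s => R.pairing t s) {i | i ∉ t}
    (fun s hs hn i => by
      rw [← R.slavnov_relation hv hη (by rw [hn, hcard]) (t := t) (s := s)
        (Finset.disjoint_right.mpr fun i hi => hs hi) (hl.onShell el.toEmbedding hvl hdl)
        (Finset.mem_map_of_mem el.toEmbedding (Finset.mem_univ i))]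
      refine Finset.sum_congr rfl fun k _ => ?_
      simp only [RelEmbedding.coe_toEmbedding]
      ring)
    (hdis hlp) (hcard ep) (hdis fun i j => (hlm j i).symm) (hcard em) hdet
  -- The recursion has the zeros of d on the `C` side, whereas `key` has the Bethe roots there.
  rw [hS, R.pairing_comm hv (Finset.disjoint_right.mpr (hdis hlp)), hz _ _ _ R, subsetDet_map,
    subsetDet_map, sinhVandermonde_map, sinhVandermonde_map, Finset.prod_map, Finset.prod_map] at key
  have hψ : (Matrix.of fun i k => YBRep.slavnovEntry η v d t (el i) (em k)) =
      psiMatrix η ξ μ l := by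
    ext i k
    rw [Matrix.of_apply, YBRep.slavnovEntry, psiMatrix, Matrix.of_apply, hdm, ht, Finset.prod_map,
      hcard]
    simp only [RelEmbedding.coe_toEmbedding, hvl, hvm, pow_succ]
    ring
  have hpm : ∏ k, ∏ a, sinh (μ k - l a - η) = ∏ k, ∏ a ∈ t, sinh (v (em k) - v a - η) := by
    simp only [ht, Finset.prod_map, RelEmbedding.coe_toEmbedding, hvl, hvm]
  have hwl : ∏ a, ∏ b ∈ Finset.Ioi a, sinh (l b - l a) =
      ∏ a, ∏ b ∈ Finset.Ioi a, sinh (v (ep b) - v (ep a)) := by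
    simp only [hvp, add_sub_add_right_eq_sub]
  have hwm : ∏ a, ∏ b ∈ Finset.Ioi a, sinh (μ b - μ a) =
      ∏ a, ∏ b ∈ Finset.Ioi a, sinh (v (em b) - v (em a)) := by
    simp only [hvm]
  rw [hψ] at key
  rw [hcol, hpm, hwl, hwm]
  simp only [RelEmbedding.coe_toEmbedding] at key
  have hwp : ∏ k, ∏ a ∈ t, sinh (v (ep k) - v a - η) ≠ 0 :=
    Finset.prod_ne_zero_iff.mpr fun k _ => hw _
  rw [mul_left_comm, key]
  field_simp

end Limit

/-- The three families of points of the limiting argument. -/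
noncomputable def slavnovPoint {N : ℕ} (η : ℂ) (l μ : Fin N → ℂ) (ε : ℂ) (i : Fin 3 ×ₗ Fin N) : ℂ :=
  ![l (ofLex i).2, μ (ofLex i).2, l (ofLex i).2 + η + ε] (ofLex i).1

/-- The `r`-th copy of `Fin N` in the index set of `slavnovPoint`. -/
def slavnovIndex (N : ℕ) (r : Fin 3) : Fin N ↪o Fin 3 ×ₗ Fin N :=
  OrderEmbedding.ofStrictMono (fun j => toLex (r, j)) fun a b h => by
    simp [Prod.Lex.toLex_lt_toLex, h]

/-- A difference with exactly one shifted point moves with slope ±1 in ε, so its sinh is nonzero for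
small ε ≠ 0. In all other differences ε cancels or is absent. -/
theorem eventually_slavnovPoint {N : ℕ} {η : ℂ} {l μ : Fin N → ℂ}
    (hll : ∀ a b, a ≠ b → sinh (l a - l b) ≠ 0) (hll' : ∀ a b, sinh (l a - l b + η) ≠ 0)
    (hmm : ∀ a b, a ≠ b → sinh (μ a - μ b) ≠ 0) (hmm' : ∀ a b, sinh (μ a - μ b + η) ≠ 0)
    (hlm : ∀ a b, sinh (l a - μ b) ≠ 0) (hlm' : ∀ a b, sinh (l a - μ b + η) ≠ 0)
    (hml' : ∀ a b, sinh (μ b - l a + η) ≠ 0) :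
    ∀ᶠ ε in 𝓝[≠] (0 : ℂ), (∀ i j, i ≠ j →
      sinh (slavnovPoint η l μ ε i - slavnovPoint η l μ ε j) ≠ 0) ∧
      ∀ i j, sinh (slavnovPoint η l μ ε i - slavnovPoint η l μ ε j + η) ≠ 0 := by
  have hpos : ∀ a, ∀ᶠ ε in 𝓝[≠] (0 : ℂ), sinh (a + 1 * ε) ≠ 0 := fun a =>
    eventually_sinh_ne (Or.inr one_ne_zero)
  have hneg : ∀ a, ∀ᶠ ε in 𝓝[≠] (0 : ℂ), sinh (a + -1 * ε) ≠ 0 := fun a =>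
    eventually_sinh_ne (Or.inr (neg_ne_zero.mpr one_ne_zero))
  refine Filter.Eventually.and (Filter.eventually_all.mpr fun i => Filter.eventually_all.mpr fun j =>
    ?_) (Filter.eventually_all.mpr fun i => Filter.eventually_all.mpr fun j => ?_)
  · obtain ⟨⟨r, a⟩, rfl⟩ := toLex.surjective i
    obtain ⟨⟨s, b⟩, rfl⟩ := toLex.surjective j
    by_cases hij : toLex (r, a) = toLex (s, b)
    · exact Filter.Eventually.of_forall fun ε h => absurd hij h
    have hab : r = s → a ≠ b := fun h1 h2 => hij (by rw [h1, h2])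
    have aux : ∀ᶠ ε in 𝓝[≠] (0 : ℂ),
        sinh (slavnovPoint η l μ ε (toLex (r, a)) - slavnovPoint η l μ ε (toLex (s, b))) ≠ 0 := by
      fin_cases r <;> fin_cases s
      · exact Filter.Eventually.of_forall fun ε => hll a b (hab rfl)
      · exact Filter.Eventually.of_forall fun ε => hlm a b
      · filter_upwards [hneg (l a - l b - η)] with ε h
        convert h using 2
        simp [slavnovPoint]; ring
      · refine Filter.Eventually.of_forall fun ε => ?_
        have : sinh (μ a - l b) ≠ 0 := by
          rw [← neg_sub, Complex.sinh_neg]; exact neg_ne_zero.mpr (hlm b a)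
        exact this
      · exact Filter.Eventually.of_forall fun ε => hmm a b (hab rfl)
      · filter_upwards [hneg (μ a - l b - η)] with ε h
        convert h using 2
        simp [slavnovPoint]; ring
      · filter_upwards [hpos (l a + η - l b)] with ε h
        convert h using 2
        simp [slavnovPoint]; ring
      · filter_upwards [hpos (l a + η - μ b)] with ε h
        convert h using 2
        simp [slavnovPoint]; ring
      · refine Filter.Eventually.of_forall fun ε => ?_
        convert hll a b (hab rfl) using 2
        simp [slavnovPoint]
    exact aux.mono fun ε h _ => h
  · obtain ⟨⟨r, a⟩, rfl⟩ := toLex.surjective i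
    obtain ⟨⟨s, b⟩, rfl⟩ := toLex.surjective j
    fin_cases r <;> fin_cases s
    · exact Filter.Eventually.of_forall fun ε => hll' a b
    · exact Filter.Eventually.of_forall fun ε => hlm' a b
    · filter_upwards [hneg (l a - l b)] with ε h
      convert h using 2
      simp [slavnovPoint]; ring
    · exact Filter.Eventually.of_forall fun ε => hml' b a
    · exact Filter.Eventually.of_forall fun ε => hmm' a b
    · filter_upwards [hneg (μ a - l b)] with ε h
      convert h using 2
      simp [slavnovPoint]; ring
    · filter_upwards [hpos (l a + η - l b + η)] with ε h
      convert h using 2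
      simp [slavnovPoint]; ring
    · filter_upwards [hpos (l a + η - μ b + η)] with ε h
      convert h using 2
      simp [slavnovPoint]; ring
    · refine Filter.Eventually.of_forall fun ε => ?_
      convert hll' a b using 2
      simp [slavnovPoint]

/-- The determinant formula at generic points. -/
theorem scalarProduct_eq_det_of_generic {M N : ℕ} {η : ℂ} {ξ : Fin M → ℂ} {l μ : Fin N → ℂ}
    (hl : IsBetheRoots η ξ l) (hμ : ∀ j m, sinh (μ j - ξ m + η) ≠ 0) (hη0 : sinh η ≠ 0)
    (hll : ∀ a b, a ≠ b → sinh (l a - l b) ≠ 0) (hll' : ∀ a b, sinh (l a - l b + η) ≠ 0)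
    (hmm : ∀ a b, a ≠ b → sinh (μ a - μ b) ≠ 0) (hmm' : ∀ a b, sinh (μ a - μ b + η) ≠ 0)
    (hlm : ∀ a b, sinh (l a - μ b) ≠ 0) (hlm' : ∀ a b, sinh (l a - μ b + η) ≠ 0)
    (hml' : ∀ a b, sinh (μ b - l a + η) ≠ 0) :
    scalarProduct η ξ l μ = (-1 : ℂ) ^ (N * (N - 1) / 2) *
      ((∏ a, ∏ b, sinh (l a - μ b + η)) /
        (∏ a, ∏ b ∈ Finset.Ioi a, sinh (l a - l b) * sinh (μ b - μ a))) *
      (psiMatrix η ξ μ l).det := by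
  set d : Fin 3 ×ₗ Fin N → ℂ := fun i =>
    ![dVac η ξ (l (ofLex i).2), dVac η ξ (μ (ofLex i).2), 0] (ofLex i).1
  have hne : ∀ {r s : Fin 3}, r ≠ s → ∀ i j, slavnovIndex N r i ≠ slavnovIndex N s j := by
    intro r s hrs i j h
    exact hrs (congrArg (fun x => (ofLex x).1) h)
  obtain ⟨h, hc, hR, h0⟩ := exists_continuousAt_pairing hη0 l hll hll' (slavnovIndex N 0).toEmbedding
    (slavnovIndex N 2).toEmbedding (hne (by decide)) (slavnovPoint η l μ) (fun _ _ => rfl)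
    (fun _ _ => rfl) d (fun _ => rfl) Finset.univ Finset.univ
  set F : ℂ → Matrix (Fin N) (Fin N) ℂ := fun ε => Matrix.of fun i k =>
    sinh η / sinh (l k - l i + η + ε) * ∏ a ∈ Finset.univ.erase i, sinh (l k - l a + ε) 
  have hFe : ∀ ε i k, F ε i k = sinh η / sinh (l k - l i + η + ε) *
      ∏ a ∈ Finset.univ.erase i, sinh (l k - l a + ε) := fun _ _ _ => rfl
  have hFc : ContinuousAt (fun ε => (F ε).det) 0 := by
    have : ContinuousAt F 0 := continuousAt_pi.mpr fun i => continuousAt_pi.mpr fun k => by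
      refine ContinuousAt.mul ?_ (tendsto_finsetProd _ fun a _ =>
        (continuous_sinh_add _).continuousAt)
      exact continuousAt_const.div (continuous_sinh_add _).continuousAt (by simpa using hll' k i)
    exact (continuous_id.matrix_det).continuousAt.comp this
  have hF0 : (F 0).det = ∏ a, ∏ b ∈ Finset.Ioi a, sinh (l a - l b) * sinh (l b - l a) := by
    rw [← prod_erase_eq_mul]
    -- Off the diagonal the product over a ≠ i contains a = k, whose factor is sinh 0.
    have : F 0 = Matrix.diagonal fun i => ∏ a ∈ Finset.univ.erase i, sinh (l i - l a) := by
      ext i k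
      rw [hFe]
      rcases eq_or_ne i k with rfl | hik
      · simp [div_self hη0]
      · rw [Matrix.diagonal_apply_ne _ hik, Finset.prod_eq_zero
          (Finset.mem_erase.mpr ⟨hik.symm, Finset.mem_univ k⟩) (by simp), mul_zero]
    rw [this, Matrix.det_diagonal]
  have hV1 : ∏ a, ∏ b ∈ Finset.Ioi a, sinh (l a - l b) ≠ 0 :=
    Finset.prod_ne_zero_iff.mpr fun a _ => Finset.prod_ne_zero_iff.mpr fun b hb =>
      hll a b (Finset.mem_Ioi.mp hb).ne
  have hV2 : ∏ a, ∏ b ∈ Finset.Ioi a, sinh (l b - l a) ≠ 0 :=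
    Finset.prod_ne_zero_iff.mpr fun a _ => Finset.prod_ne_zero_iff.mpr fun b hb =>
      hll b a (Finset.mem_Ioi.mp hb).ne'
  have hV3 : ∏ a, ∏ b ∈ Finset.Ioi a, sinh (μ b - μ a) ≠ 0 :=
    Finset.prod_ne_zero_iff.mpr fun a _ => Finset.prod_ne_zero_iff.mpr fun b hb =>
      hmm b a (Finset.mem_Ioi.mp hb).ne'
  simp only [Finset.prod_mul_distrib] at hF0 ⊢
  have hlim : scalarProduct η ξ l μ * ((∏ a, ∏ b ∈ Finset.Ioi a, sinh (μ b - μ a)) /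
      ∏ k, ∏ a, sinh (μ k - l a - η)) * (F 0).det =
        h 0 * (∏ a, ∏ b ∈ Finset.Ioi a, sinh (l b - l a)) * (psiMatrix η ξ μ l).det := by
    have hF0' : (F 0).det ≠ 0 := by rw [hF0]; exact mul_ne_zero hV1 hV2
    refine tendsto_nhds_unique_of_eventuallyEq (l := 𝓝[≠] (0 : ℂ))
      ((continuousAt_const.mul hFc).tendsto.mono_left nhdsWithin_le_nhds)
      (((hc.mul continuousAt_const).mul continuousAt_const).tendsto.mono_left nhdsWithin_le_nhds) ?_
    filter_upwards [eventually_slavnovPoint hll hll' hmm hmm' hlm hlm' hml',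
      (hFc.eventually_ne hF0').filter_mono nhdsWithin_le_nhds] with ε hε hFε
    exact scalarProduct_mul_det hl hμ (el := slavnovIndex N 0) (em := slavnovIndex N 1)
      (ep := slavnovIndex N 2) (hne (by decide)) (hne (by decide)) hε.1 hε.2 (fun _ => rfl)
      (fun _ => rfl) (fun _ => rfl) (d := d) (fun _ => rfl) (fun _ => rfl) (fun _ => rfl)
      (hR ε hε.1) hFε (hFe ε)
  have hprod : ∏ k, d ((slavnovIndex N 0).toEmbedding k) = 1 := hl.prod_dVac
  rw [hF0, h0 rfl, hprod, mul_one, Finset.card_univ, Fintype.card_fin] at hlim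
  have hP : ∏ k, ∏ a, sinh (μ k - l a - η) = (-1) ^ N * ∏ a, ∏ b, sinh (l a - μ b + η) := by
    rw [Finset.prod_comm]
    have : ∀ a k, sinh (μ k - l a - η) = -1 * sinh (l a - μ k + η) := fun a k => by
      rw [neg_one_mul, ← Complex.sinh_neg]; ring_nf
    simp only [this, Finset.prod_mul_distrib, Finset.prod_const, Finset.card_univ, Fintype.card_fin]
    congr 1
    rw [← pow_mul]
    rcases Nat.even_or_odd N with hN | hN
    · rw [hN.neg_one_pow, (hN.mul_left N).neg_one_pow]
    · rw [hN.neg_one_pow, (hN.mul hN).neg_one_pow]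
  have hP0 : ∏ a, ∏ b, sinh (l a - μ b + η) ≠ 0 :=
    Finset.prod_ne_zero_iff.mpr fun a _ => Finset.prod_ne_zero_iff.mpr fun b _ => hlm' a b
  have hsign : (-1 : ℂ) ^ (N * (N + 1) / 2) = (-1) ^ N * (-1) ^ (N * (N - 1) / 2) := by
    rw [← pow_add]
    congr 1
    rcases N with _ | n
    · rfl
    · rw [show (n + 1) * (n + 1 + 1) = (n + 1) * (n + 1 - 1) + (n + 1) * 2 by
        simp only [Nat.add_sub_cancel]; ring, Nat.add_mul_div_right _ _ two_pos, add_comm]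
  have hs : (-1 : ℂ) ^ N ≠ 0 := pow_ne_zero _ (neg_ne_zero.mpr one_ne_zero)
  have hs2 : (-1 : ℂ) ^ N * (-1) ^ N = 1 := by rw [← mul_pow]; simp
  rw [hP, hsign] at hlim
  field_simp at hlim ⊢
  rw [sq, hs2, one_mul] at hlim
  linear_combination hlim

/-! ### Symmetry, and removal of the genericity assumptions. -/

open scoped Topology

theorem scalarProduct_comm_of_generic {M N : ℕ} {η : ℂ} {ξ : Fin M → ℂ} {v : Fin N ⊕ Fin N → ℂ}
    (hv : ∀ i j, i ≠ j → sinh (v i - v j) ≠ 0) (hη : ∀ i j, i ≠ j → sinh (v i - v j + η) ≠ 0)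
    (hξ : ∀ i m, sinh (v i - ξ m + η) ≠ 0) :
    scalarProduct η ξ (v ∘ Sum.inr) (v ∘ Sum.inl) =
      scalarProduct η ξ (v ∘ Sum.inl) (v ∘ Sum.inr) := by
  have h1 := pairing_latticeRep hξ hv hη Function.Embedding.inl Function.Embedding.inr
  have h2 := pairing_latticeRep hξ hv hη Function.Embedding.inr Function.Embedding.inl
  refine h2.symm.trans ((YBRep.pairing_comm _ hv ?_).trans h1)
  rw [Finset.disjoint_left]
  simp

/-- The Bethe equations play no role. Moving the 2N points at distinct integer speeds makes them
generic for small ε ≠ 0, and both sides are continuous at ε = 0. -/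
theorem scalarProduct_comm {M N : ℕ} {η : ℂ} {ξ : Fin M → ℂ} {l μ : Fin N → ℂ}
    (hl : ∀ j m, sinh (l j - ξ m + η) ≠ 0) (hμ : ∀ j m, sinh (μ j - ξ m + η) ≠ 0) :
    scalarProduct η ξ μ l = scalarProduct η ξ l μ := by
  set c : Fin N ⊕ Fin N → ℂ := fun i => ((finSumFinEquiv i : ℕ) : ℂ)
  set z : Fin N ⊕ Fin N → ℂ := Sum.elim l μ
  set v : ℂ → Fin N ⊕ Fin N → ℂ := fun ε i => z i + c i * ε with hvdef
  have hc : ∀ i j, i ≠ j → c i - c j ≠ 0 := fun i j hij => sub_ne_zero.mpr fun h =>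
    hij (finSumFinEquiv.injective (Fin.ext (Nat.cast_injective h)))
  have hz : ∀ i m, sinh (z i - ξ m + η) ≠ 0 := by
    rintro (i | i) m
    exacts [hl i m, hμ i m]
  have h0 : v 0 = z := by
    ext i
    simp [hvdef]
  have hcont : ∀ i, ContinuousAt (fun ε => v ε i) 0 := fun i =>
    (continuous_const.add (continuous_const.mul continuous_id)).continuousAt
  have h1 : ContinuousAt (fun ε => scalarProduct η ξ (v ε ∘ Sum.inr) (v ε ∘ Sum.inl)) 0 :=
    continuousAt_scalarProduct η ξ (fun j => hcont _) (fun j => hcont _)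
      (fun j => by rw [h0]; exact hz (Sum.inr j)) (fun j => by rw [h0]; exact hz (Sum.inl j))
  have h2 : ContinuousAt (fun ε => scalarProduct η ξ (v ε ∘ Sum.inl) (v ε ∘ Sum.inr)) 0 :=
    continuousAt_scalarProduct η ξ (fun j => hcont _) (fun j => hcont _)
      (fun j => by rw [h0]; exact hz (Sum.inl j)) (fun j => by rw [h0]; exact hz (Sum.inr j))
  have h3 : ∀ᶠ ε in 𝓝[≠] (0 : ℂ), (∀ i j, i ≠ j → sinh (v ε i - v ε j) ≠ 0) ∧
      (∀ i j, i ≠ j → sinh (v ε i - v ε j + η) ≠ 0) ∧ ∀ i m, sinh (v ε i - ξ m + η) ≠ 0 := by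
    simp only [Filter.eventually_and, Filter.eventually_all]
    refine ⟨fun i j hij => ?_, fun i j hij => ?_, fun i m => ?_⟩
    · filter_upwards [eventually_sinh_ne (a := z i - z j) (Or.inr (hc i j hij))] with ε h
      convert h using 2
      ring
    · filter_upwards [eventually_sinh_ne (a := z i - z j + η) (Or.inr (hc i j hij))] with ε h
      convert h using 2
      ring
    · filter_upwards [eventually_sinh_ne (k := c i) (Or.inl (hz i m))] with ε h
      convert h using 2
      ring
  have h4 := tendsto_nhds_unique_of_eventuallyEq (l := 𝓝[≠] (0 : ℂ))
    (h1.tendsto.mono_left nhdsWithin_le_nhds) (h2.tendsto.mono_left nhdsWithin_le_nhds)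
    (h3.mono fun ε h => scalarProduct_comm_of_generic h.1 h.2.1 h.2.2)
  rw [h0] at h4
  exact h4

theorem opC_eq_zero {M : ℕ} {η : ℂ} (hη0 : sinh η = 0) (ξ : Fin M → ℂ) (u : ℂ) : opC η ξ u = 0 := by
  rw [opC_eq]
  induction sites M with
  | nil => simp [monodromyMatrix]
  | cons m s ih =>
    rw [monodromyMatrix_cons, Matrix.mul_apply, Fin.sum_univ_two, ih]
    simp [lax, hη0]

/-- Both `opC` and `tFun` carry a factor sinh η, so for N > 0 both sides vanish; for N = 0 both are
1. -/
theorem scalarProduct_eq_det_of_sinh_eq_zero {M N : ℕ} {η : ℂ} (hη0 : sinh η = 0) (ξ : Fin M → ℂ)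
    (l μ : Fin N → ℂ) :
    scalarProduct η ξ μ l = (-1 : ℂ) ^ (N * (N - 1) / 2) *
      ((∏ a, ∏ b, sinh (l a - μ b + η)) /
        (∏ a, ∏ b ∈ Finset.Ioi a, sinh (l a - l b) * sinh (μ b - μ a))) *
      (psiMatrix η ξ μ l).det := by
  rcases N with _ | n
  · simp [scalarProduct, vacuumExpectation]
  · have h1 : psiMatrix η ξ μ l = 0 := by
      ext i k
      simp [psiMatrix, tFun, hη0]
    rw [h1, Matrix.det_zero, mul_zero, scalarProduct, List.ofFn_succ, List.prod_cons,
      opC_eq_zero hη0, zero_mul, zero_mul, vacuumExpectation]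
    simp

theorem continuousAt_psiMatrix {M N : ℕ} {η : ℂ} {ξ : Fin M → ℂ} {l : Fin N → ℂ}
    {μ : ℂ → Fin N → ℂ} (hc : ∀ k, ContinuousAt (fun ε => μ ε k) 0)
    (hμ : ∀ j m, sinh (μ 0 j - ξ m + η) ≠ 0) (hlm : ∀ a b, sinh (l a - μ 0 b) ≠ 0)
    (hlm' : ∀ a b, sinh (l a - μ 0 b + η) ≠ 0) (hml' : ∀ a b, sinh (μ 0 b - l a + η) ≠ 0) :
    ContinuousAt (fun ε => psiMatrix η ξ (μ ε) l) 0 := by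
  have hs : ∀ k a, ContinuousAt (fun ε => sinh (μ ε k - a)) 0 := fun k a =>
    Complex.continuous_sinh.continuousAt.comp ((hc k).sub continuousAt_const)
  have hs' : ∀ k a b, ContinuousAt (fun ε => sinh (μ ε k - a + b)) 0 := fun k a b =>
    Complex.continuous_sinh.continuousAt.comp (((hc k).sub continuousAt_const).add
      continuousAt_const)
  have hl : ∀ k a, ContinuousAt (fun ε => sinh (a - μ ε k)) 0 := fun k a =>
    Complex.continuous_sinh.continuousAt.comp (continuousAt_const.sub (hc k))
  have hl' : ∀ k a b, ContinuousAt (fun ε => sinh (a - μ ε k + b)) 0 := fun k a b =>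
    Complex.continuous_sinh.continuousAt.comp ((continuousAt_const.sub (hc k)).add
      continuousAt_const)
  have hml : ∀ a b, sinh (μ 0 b - l a) ≠ 0 := fun a b => by
    rw [← neg_sub, Complex.sinh_neg]
    exact neg_ne_zero.mpr (hlm a b)
  have hml'' : ∀ a b, sinh (μ 0 b - l a - η) ≠ 0 := fun a b => by
    rw [show μ 0 b - l a - η = -(l a - μ 0 b + η) by ring, Complex.sinh_neg]
    exact neg_ne_zero.mpr (hlm' a b)
  refine continuousAt_pi.mpr fun j => continuousAt_pi.mpr fun k => ContinuousAt.sub ?_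
    (((continuousAt_const.mul ?_).mul ?_).mul ?_)
  · exact continuousAt_const.div ((hl k _).mul (hl' k _ _)) (mul_ne_zero (hlm j k) (hlm' j k))
  · exact tendsto_finsetProd _ fun m _ => (hs k _).div (hs' k _ _) (hμ k m)
  · exact continuousAt_const.div ((hs k _).mul (hs' k _ _)) (mul_ne_zero (hml j k) (hml' j k))
  · refine tendsto_finsetProd _ fun a _ => (hs' k _ _).div ?_ (hml'' a k)
    simpa only [sub_eq_add_neg] using hs' k (l a) (-η)

/-- The determinant formula, for Bethe roots `l`. -/
theorem scalarProduct_eq_det {M N : ℕ} {η : ℂ} {ξ : Fin M → ℂ} {l μ : Fin N → ℂ}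
    (hl : IsBetheRoots η ξ l) (hμ : ∀ j m, sinh (μ j - ξ m + η) ≠ 0)
    (hll : ∀ a b, a ≠ b → sinh (l a - l b) ≠ 0) (hmm : ∀ a b, a ≠ b → sinh (μ a - μ b) ≠ 0)
    (hlm : ∀ a b, sinh (l a - μ b) ≠ 0) (hlm' : ∀ a b, sinh (l a - μ b + η) ≠ 0)
    (hml' : ∀ a b, sinh (μ b - l a + η) ≠ 0) :
    scalarProduct η ξ μ l = (-1 : ℂ) ^ (N * (N - 1) / 2) *
      ((∏ a, ∏ b, sinh (l a - μ b + η)) /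
        (∏ a, ∏ b ∈ Finset.Ioi a, sinh (l a - l b) * sinh (μ b - μ a))) *
      (psiMatrix η ξ μ l).det := by
  by_cases hη0 : sinh η = 0
  · exact scalarProduct_eq_det_of_sinh_eq_zero hη0 ξ l μ
  rw [scalarProduct_comm hl.regular_site hμ]
  have hll' : ∀ a b, sinh (l a - l b + η) ≠ 0 := fun a b => by
    rcases eq_or_ne b a with rfl | hab
    · simpa using hη0
    · rw [show l a - l b + η = -(l b - l a - η) by ring, Complex.sinh_neg]
      exact neg_ne_zero.mpr (hl.regular_pair b a hab)
  -- Only the μ are moved, because the Bethe roots must remain on shell. Distinct speeds restore the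
  -- one condition not assumed, sinh(μ_a − μ_b + η) ≠ 0 for a ≠ b.
  set v : ℂ → Fin N → ℂ := fun ε k => μ k + (k : ℕ) * ε with hv
  have h0 : v 0 = μ := by
    ext k
    simp [hv]
  have hc : ∀ k, ContinuousAt (fun ε => v ε k) 0 := fun k =>
    (continuous_const.add (continuous_const.mul continuous_id)).continuousAt
  have hcast : ∀ a b : Fin N, a ≠ b → ((a : ℕ) : ℂ) - (b : ℕ) ≠ 0 := fun a b hab =>
    sub_ne_zero.mpr fun h => hab (Fin.ext (Nat.cast_injective h))
  have hgen : ∀ᶠ ε in 𝓝[≠] (0 : ℂ), (∀ j m, sinh (v ε j - ξ m + η) ≠ 0) ∧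
      (∀ a b, a ≠ b → sinh (v ε a - v ε b) ≠ 0) ∧ (∀ a b, sinh (v ε a - v ε b + η) ≠ 0) ∧
      (∀ a b, sinh (l a - v ε b) ≠ 0) ∧ (∀ a b, sinh (l a - v ε b + η) ≠ 0) ∧
      ∀ a b, sinh (v ε b - l a + η) ≠ 0 := by
    simp only [Filter.eventually_and, Filter.eventually_all]
    refine ⟨fun j m => ?_, fun a b hab => ?_, fun a b => ?_, fun a b => ?_, fun a b => ?_,
      fun a b => ?_⟩
    · filter_upwards [eventually_sinh_ne (k := (j : ℕ)) (Or.inl (hμ j m))] with ε h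
      convert h using 2
      ring
    · filter_upwards [eventually_sinh_ne (a := μ a - μ b) (Or.inr (hcast a b hab))] with ε h
      convert h using 2
      ring
    · have : sinh (μ a - μ b + η) ≠ 0 ∨ ((a : ℕ) : ℂ) - (b : ℕ) ≠ 0 := by
        rcases eq_or_ne a b with rfl | hab
        · exact Or.inl (by simpa using hη0)
        · exact Or.inr (hcast a b hab)
      filter_upwards [eventually_sinh_ne this] with ε h
      convert h using 2
      ring
    · filter_upwards [eventually_sinh_ne (k := -(b : ℕ)) (Or.inl (hlm a b))] with ε h
      convert h using 2
      ring
    · filter_upwards [eventually_sinh_ne (k := -(b : ℕ)) (Or.inl (hlm' a b))] with ε h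
      convert h using 2
      ring
    · filter_upwards [eventually_sinh_ne (k := (b : ℕ)) (Or.inl (hml' a b))] with ε h
      convert h using 2
      ring
  have hS : ContinuousAt (fun ε => scalarProduct η ξ l (v ε)) 0 :=
    continuousAt_scalarProduct η ξ (fun _ => continuousAt_const) hc hl.regular_site
      (by rw [h0]; exact hμ)
  have hden : ∏ a, ∏ b ∈ Finset.Ioi a, sinh (l a - l b) * sinh (v 0 b - v 0 a) ≠ 0 := by
    rw [h0]
    refine Finset.prod_ne_zero_iff.mpr fun a _ => Finset.prod_ne_zero_iff.mpr fun b hb => ?_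
    have hab := (Finset.mem_Ioi.mp hb).ne
    exact mul_ne_zero (hll a b hab) (hmm b a hab.symm)
  have hΨ : ContinuousAt (fun ε => (psiMatrix η ξ (v ε) l).det) 0 := by
    have : ContinuousAt (fun ε => psiMatrix η ξ (v ε) l) 0 := by
      refine continuousAt_psiMatrix hc ?_ ?_ ?_ ?_
      all_goals rw [h0]; assumption
    exact (continuous_id.matrix_det).continuousAt.comp this
  have hA : ContinuousAt (fun ε => ∏ a, ∏ b, sinh (l a - v ε b + η)) 0 :=
    tendsto_finsetProd _ fun a _ => tendsto_finsetProd _ fun b _ =>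
      Complex.continuous_sinh.continuousAt.comp
        ((continuousAt_const.sub (hc b)).add continuousAt_const)
  have hB : ContinuousAt (fun ε =>
      ∏ a, ∏ b ∈ Finset.Ioi a, sinh (l a - l b) * sinh (v ε b - v ε a)) 0 :=
    tendsto_finsetProd _ fun a _ => tendsto_finsetProd _ fun b _ =>
      continuousAt_const.mul (Complex.continuous_sinh.continuousAt.comp ((hc b).sub (hc a)))
  have hD := ((continuousAt_const (y := (-1 : ℂ) ^ (N * (N - 1) / 2))).mul
    (hA.div hB hden)).mul hΨ
  have h := tendsto_nhds_unique_of_eventuallyEq (l := 𝓝[≠] (0 : ℂ))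
    (hS.tendsto.mono_left nhdsWithin_le_nhds) (hD.tendsto.mono_left nhdsWithin_le_nhds)
    (hgen.mono fun ε h => scalarProduct_eq_det_of_generic hl h.1 hη0 hll hll' h.2.1 h.2.2.1
      h.2.2.2.1 h.2.2.2.2.1 h.2.2.2.2.2)
  simp only [Pi.mul_apply, Pi.div_apply, h0] at h
  exact h

end SpinlessFermion

open SpinlessFermion Complex in
theorem mainTheorem5 (M N : ℕ) (hN : N ≤ M) (η : ℂ) (ξ : Fin M → ℂ) (l μ : Fin N → ℂ)
    (hl : IsBetheRoots η ξ l)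
    (hμ : ∀ j m, sinh (μ j - ξ m + η) ≠ 0) :
    scalarProduct η ξ μ l = scalarProduct η ξ l μ ∧
    ((∀ a b, a ≠ b → sinh (l a - l b) ≠ 0) →
      (∀ a b, a ≠ b → sinh (μ a - μ b) ≠ 0) →
      (∀ a b, sinh (l a - μ b) ≠ 0) →
      (∀ a b, sinh (l a - μ b + η) ≠ 0) →
      (∀ a b, sinh (μ b - l a + η) ≠ 0) →
      scalarProduct η ξ μ l =
        (-1 : ℂ) ^ (N * (N - 1) / 2) *
          ((∏ a, ∏ b, sinh (l a - μ b + η)) /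
            (∏ a, ∏ b ∈ Finset.Ioi a, sinh (l a - l b) * sinh (μ b - μ a))) *
          (psiMatrix η ξ μ l).det) :=
  ⟨scalarProduct_comm hl.regular_site hμ, scalarProduct_eq_det hl hμ⟩
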